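/- Let $U(a,z)$ be the parabolic cylinder function $$U(a,z)=\sqrt\pi\,2^{-a/2}\Big[\frac{2^{-1/4}y_1(a,z)}{\Gamma(\frac34+\frac a2)}-\frac{2^{1/4}y_2(a,z)}{\Gamma(\frac14+\frac a2)}\Big],$$ $y_1=e^{-z^2/4}{}_1F_1(\frac a2+\frac14,\frac12;\frac{z^2}2)$, $y_2=ze^{-z^2/4}{}_1F_1(\frac a2+\frac34,\frac32;\frac{z^2}2)$. For $\lambda\ge 0$ let $\phi(w)=w+\frac12w^2-\lambda\ln w$, $w_0=\frac12(\sqrt{1+4\lambda}-1)$ and $A=\frac12w_0^2+w_0-\lambda\ln w_0-\lambda+\lambda\ln\lambda$ ($A=0$ if $\lambda=0$). For each $t>0$ there is a unique $w=w(t)>0$ such that $\phi(w)=t-\lambda\ln t+A$ and such that $w-w_0$ and $t-\lambda$ have the same sign. For $t>0$, $t\ne\lambda$, put $$f_0(t)=(1+4\lambda)^{1/4}\sqrt{\frac wt}\,\frac{t-\lambda}{w^2+w-\lambda},\qquad f_{k+1}(t)=\sqrt t\,\frac{d}{dt}\Big[\sqrt t\,\frac{f_k(t)-f_k(\lambda)}{t-\lambda}\Big],\quad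 k\ge0,$$ where $f_k(\lambda)=\lim_{t\to\lambda,\ t>0,\ t\ne\lambda}f_k(t)$. (1) All $f_k$ are well defined: for every $\lambda\ge0$ and $k$, the function $f_k$ is $C^\infty$ on $(0,\infty)\setminus\{\lambda\}$ and the limit $f_k(\lambda)$ exists. For $a\ge0$, $z>0$ put $\lambda=a/z^2$, $\sigma=\frac12\big[1+z/\sqrt{4a+z^2}\big]$, $\rho=(2\sigma-1)^2/\sigma$. (2) $\sigma\in[0,1]$, and for every $k$ there is a polynomial $p_k$ of degree exactly $2k$, independent of $a,z$, with $f_k(\lambda)=\rho^k p_k(\sigma)$ for all $a\ge0$, $z>0$. (3) $\rho/z^2>0$, and $\rho/z^2\to0$ as $z\to\infty$ uniformly in $a\ge0$ and as $a\to\infty$ uniformly in $z>0$. For every $N\ge0$ there are constants $C,R$ such that for all $a\ge0$, $z>0$ with $z\ge R$ or $a\ge R$, $$\Big|\frac{U(a,z)}{e^{-z^2/4-Az^2}z^{-a-1/2}(1+4\lambda)^{-1/4}}-\sum_{k=0}^{N-1}\frac{f_k(\lambda)}{z^{2k}}\Big|\le C\Big(\frac{\rho}{z^2}\Big)^N .$$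 (4) Let $\varphi_0=1$, $\varphi_{s+1}(\tau)=-4\tau^2(\tau+1)^2\varphi_s'(\tau)-\frac14\int_0^\tau(20u^2+20u+3)\varphi_s(u)\,du$, and $\tilde\tau=\frac12\big[\frac t{\sqrt{1+t^2}}-1\big]$, $\tilde\xi=\frac12\big[t\sqrt{1+t^2}+\ln(t+\sqrt{1+t^2})\big]$, $\tilde h(\mu)=e^{\mu^2/4}\mu^{-\mu^2/2-1/2}2^{\mu^2/4-1/4}$. With $a=\frac12\mu^2$, $z=\mu\sqrt2\,t$, $\mu>0$, $t>0$ (so that $\lambda=1/(4t^2)$), the leading factor in (3) equals $\tilde h(\mu)e^{-\mu^2\tilde\xi}(1+t^2)^{-1/4}$, and for all $k$ $$\frac{(-1)^k}{(2t^2)^k}f_k(\lambda)=\varphi_k(\tilde\tau).$$ In these variables the expansion extends to $z=0$: for every $N\ge0$ there are $C,R$ such that for all $\mu>0$, $t\ge0$ with $\mu\ge R$ or $\mu t\ge R$, $$\Big|\frac{U(\frac12\mu^2,\mu\sqrt2\,t)}{\tilde h(\mu)e^{-\mu^2\tilde\xi}(1+t^2)^{-1/4}}-\sum_{k=0}^{N-1}(-1)^k\frac{\varphi_k(\tilde\tau)}{\mu^{2k}}\Big|\le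 C\Big(\frac{|\tilde\tau|}{\mu^2}\Big)^N .$$ -/

import Mathlib

open scoped Topology ContDiff

noncomputable section

namespace ParabolicCylinder

/-- The Kummer (confluent hypergeometric) series `₁F₁(a, c; x) = ∑ (a)ₙ / (c)ₙ · xⁿ / n!`. -/
def kummer (a c x : ℝ) : ℝ :=
  ∑' n : ℕ, (ascPochhammer ℝ n).eval a / (ascPochhammer ℝ n).eval c * (x ^ n / (n.factorial : ℝ))

/-- The even solution of `y'' = (z²/4 + a) y` with `y(0) = 1`. -/
def y₁ (a z : ℝ) : ℝ :=
  Real.exp (-z ^ 2 / 4) * kummer (a / 2 + 1 / 4) (1 / 2) (z ^ 2 / 2)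

/-- The odd solution of `y'' = (z²/4 + a) y` with `y'(0) = 1`. -/
def y₂ (a z : ℝ) : ℝ :=
  z * Real.exp (-z ^ 2 / 4) * kummer (a / 2 + 3 / 4) (3 / 2) (z ^ 2 / 2)

/-- The parabolic cylinder function `U(a, z)`. -/
def U (a z : ℝ) : ℝ :=
  √Real.pi * (2 : ℝ) ^ (-a / 2) *
    ((2 : ℝ) ^ (-(1 / 4) : ℝ) * y₁ a z / Real.Gamma (3 / 4 + a / 2)
      - (2 : ℝ) ^ (1 / 4 : ℝ) * y₂ a z / Real.Gamma (1 / 4 + a / 2))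

/-- The phase `φ(w) = w + w²/2 - l log w`. -/
def phase (l w : ℝ) : ℝ := w + w ^ 2 / 2 - l * Real.log w

/-- The saddle point `w₀` of `phase l`. -/
def saddle (l : ℝ) : ℝ := (√(1 + 4 * l) - 1) / 2

/-- The constant `A`; for `l = 0` it is `0`, the limit of the expression as `l ↓ 0`. -/
def A (l : ℝ) : ℝ :=
  saddle l ^ 2 / 2 + saddle l - l * Real.log (saddle l) - l + l * Real.log l

/-- The solution `w = w(t)` of `φ(w) = t - l log t + A`, on the branch `w ≥ w₀` if `t ≥ l`
and on the branch `0 < w ≤ w₀` if `0 < t < l`. -/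
def w (l t : ℝ) : ℝ :=
  if l ≤ t then
    Function.invFunOn (phase l) (Set.Ici (saddle l)) (t - l * Real.log t + A l)
  else
    Function.invFunOn (phase l) (Set.Ioc 0 (saddle l)) (t - l * Real.log t + A l)

/-- The value at `t = l` of a function given for `t > 0`, `t ≠ l`, by its limit. -/
def valueAt (l : ℝ) (g : ℝ → ℝ) : ℝ := Filter.limUnder (𝓝[Set.Ioi 0 \ {l}] l) g

/-- The functions `f_k(t)`, for `t > 0`, `t ≠ l`:
`f_0(t) = (1 + 4l)^{1/4} √(w/t) (t - l) / (w² + w - l)` and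
`f_{k+1}(t) = √t d/dt [√t (f_k(t) - f_k(l)) / (t - l)]`.
The point `t = l` is a removable singularity, so `f_k(l)` is the limit there. -/
def f (l : ℝ) : ℕ → ℝ → ℝ
  | 0 => fun t =>
      (1 + 4 * l) ^ (1 / 4 : ℝ) * √(w l t / t) * ((t - l) / (w l t ^ 2 + w l t - l))
  | k + 1 => fun t =>
      √t * deriv (fun s => √s * ((f l k s - valueAt l (f l k)) / (s - l))) t

/-- The coefficient `f_k(l)`. -/
def coeff (k : ℕ) (l : ℝ) : ℝ := valueAt l (f l k)

/-- `σ = (1 + z / √(4a + z²)) / 2`. -/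
def sigma (a z : ℝ) : ℝ := (1 + z / √(4 * a + z ^ 2)) / 2

/-- `ρ = (2σ - 1)² / σ`. -/
def rho (a z : ℝ) : ℝ := (2 * sigma a z - 1) ^ 2 / sigma a z

/-- The factor `e^{-z²/4 - A z²} z^{-a-1/2} (1 + 4l)^{-1/4}`, `l = a / z²`, for `z > 0`. -/
def leading (a z : ℝ) : ℝ :=
  Real.exp (-z ^ 2 / 4 - A (a / z ^ 2) * z ^ 2) * z ^ (-a - 1 / 2)
    * (1 + 4 * (a / z ^ 2)) ^ (-(1 / 4) : ℝ)

/-- The functions `φ_s` with `φ_0 = 1` and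
`φ_{s+1}(τ) = -4 τ² (τ+1)² φ_s'(τ) - (1/4) ∫_0^τ (20u² + 20u + 3) φ_s(u) du`. -/
def phi : ℕ → ℝ → ℝ
  | 0 => fun _ => 1
  | s + 1 => fun τ =>
      -4 * τ ^ 2 * (τ + 1) ^ 2 * deriv (phi s) τ
        - 1 / 4 * ∫ u in (0 : ℝ)..τ, (20 * u ^ 2 + 20 * u + 3) * phi s u

/-- `τ̃ = (t / √(1 + t²) - 1) / 2`. -/
def tau (t : ℝ) : ℝ := (t / √(1 + t ^ 2) - 1) / 2

/-- `ξ̃ = (t √(1 + t²) + log (t + √(1 + t²))) / 2`. -/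
def xi (t : ℝ) : ℝ := (t * √(1 + t ^ 2) + Real.log (t + √(1 + t ^ 2))) / 2

/-- `h̃(μ) = e^{μ²/4} μ^{-μ²/2 - 1/2} 2^{μ²/4 - 1/4}`, for `μ > 0`. -/
def h (μ : ℝ) : ℝ :=
  Real.exp (μ ^ 2 / 4) * μ ^ (-μ ^ 2 / 2 - 1 / 2) * (2 : ℝ) ^ (μ ^ 2 / 4 - 1 / 4)

/-- The factor `h̃(μ) e^{-μ² ξ̃} / (t² + 1)^{1/4}`. -/
def leadingOlver (μ t : ℝ) : ℝ :=
  h μ * Real.exp (-μ ^ 2 * xi t) / (t ^ 2 + 1) ^ (1 / 4 : ℝ)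

end ParabolicCylinder

end

/-!
The coefficients `f_k(l)` and `φ_k(τ)` come from two different expansions of `U`. The uniform error
bounds are proved for the expansion with `φ_k`, which satisfies a differential equation; the
coefficients `f_k(l)` are then identified by comparing the two along the rays `a = l z²`.

Integral representation. Expanding `e^{-z s}` in
`J_b(z) = ∫_0^∞ s^b e^{-s²/2 - z s} ds` gives the two Kummer series, and the duplication formula
yields `U(a, z) = e^{-z²/4} J_{a-1/2}(z) / Γ(a + 1/2)` for `a ≥ 0` (`U_eq_J`). This gives Weber's
equation `U'' = (z²/4 + a) U` (`hasDerivAt_dU`) and `U / leading → 1` as `z → ∞`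
(`tendsto_U_div_leading`).

Uniform expansion. With `a = μ²/2`, `z = μ √2 t` and `ξ = xi t` as independent variable,
`V = U / leadingOlver` satisfies `V'' = 2 μ² V' + ψ V` with `|ψ|` at most a multiple of `dτ/dξ`
(`exists_deriv_U_div_leadingOlver`, `abs_psi_le`). The recursion for `φ_k` is the corresponding
transport equation (`derivXi_phiPoly_succ`), so the error `E = V - ∑_{k < N} (-1)^k φ_k(τ) μ^{-2k}`
satisfies the same equation up to an inhomogeneous term in `φ_N'(τ) dτ/dξ`. As `φ_N` has a zero of
order `N` at `τ = 0` (`exists_phiPoly_eq`) and `E → 0` at infinity, integrating twice from infinity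
(`abs_le_of_inhomogeneous`) bounds `E` by a constant times `(|τ| / μ²)^N` plus a fraction less than
`1` of the supremum of `|E|` (`exists_abs_U_div_leadingOlver_sub_le`). Since
`ρ / z² = 2 |τ| / μ²` and `σ = τ + 1`, this is an expansion in `ρ / z²` with the coefficients
`p_k(σ) = φ_k(σ - 1) / (2 (σ - 1))^k`, polynomials of degree `2k`; the case `a = 0` follows by
letting `a ↓ 0` (`exists_abs_U_div_leading_sub_le`).

The functions `f_k`. Near their minima the phases `t - l log t` and `φ(w)` are, up to constants,
squares of analytic coordinates, which makes `w` analytic at `t = l` (`analyticAt_w_self`). Hence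
`f_0` extends analytically to `t = l`, and the `f_k` are the iterates of `stepOp l`, an operator
that preserves analyticity (`f_eq_iterate`). Substituting `s = w(t)` in the integral representation
turns `U / leading` into the mean of `f_0` with respect to a Gamma density
(`U_div_leading_eq_mean`), and each integration by parts near `t = l` replaces `f_k` by
`f_k(l) + z^{-2} f_{k+1}` (`integral_stepOp`). So, for fixed `l`, the `f_k(l)` are the coefficients
of an asymptotic expansion in `z^{-2}` along `a = l z²` (`exists_abs_U_div_leading_sub_coeff_le`).
Along this ray `ρ` and `σ` are constant, and uniqueness of asymptotic expansions gives
`f_k(l) = ρ^k p_k(σ)` (`coeff_eq`).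
-/

namespace ParabolicCylinder

open MeasureTheory Set Filter

/-! ### The integral representation of `U` -/

/-- The integral `J_b(z) = ∫_0^∞ s^b e^{-s²/2 - z s} ds`, convergent for `b > -1`. -/
noncomputable def J (b z : ℝ) : ℝ := ∫ s in Ioi (0 : ℝ), s ^ b * Real.exp (-s ^ 2 / 2 - z * s)

lemma aestronglyMeasurable_J_integrand (b z : ℝ) :
    AEStronglyMeasurable (fun s : ℝ => s ^ b * Real.exp (-s ^ 2 / 2 - z * s))
      (volume.restrict (Ioi 0)) := by
  apply Measurable.aestronglyMeasurable
  fun_prop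

lemma integrableOn_J {b : ℝ} (hb : -1 < b) (z : ℝ) :
    IntegrableOn (fun s : ℝ => s ^ b * Real.exp (-s ^ 2 / 2 - z * s)) (Ioi 0) := by
  -- `-s²/2 - z s ≤ z² - s²/4`.
  have h := (integrableOn_rpow_mul_exp_neg_mul_sq (b := 1 / 4) (by norm_num) hb).const_mul
    (Real.exp (z ^ 2))
  refine Integrable.mono' h (aestronglyMeasurable_J_integrand b z) ?_
  filter_upwards [ae_restrict_mem measurableSet_Ioi] with s hs
  have hs' : (0 : ℝ) < s := hs
  rw [Real.norm_of_nonneg (by positivity)]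
  have : Real.exp (-s ^ 2 / 2 - z * s) ≤ Real.exp (z ^ 2) * Real.exp (-(1 / 4) * s ^ 2) := by
    rw [← Real.exp_add]
    apply Real.exp_le_exp.2
    nlinarith [sq_nonneg (s / 2 + z)]
  calc s ^ b * Real.exp (-s ^ 2 / 2 - z * s)
      ≤ s ^ b * (Real.exp (z ^ 2) * Real.exp (-(1 / 4) * s ^ 2)) := by gcongr
    _ = _ := by ring

lemma J_nonneg (b z : ℝ) : 0 ≤ J b z :=
  setIntegral_nonneg measurableSet_Ioi fun s hs => by
    have : (0 : ℝ) < s := hs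
    positivity

lemma J_le_of_nonneg {b z : ℝ} (hb : -1 < b) (hz : 0 ≤ z) : J b z ≤ J b 0 := by
  refine setIntegral_mono_on (integrableOn_J hb z) (integrableOn_J hb 0) measurableSet_Ioi ?_
  intro s hs
  have hs' : (0 : ℝ) < s := hs
  gcongr

lemma hasDerivAt_J {b : ℝ} (hb : -1 < b) (z : ℝ) : HasDerivAt (J b) (-J (b + 1) z) z := by
  -- For `|x - z| < 1` the derivative of the integrand at `x` is dominated by its value at `z - 1`.
  have key := hasDerivAt_integral_of_dominated_loc_of_deriv_le
    (μ := volume.restrict (Ioi (0 : ℝ))) (x₀ := z) (s := Metric.ball z 1)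
    (F := fun z s => s ^ b * Real.exp (-s ^ 2 / 2 - z * s))
    (F' := fun z s => -(s ^ (b + 1) * Real.exp (-s ^ 2 / 2 - z * s)))
    (bound := fun s => s ^ (b + 1) * Real.exp (-s ^ 2 / 2 - (z - 1) * s))
    (Metric.ball_mem_nhds z one_pos)
    (Eventually.of_forall fun z => aestronglyMeasurable_J_integrand b z)
    (integrableOn_J hb z) (aestronglyMeasurable_J_integrand (b + 1) z).neg
    (by
      filter_upwards [ae_restrict_mem measurableSet_Ioi] with s hs x hx
      have hs' : (0 : ℝ) < s := hs
      rw [norm_neg, Real.norm_of_nonneg (by positivity)]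
      rw [Metric.mem_ball, Real.dist_eq, abs_lt] at hx
      gcongr
      linarith)
    (integrableOn_J (by linarith) _)
    (by
      filter_upwards [ae_restrict_mem measurableSet_Ioi] with s hs x hx
      have hs' : (0 : ℝ) < s := hs
      have h1 : HasDerivAt (fun x : ℝ => -s ^ 2 / 2 - x * s) (-s) x := by
        simpa using ((hasDerivAt_id x).mul_const s).const_sub (-s ^ 2 / 2)
      have h2 := (h1.exp).const_mul (s ^ b)
      refine h2.congr_deriv ?_
      rw [Real.rpow_add_one hs'.ne']
      ring)
  have h := key.2
  rw [integral_neg] at h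
  exact h

/-- The recurrence coming from `∫ d/ds (s^{b+1} e^{-s²/2 - z s}) ds = 0`. -/
lemma J_recurrence {b : ℝ} (hb : -1 < b) (z : ℝ) :
    (b + 1) * J b z = z * J (b + 1) z + J (b + 2) z := by
  set g : ℝ → ℝ := fun s => s ^ (b + 1) * Real.exp (-s ^ 2 / 2 - z * s) with hg
  set g' : ℝ → ℝ := fun s => (b + 1) * (s ^ b * Real.exp (-s ^ 2 / 2 - z * s))
    - z * (s ^ (b + 1) * Real.exp (-s ^ 2 / 2 - z * s))
    - s ^ (b + 2) * Real.exp (-s ^ 2 / 2 - z * s) with hg'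
  have i0 := integrableOn_J hb z
  have i1 := integrableOn_J (b := b + 1) (by linarith) z
  have i2 := integrableOn_J (b := b + 2) (by linarith) z
  have hder : ∀ s ∈ Ioi (0 : ℝ), HasDerivAt g (g' s) s := by
    intro s hs
    have hs' : (0 : ℝ) < s := hs
    have h1 : HasDerivAt (fun s : ℝ => -s ^ 2 / 2 - z * s) (-s - z) s := by
      have := (((hasDerivAt_id s).pow 2).neg.div_const 2).sub ((hasDerivAt_id s).const_mul z)
      refine this.congr_deriv ?_
      simp
      ring
    have h2 := (Real.hasDerivAt_rpow_const (p := b + 1) (Or.inl hs'.ne')).mul h1.exp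
    refine h2.congr_deriv ?_
    simp only [hg']
    rw [show b + 2 = b + 1 + 1 by ring, Real.rpow_add_one hs'.ne' (b + 1),
      show b + 1 - 1 = b by ring]
    ring
  have i01 : IntegrableOn (fun s => (b + 1) * (s ^ b * Real.exp (-s ^ 2 / 2 - z * s))
      - z * (s ^ (b + 1) * Real.exp (-s ^ 2 / 2 - z * s))) (Ioi 0) :=
    (i0.const_mul (b + 1)).sub (i1.const_mul z)
  have gint : IntegrableOn g' (Ioi 0) := i01.sub i2
  have h0 : Tendsto g atTop (𝓝 0) :=
    tendsto_zero_of_hasDerivAt_of_integrableOn_Ioi hder gint i1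
  have hc : ContinuousWithinAt g (Ici 0) 0 := by
    apply Continuous.continuousWithinAt
    have : Continuous fun s : ℝ => s ^ (b + 1) := Real.continuous_rpow_const (by linarith)
    fun_prop
  have := integral_Ioi_of_hasDerivAt_of_tendsto hc hder gint h0
  have e : g 0 = 0 := by simp [hg, Real.zero_rpow (by linarith : b + 1 ≠ 0)]
  rw [e, hg'] at this
  rw [integral_sub i01 i2,
    integral_sub (i0.const_mul (b + 1)) (i1.const_mul z), integral_const_mul,
    integral_const_mul] at this
  simp only [J]
  linarith

lemma integral_rpow_mul_exp_neg_half_sq {q : ℝ} (hq : -1 < q) :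
    ∫ s in Ioi (0 : ℝ), s ^ q * Real.exp (-s ^ 2 / 2)
      = (2 : ℝ) ^ ((q - 1) / 2) * Real.Gamma ((q + 1) / 2) := by
  have h := integral_rpow_mul_exp_neg_mul_rpow (p := 2) (q := q) (b := 1 / 2)
    (by norm_num) hq (by norm_num)
  have e : ∀ s : ℝ, Real.exp (-s ^ 2 / 2) = Real.exp (-(1 / 2) * s ^ (2 : ℝ)) := by
    intro s
    rw [Real.rpow_two]
    ring_nf
  simp_rw [e]
  rw [h]
  congr 1
  rw [one_div, Real.inv_rpow (by norm_num), ← Real.rpow_neg (by norm_num)]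
  have : (2 : ℝ) ^ (-(-(q + 1) / 2)) = 2 ^ ((q - 1) / 2) * 2 := by
    rw [← Real.rpow_add_one (by norm_num)]
    ring_nf
  rw [this]
  ring

/-- Term-by-term integration of the power series of `e^{-z s}`. -/
lemma hasSum_J {b : ℝ} (hb : -1 < b) (z : ℝ) :
    HasSum (fun n : ℕ => (-z) ^ n / n.factorial *
      ((2 : ℝ) ^ ((b + n - 1) / 2) * Real.Gamma ((b + n + 1) / 2))) (J b z) := by
  have hexp : ∀ x : ℝ, HasSum (fun n : ℕ => x ^ n / n.factorial) (Real.exp x) := by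
    intro x
    rw [Real.exp_eq_exp_ℝ]
    exact NormedSpace.exp_series_hasSum_exp' (𝕂 := ℝ) x |>.congr_fun (by
      intro n; simp [div_eq_inv_mul])
  -- The series of absolute values sums to the integrand of `J b (-|z|)`.
  have key := hasSum_integral_of_dominated_convergence
    (μ := volume.restrict (Ioi (0 : ℝ)))
    (F := fun (n : ℕ) s => s ^ b * Real.exp (-s ^ 2 / 2) * ((-z * s) ^ n / n.factorial))
    (f := fun s => s ^ b * Real.exp (-s ^ 2 / 2 - z * s))
    (fun n s => s ^ b * Real.exp (-s ^ 2 / 2) * ((|z| * s) ^ n / n.factorial))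
    (by
      intro n
      apply Measurable.aestronglyMeasurable
      fun_prop)
    (by
      intro n
      filter_upwards [ae_restrict_mem measurableSet_Ioi] with s hs
      have hs' : (0 : ℝ) < s := hs
      rw [norm_mul, norm_div, norm_pow, Real.norm_of_nonneg (by positivity :
        0 ≤ s ^ b * Real.exp (-s ^ 2 / 2)), norm_mul, norm_neg, Real.norm_eq_abs z,
        Real.norm_of_nonneg hs'.le, Real.norm_of_nonneg (by positivity : (0 : ℝ) ≤ n.factorial)])
    (by
      refine Eventually.of_forall fun s => ?_
      exact ((hexp (|z| * s)).mul_left _).summable)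
    (by
      have := integrableOn_J hb (-|z|)
      refine this.congr (Eventually.of_forall fun s => ?_)
      change _ = ∑' n : ℕ, _
      rw [((hexp (|z| * s)).mul_left _).tsum_eq, mul_assoc, ← Real.exp_add]
      ring_nf)
    (by
      refine Eventually.of_forall fun s => ?_
      have := (hexp (-z * s)).mul_left (s ^ b * Real.exp (-s ^ 2 / 2))
      rwa [mul_assoc, ← Real.exp_add,
        show -s ^ 2 / 2 + -z * s = -s ^ 2 / 2 - z * s by ring] at this)
  refine key.congr_fun fun n => ?_
  have e : ∫ s in Ioi (0 : ℝ), s ^ b * Real.exp (-s ^ 2 / 2) * ((-z * s) ^ n / n.factorial)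
      = ∫ s in Ioi (0 : ℝ), (-z) ^ n / n.factorial * (s ^ (b + n) * Real.exp (-s ^ 2 / 2)) := by
    refine setIntegral_congr_fun measurableSet_Ioi fun s hs => ?_
    have hs' : (0 : ℝ) < s := hs
    rw [Real.rpow_add hs', Real.rpow_natCast, mul_pow]
    ring
  rw [e, integral_const_mul, integral_rpow_mul_exp_neg_half_sq]
  have : (0 : ℝ) ≤ n := n.cast_nonneg
  linarith

lemma Gamma_add_nat_eq {x : ℝ} (hx : 0 < x) (m : ℕ) :
    Real.Gamma (x + m) = (ascPochhammer ℝ m).eval x * Real.Gamma x := by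
  induction m with
  | zero => simp
  | succ m ih =>
    have : (0 : ℝ) ≤ m := m.cast_nonneg
    rw [Nat.cast_succ, ← add_assoc, Real.Gamma_add_one (by positivity), ih,
      ascPochhammer_succ_eval]
    ring

lemma factorial_two_mul_eq (m : ℕ) :
    ((2 * m).factorial : ℝ) = 4 ^ m * m.factorial * (ascPochhammer ℝ m).eval (1 / 2) := by
  induction m with
  | zero => simp
  | succ m ih =>
    rw [show 2 * (m + 1) = 2 * m + 1 + 1 by ring, Nat.factorial_succ, Nat.factorial_succ,
      Nat.factorial_succ, ascPochhammer_succ_eval]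
    push_cast
    rw [ih]
    ring

lemma factorial_two_mul_add_one_eq (m : ℕ) :
    ((2 * m + 1).factorial : ℝ) = 4 ^ m * m.factorial * (ascPochhammer ℝ m).eval (3 / 2) := by
  induction m with
  | zero => simp
  | succ m ih =>
    rw [show 2 * (m + 1) + 1 = 2 * m + 1 + 1 + 1 by ring, Nat.factorial_succ, Nat.factorial_succ,
      Nat.factorial_succ m, ascPochhammer_succ_eval]
    push_cast
    rw [ih]
    ring

/-- The even and odd parts of the power series of `J_{a-1/2}` are the two Kummer series. -/
lemma J_eq_kummer {a : ℝ} (ha : 0 ≤ a) (z : ℝ) :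
    J (a - 1 / 2) z
      = (2 : ℝ) ^ (a / 2 - 3 / 4) * Real.Gamma (a / 2 + 1 / 4)
          * kummer (a / 2 + 1 / 4) (1 / 2) (z ^ 2 / 2)
        - (2 : ℝ) ^ (a / 2 - 1 / 4) * Real.Gamma (a / 2 + 3 / 4)
          * (z * kummer (a / 2 + 3 / 4) (3 / 2) (z ^ 2 / 2)) := by
  have hS := hasSum_J (b := a - 1 / 2) (by linarith) z
  set u : ℕ → ℝ := fun n => (-z) ^ n / n.factorial *
      ((2 : ℝ) ^ ((a - 1 / 2 + n - 1) / 2) * Real.Gamma ((a - 1 / 2 + n + 1) / 2)) with hu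
  have he : Summable fun m : ℕ => u (2 * m) :=
    hS.summable.comp_injective (fun x y h => by simpa using h)
  have ho : Summable fun m : ℕ => u (2 * m + 1) :=
    hS.summable.comp_injective (fun x y h => by simpa using h)
  rw [← hS.tsum_eq, ← tsum_even_add_odd he ho, sub_eq_add_neg]
  congr 1
  · rw [kummer, ← tsum_mul_left]
    refine tsum_congr fun m => ?_
    have h1 : ((a - 1 / 2 + ((2 * m : ℕ) : ℝ) - 1) / 2) = (a / 2 - 3 / 4) + m := by
      push_cast; ring
    have h2 : ((a - 1 / 2 + ((2 * m : ℕ) : ℝ) + 1) / 2) = (a / 2 + 1 / 4) + m := by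
      push_cast; ring
    simp only [hu]
    rw [h1, h2, Gamma_add_nat_eq (by positivity), factorial_two_mul_eq,
      Real.rpow_add (by norm_num), Real.rpow_natCast, pow_mul, neg_sq, div_pow,
      show (4 : ℝ) ^ m = 2 ^ m * 2 ^ m by rw [← mul_pow]; norm_num]
    have : (ascPochhammer ℝ m).eval (1 / 2) ≠ 0 := (ascPochhammer_pos m _ (by norm_num)).ne'
    have : (m.factorial : ℝ) ≠ 0 := by positivity
    field_simp
  · rw [kummer, ← tsum_mul_left, ← tsum_mul_left, ← tsum_neg]
    refine tsum_congr fun m => ?_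
    have h1 : ((a - 1 / 2 + ((2 * m + 1 : ℕ) : ℝ) - 1) / 2) = (a / 2 - 1 / 4) + m := by
      push_cast; ring
    have h2 : ((a - 1 / 2 + ((2 * m + 1 : ℕ) : ℝ) + 1) / 2) = (a / 2 + 3 / 4) + m := by
      push_cast; ring
    simp only [hu]
    rw [h1, h2, Gamma_add_nat_eq (by positivity), factorial_two_mul_add_one_eq,
      Real.rpow_add (by norm_num), Real.rpow_natCast, pow_succ, pow_mul, neg_sq, div_pow,
      show (4 : ℝ) ^ m = 2 ^ m * 2 ^ m by rw [← mul_pow]; norm_num]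
    have : (ascPochhammer ℝ m).eval (3 / 2) ≠ 0 := (ascPochhammer_pos m _ (by norm_num)).ne'
    have : (m.factorial : ℝ) ≠ 0 := by positivity
    field_simp

/-- `U(a, z) = e^{-z²/4} / Γ(a + 1/2) ∫_0^∞ s^{a-1/2} e^{-s²/2 - z s} ds`. -/
lemma U_eq_J {a : ℝ} (ha : 0 ≤ a) (z : ℝ) :
    U a z = Real.exp (-z ^ 2 / 4) / Real.Gamma (a + 1 / 2) * J (a - 1 / 2) z := by
  have hG : 0 < Real.Gamma (a + 1 / 2) := Real.Gamma_pos_of_pos (by positivity)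
  have hG1 : 0 < Real.Gamma (a / 2 + 1 / 4) := Real.Gamma_pos_of_pos (by positivity)
  have hG3 : 0 < Real.Gamma (a / 2 + 3 / 4) := Real.Gamma_pos_of_pos (by positivity)
  have hdup := Real.Gamma_mul_Gamma_add_half (a / 2 + 1 / 4)
  rw [show a / 2 + 1 / 4 + 1 / 2 = a / 2 + 3 / 4 by ring,
    show 2 * (a / 2 + 1 / 4) = a + 1 / 2 by ring,
    show 1 - (a + 1 / 2) = (1 / 2 - a) by ring] at hdup
  have hp : (0 : ℝ) < 2 ^ (1 / 2 - a) := by positivity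
  rw [J_eq_kummer ha, U, y₁, y₂, show 3 / 4 + a / 2 = a / 2 + 3 / 4 by ring,
    show 1 / 4 + a / 2 = a / 2 + 1 / 4 by ring]
  have e1 : (2 : ℝ) ^ (a / 2 - 3 / 4) = 2 ^ (-a / 2) * 2 ^ (-(1 / 4) : ℝ) / 2 ^ (1 / 2 - a) := by
    rw [← Real.rpow_add (by norm_num), ← Real.rpow_sub (by norm_num)]; ring_nf
  have e2 : (2 : ℝ) ^ (a / 2 - 1 / 4) = 2 ^ (-a / 2) * 2 ^ (1 / 4 : ℝ) / 2 ^ (1 / 2 - a) := by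
    rw [← Real.rpow_add (by norm_num), ← Real.rpow_sub (by norm_num)]; ring_nf
  have hpi : √Real.pi = Real.Gamma (a / 2 + 1 / 4) * Real.Gamma (a / 2 + 3 / 4)
      / (Real.Gamma (a + 1 / 2) * 2 ^ (1 / 2 - a)) := by
    rw [hdup]; field_simp
  rw [e1, e2, hpi]
  field_simp

/-! ### The leading factor -/

/-- The ratio `w₀ / l`, in a form that is regular at `l = 0`. -/
noncomputable def saddleRatio (l : ℝ) : ℝ := 2 / (1 + √(1 + 4 * l))

lemma saddleRatio_pos (l : ℝ) : 0 < saddleRatio l := by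
  unfold saddleRatio; positivity

lemma saddle_eq_mul {l : ℝ} (hl : 0 ≤ l) : saddle l = l * saddleRatio l := by
  have h := Real.sq_sqrt (by positivity : 0 ≤ 1 + 4 * l)
  rw [saddle, saddleRatio]
  field_simp
  linear_combination h

lemma saddle_sq {l : ℝ} (hl : 0 ≤ l) : saddle l ^ 2 + saddle l = l := by
  have h := Real.sq_sqrt (by positivity : 0 ≤ 1 + 4 * l)
  rw [saddle]
  linear_combination h / 4

/-- A form of `A` that is regular at `l = 0`. -/
lemma A_eq {l : ℝ} (hl : 0 ≤ l) :
    A l = l * (saddleRatio l / 2 - 1 / 2 - Real.log (saddleRatio l)) := by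
  rcases hl.eq_or_lt with rfl | hl'
  · simp [A, saddle]
  · have h1 := saddle_sq hl
    have h2 := saddle_eq_mul hl
    have h3 : Real.log (saddle l) = Real.log l + Real.log (saddleRatio l) := by
      rw [h2, Real.log_mul hl'.ne' (saddleRatio_pos l).ne']
    rw [A, h3]
    linear_combination h1 / 2 + h2 / 2

lemma continuous_saddleRatio : Continuous saddleRatio := by
  unfold saddleRatio
  refine continuous_const.div (by fun_prop) fun l => ?_
  positivity

lemma continuous_saddleRatio_combination :
    Continuous fun l => saddleRatio l / 2 - 1 / 2 - Real.log (saddleRatio l) :=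
  ((continuous_saddleRatio.div_const 2).sub continuous_const).sub
    (continuous_saddleRatio.log fun l => (saddleRatio_pos l).ne')

lemma add_sqrt_one_add_sq_pos (t : ℝ) : 0 < t + √(1 + t ^ 2) := by
  have : |t| < √(1 + t ^ 2) := Real.lt_sqrt_of_sq_lt (by rw [sq_abs]; linarith)
  linarith [neg_abs_le t]

/-- In the variables `a = μ²/2`, `z = μ √2 t` the two leading factors agree. -/
lemma leading_eq_leadingOlver {μ t : ℝ} (hμ : 0 < μ) (ht : 0 < t) :
    leading (μ ^ 2 / 2) (μ * √2 * t) = leadingOlver μ t := by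
  set θ := √(1 + t ^ 2) with hθ
  have hθ2 : θ ^ 2 = 1 + t ^ 2 := Real.sq_sqrt (by positivity)
  have hθ0 : 0 < θ := by positivity
  have hz2 : (μ * √2 * t) ^ 2 = 2 * μ ^ 2 * t ^ 2 := by
    rw [mul_pow, mul_pow, Real.sq_sqrt (by norm_num)]; ring
  have hl : μ ^ 2 / 2 / (2 * μ ^ 2 * t ^ 2) = 1 / (4 * t ^ 2) := by field_simp; norm_num
  have hr : saddleRatio (1 / (4 * t ^ 2)) = 2 * t / (t + θ) := by
    have : √(1 + 4 * (1 / (4 * t ^ 2))) = θ / t := by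
      rw [hθ, ← Real.sqrt_sq ht.le, ← Real.sqrt_div (by positivity), Real.sqrt_sq ht.le]
      congr 1
      field_simp
      ring
    rw [saddleRatio, this]
    field_simp
  have hq : (1 + 4 * (1 / (4 * t ^ 2))) = (t ^ 2 + 1) / t ^ 2 := by field_simp
  have hlogr : Real.log (2 * t / (t + θ)) = Real.log 2 + Real.log t - Real.log (t + θ) := by
    rw [Real.log_div (by positivity) (by positivity), Real.log_mul (by norm_num) ht.ne']
  have hrr : 2 * t / (t + θ) = 2 * t * (θ - t) := by
    field_simp; linear_combination -hθ2
  have hlogz : Real.log (μ * √2 * t) = Real.log μ + Real.log 2 / 2 + Real.log t := by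
    rw [Real.log_mul (by positivity) ht.ne', Real.log_mul hμ.ne' (by positivity),
      Real.log_sqrt (by norm_num)]
  have hlogq : Real.log ((t ^ 2 + 1) / t ^ 2) = Real.log (t ^ 2 + 1) - 2 * Real.log t := by
    rw [Real.log_div (by positivity) (by positivity), Real.log_pow]; norm_num
  -- Both sides are written as exponentials of combinations of `log 2`, `log μ`, `log t`,
  -- `log (t + θ)` and `log (t² + 1)`.
  rw [leading, leadingOlver, h, hz2, hl, A_eq (by positivity), hr, hlogr, hrr, hq,
    Real.rpow_def_of_pos (by positivity : 0 < μ * √2 * t), hlogz,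
    Real.rpow_def_of_pos (by positivity : 0 < (t ^ 2 + 1) / t ^ 2), hlogq,
    Real.rpow_def_of_pos hμ, Real.rpow_def_of_pos (by norm_num : (0 : ℝ) < 2),
    Real.rpow_def_of_pos (by positivity : 0 < t ^ 2 + 1), ← Real.exp_add, ← Real.exp_add,
    ← Real.exp_add, ← Real.exp_add, ← Real.exp_add, ← Real.exp_sub, xi, ← hθ]
  congr 1
  field_simp
  ring

/-- Rescaling the variable of integration in `J`. -/
lemma J_scale (b z : ℝ) {c : ℝ} (hc : 0 < c) :
    J b z = c ^ (b + 1) *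
      ∫ s in Ioi (0 : ℝ), s ^ b * Real.exp (-c ^ 2 * s ^ 2 / 2 - z * c * s) := by
  have h := integral_comp_mul_left_Ioi
    (fun s : ℝ => s ^ b * Real.exp (-s ^ 2 / 2 - z * s)) 0 hc
  rw [mul_zero, smul_eq_mul] at h
  have h2 : ∫ s in Ioi (0 : ℝ), (c * s) ^ b * Real.exp (-(c * s) ^ 2 / 2 - z * (c * s))
      = c ^ b * ∫ s in Ioi (0 : ℝ), s ^ b * Real.exp (-c ^ 2 * s ^ 2 / 2 - z * c * s) := by
    rw [← integral_const_mul]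
    refine setIntegral_congr_fun measurableSet_Ioi fun s hs => ?_
    have hs' : (0 : ℝ) < s := hs
    rw [Real.mul_rpow hc.le hs'.le, mul_pow, mul_assoc]
    ring_nf
  rw [h2] at h
  rw [Real.rpow_add_one hc.ne', mul_right_comm, h, J]
  field_simp

/-- Watson's lemma for `J`, to leading order. -/
lemma tendsto_rpow_mul_J {a : ℝ} (ha : 0 ≤ a) :
    Tendsto (fun z : ℝ => z ^ (a + 1 / 2) * J (a - 1 / 2) z) atTop
      (𝓝 (Real.Gamma (a + 1 / 2))) := by
  have hG : Real.Gamma (a + 1 / 2) = ∫ s in Ioi (0 : ℝ), s ^ (a - 1 / 2) * Real.exp (-s) := by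
    rw [Real.Gamma_eq_integral (by positivity)]
    refine setIntegral_congr_fun measurableSet_Ioi fun s _ => ?_
    rw [mul_comm, show a + 1 / 2 - 1 = a - 1 / 2 by ring]
  have hint : IntegrableOn (fun s : ℝ => s ^ (a - 1 / 2) * Real.exp (-s)) (Ioi 0) := by
    have := Real.GammaIntegral_convergent (s := a + 1 / 2) (by positivity)
    refine this.congr_fun (fun s _ => ?_) measurableSet_Ioi
    simp only
    rw [mul_comm, show a + 1 / 2 - 1 = a - 1 / 2 by ring]
  rw [hG]
  have hlim : Tendsto (fun z : ℝ => ∫ s in Ioi (0 : ℝ),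
      s ^ (a - 1 / 2) * Real.exp (-(z⁻¹) ^ 2 * s ^ 2 / 2 - s)) atTop
      (𝓝 (∫ s in Ioi (0 : ℝ), s ^ (a - 1 / 2) * Real.exp (-s))) := by
    refine tendsto_integral_filter_of_dominated_convergence
      (fun s => s ^ (a - 1 / 2) * Real.exp (-s)) ?_ ?_ hint ?_
    · refine Eventually.of_forall fun z => Measurable.aestronglyMeasurable ?_
      fun_prop
    · refine Eventually.of_forall fun z => ?_
      filter_upwards [ae_restrict_mem measurableSet_Ioi] with s hs
      have hs' : (0 : ℝ) < s := hs
      rw [Real.norm_of_nonneg (by positivity)]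
      have : 0 ≤ (z⁻¹) ^ 2 * s ^ 2 / 2 := by positivity
      gcongr
      linarith
    · refine Eventually.of_forall fun s => ?_
      have : Tendsto (fun z : ℝ => -(z⁻¹) ^ 2 * s ^ 2 / 2 - s) atTop (𝓝 (-0 ^ 2 * s ^ 2 / 2 - s)) :=
        (((tendsto_inv_atTop_zero.pow 2).neg.mul_const _).div_const _).sub_const _
      simp only [ne_eq, OfNat.ofNat_ne_zero, not_false_eq_true, zero_pow, neg_zero, zero_mul,
        zero_div, zero_sub] at this
      exact ((Real.continuous_exp.tendsto _).comp this).const_mul _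
  -- The substitution `s ↦ s / z` in `J`.
  refine hlim.congr' ?_
  filter_upwards [eventually_gt_atTop 0] with z hz
  rw [J_scale _ z (inv_pos.2 hz), ← mul_assoc, show a - 1 / 2 + 1 = a + 1 / 2 by ring,
    ← Real.mul_rpow hz.le (by positivity), mul_inv_cancel₀ hz.ne', Real.one_rpow, one_mul]
  simp_rw [one_mul]

lemma U_div_leading {a z : ℝ} (ha : 0 ≤ a) (hz : 0 < z) :
    U a z / leading a z = z ^ (a + 1 / 2) * J (a - 1 / 2) z / Real.Gamma (a + 1 / 2)
      * Real.exp (A (a / z ^ 2) * z ^ 2) * (1 + 4 * (a / z ^ 2)) ^ (1 / 4 : ℝ) := by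
  have hq : 0 < 1 + 4 * (a / z ^ 2) := by positivity
  rw [U_eq_J ha, leading, Real.rpow_neg hq.le, Real.exp_sub,
    show -a - 1 / 2 = -(a + 1 / 2) by ring, Real.rpow_neg hz.le]
  field_simp

/-- `U(a, z)` is asymptotic to the leading factor as `z → ∞` with `a` fixed. -/
lemma tendsto_U_div_leading {a : ℝ} (ha : 0 ≤ a) :
    Tendsto (fun z => U a z / leading a z) atTop (𝓝 1) := by
  have hl : Tendsto (fun z : ℝ => a / z ^ 2) atTop (𝓝 0) :=
    tendsto_const_nhds.div_atTop (tendsto_pow_atTop two_ne_zero)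
  have hA : Tendsto (fun z : ℝ => A (a / z ^ 2) * z ^ 2) atTop (𝓝 0) := by
    have h1 := (continuous_saddleRatio_combination.tendsto 0).comp hl
    have h2 := h1.const_mul a
    have e : a * (saddleRatio 0 / 2 - 1 / 2 - Real.log (saddleRatio 0)) = 0 := by
      norm_num [saddleRatio]
    rw [e] at h2
    refine h2.congr' ?_
    filter_upwards [eventually_gt_atTop 0] with z hz
    rw [A_eq (by positivity)]
    simp only [Function.comp]
    field_simp
  have hq : Tendsto (fun z : ℝ => (1 + 4 * (a / z ^ 2)) ^ (1 / 4 : ℝ)) atTop (𝓝 1) := by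
    have h1 := ((hl.const_mul 4).const_add 1).rpow_const (p := 1 / 4) (Or.inr (by norm_num))
    simpa using h1
  have hG : 0 < Real.Gamma (a + 1 / 2) := Real.Gamma_pos_of_pos (by positivity)
  have := (((tendsto_rpow_mul_J ha).div_const (Real.Gamma (a + 1 / 2))).mul
    ((Real.continuous_exp.tendsto _).comp hA)).mul hq
  rw [div_self hG.ne', Real.exp_zero, one_mul, one_mul] at this
  refine this.congr' ?_
  filter_upwards [eventually_gt_atTop 0] with z hz
  rw [U_div_leading ha hz]
  rfl

lemma tendsto_U_div_leadingOlver {μ : ℝ} (hμ : 0 < μ) :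
    Tendsto (fun t => U (μ ^ 2 / 2) (μ * √2 * t) / leadingOlver μ t) atTop (𝓝 1) := by
  have h1 := (tendsto_U_div_leading (a := μ ^ 2 / 2) (by positivity)).comp
    (tendsto_id.const_mul_atTop (by positivity : 0 < μ * √2))
  refine h1.congr' ?_
  filter_upwards [eventually_gt_atTop 0] with t ht
  simp only [Function.comp, id]
  rw [leading_eq_leadingOlver hμ ht]

/-! ### The polynomials `φ_s` -/

open Polynomial in
/-- The antiderivative of a polynomial that vanishes at `0`. -/
noncomputable def antideriv (p : ℝ[X]) : ℝ[X] :=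
  ∑ n ∈ Finset.range (p.natDegree + 1), monomial (n + 1) (p.coeff n / (n + 1))

open Polynomial in
lemma coeff_antideriv_succ (p : ℝ[X]) (m : ℕ) :
    (antideriv p).coeff (m + 1) = p.coeff m / (m + 1) := by
  simp only [antideriv, finsetSum_coeff, coeff_monomial, Nat.add_right_cancel_iff]
  rw [Finset.sum_ite_eq']
  split_ifs with h
  · rfl
  · rw [Finset.mem_range, not_lt] at h
    rw [coeff_eq_zero_of_natDegree_lt (by omega), zero_div]

open Polynomial in
lemma coeff_antideriv_zero (p : ℝ[X]) : (antideriv p).coeff 0 = 0 := by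
  simp [antideriv, coeff_monomial]

open Polynomial in
lemma derivative_antideriv (p : ℝ[X]) : derivative (antideriv p) = p := by
  ext m
  rw [coeff_derivative, coeff_antideriv_succ]
  field_simp

open Polynomial in
/-- The functions `φ_s` as polynomials. -/
noncomputable def phiPoly : ℕ → ℝ[X]
  | 0 => 1
  | s + 1 => -4 * X ^ 2 * (X + 1) ^ 2 * derivative (phiPoly s)
      - C (1 / 4) * antideriv ((20 * X ^ 2 + 20 * X + 3) * phiPoly s)

open Polynomial in
lemma phi_eq_eval (s : ℕ) (τ : ℝ) : phi s τ = (phiPoly s).eval τ := by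
  induction s generalizing τ with
  | zero => simp [phi, phiPoly]
  | succ s ih =>
    have hf : phi s = fun τ => (phiPoly s).eval τ := funext ih
    have hint : ∫ u in (0 : ℝ)..τ, (20 * u ^ 2 + 20 * u + 3) * (phiPoly s).eval u
        = (antideriv ((20 * X ^ 2 + 20 * X + 3) * phiPoly s)).eval τ := by
      rw [intervalIntegral.integral_eq_sub_of_hasDerivAt
        (f := fun u => (antideriv ((20 * X ^ 2 + 20 * X + 3) * phiPoly s)).eval u)]
      · simp [← coeff_zero_eq_eval_zero, coeff_antideriv_zero]
      · intro u _
        have := (antideriv ((20 * X ^ 2 + 20 * X + 3) * phiPoly s)).hasDerivAt u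
        rw [derivative_antideriv] at this
        simpa using this
      · apply Continuous.intervalIntegrable
        fun_prop
    rw [phi, phiPoly, hf]
    beta_reduce
    rw [hint, Polynomial.deriv]
    simp

open Polynomial in
/-- `φ_s` has a zero of order at least `s` at `0`, and its cofactor has degree exactly `2s`. -/
lemma exists_phiPoly_eq (s : ℕ) :
    ∃ q : ℝ[X], phiPoly s = X ^ s * q ∧ q.degree = ((2 * s : ℕ) : WithBot ℕ) := by
  have hdvd : ∀ s, X ^ s ∣ phiPoly s := by
    intro s
    induction s with
    | zero => simp
    | succ s ih =>
      have hd : X ^ (s + 1) ∣ -4 * X ^ 2 * (X + 1) ^ 2 * derivative (phiPoly s) := by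
        obtain ⟨q, hq⟩ := ih
        rcases s with _ | s
        · rw [phiPoly]; simp
        · rw [hq, derivative_mul, derivative_X_pow]
          refine ⟨-4 * (X + 1) ^ 2 * (C ((s + 1 : ℕ) : ℝ) * q + X * derivative q), ?_⟩
          simp only [Nat.add_sub_cancel]
          ring
      have hi : X ^ (s + 1) ∣ antideriv ((20 * X ^ 2 + 20 * X + 3) * phiPoly s) := by
        rw [X_pow_dvd_iff]
        intro d hd
        rcases d with _ | d
        · exact coeff_antideriv_zero _
        · rw [coeff_antideriv_succ, X_pow_dvd_iff.1 (ih.mul_left _) d (by omega), zero_div]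
      rw [phiPoly]
      exact dvd_sub hd (hi.mul_left _)
  have hdeg : ∀ s, (phiPoly s).natDegree ≤ 3 * s ∧ (phiPoly s).coeff (3 * s) ≠ 0 := by
    intro s
    induction s with
    | zero => simp [phiPoly]
    | succ s ih =>
      obtain ⟨ih1, ih2⟩ := ih
      set c := (phiPoly s).coeff (3 * s)
      have h4 : -4 * X ^ 2 * (X + 1) ^ 2 = (C (-4) * X ^ 2 * (X + 1) ^ 2 : ℝ[X]) := by
        rw [C_neg]; rfl
      have h20 : (20 * X ^ 2 + 20 * X + 3 : ℝ[X]) = C 20 * X ^ 2 + C 20 * X + C 3 := rfl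
      have hp4 : (C (-4) * X ^ 2 * (X + 1) ^ 2 : ℝ[X]).natDegree ≤ 4 := by compute_degree
      have hc4 : (C (-4) * X ^ 2 * (X + 1) ^ 2 : ℝ[X]).coeff 4 = -4 := by
        rw [show (C (-4) * X ^ 2 * (X + 1) ^ 2 : ℝ[X])
          = C (-4) * (X ^ 4 + X ^ 3 + X ^ 3 + X ^ 2) by ring, coeff_C_mul]
        simp [coeff_X_pow]
      have hp2 : (C 20 * X ^ 2 + C 20 * X + C 3 : ℝ[X]).natDegree ≤ 2 := by compute_degree
      have hc2 : (C 20 * X ^ 2 + C 20 * X + C 3 : ℝ[X]).coeff 2 = 20 := by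
        simp only [coeff_add, coeff_C_mul, coeff_X_pow, coeff_X, coeff_C]
        norm_num
      have hpd : (C (-4) * X ^ 2 * (X + 1) ^ 2 * derivative (phiPoly s)).natDegree ≤ 3 * (s + 1) ∧
          (C (-4) * X ^ 2 * (X + 1) ^ 2 * derivative (phiPoly s)).coeff (3 * (s + 1))
            = -4 * (c * (3 * s)) := by
        rcases s with _ | s
        · simp [phiPoly]
        · have hd : (derivative (phiPoly (s + 1))).natDegree ≤ 3 * s + 2 :=
            (natDegree_derivative_le _).trans (by omega)
          refine ⟨natDegree_mul_le.trans (by omega), ?_⟩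
          rw [show 3 * (s + 1 + 1) = 4 + (3 * s + 2) by ring,
            coeff_mul_add_eq_of_natDegree_le hp4 hd, hc4, coeff_derivative]
          simp only [c]
          push_cast
          rw [show 3 * s + 2 + 1 = 3 * (s + 1) by ring]
          ring
      have hpi : ((C 20 * X ^ 2 + C 20 * X + C 3) * phiPoly s).natDegree ≤ 2 + 3 * s :=
        natDegree_mul_le.trans (by omega)
      have hci : ((C 20 * X ^ 2 + C 20 * X + C 3) * phiPoly s).coeff (2 + 3 * s) = 20 * c := by
        rw [coeff_mul_add_eq_of_natDegree_le hp2 ih1, hc2]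
      rw [phiPoly, h4, h20]
      constructor
      · refine (natDegree_sub_le _ _).trans (max_le hpd.1 ?_)
        refine natDegree_mul_le.trans ?_
        rw [natDegree_C, zero_add, natDegree_le_iff_coeff_eq_zero]
        intro m hm
        rcases m with _ | m
        · omega
        · rw [coeff_antideriv_succ, coeff_eq_zero_of_natDegree_lt (by omega), zero_div]
      · rw [coeff_sub, hpd.2, coeff_C_mul, show 3 * (s + 1) = 2 + 3 * s + 1 by ring,
          coeff_antideriv_succ, hci]
        push_cast
        -- The two terms of the recursion contribute with the same sign, so they cannot cancel.
        have : -4 * (c * (3 * s)) - 1 / 4 * (20 * c / (2 + 3 * s + 1))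
            = -c * (12 * s + 5 / (3 * s + 3)) := by
          field_simp
          ring
        rw [this]
        have : (0 : ℝ) < 12 * s + 5 / (3 * s + 3) := by positivity
        exact mul_ne_zero (neg_ne_zero.2 ih2) this.ne'
  obtain ⟨q, hq⟩ := hdvd s
  refine ⟨q, hq, ?_⟩
  have hc : q.coeff (2 * s) ≠ 0 := by
    have := (hdeg s).2
    rwa [hq, show 3 * s = 2 * s + s by ring, coeff_X_pow_mul] at this
  refine le_antisymm ?_ (le_degree_of_ne_zero hc)
  rw [degree_le_iff_coeff_zero]
  intro m hm
  have := coeff_eq_zero_of_natDegree_lt (p := phiPoly s) (n := m + s) (by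
    have := (hdeg s).1
    have : 2 * s < m := by exact_mod_cast hm
    omega)
  rwa [hq, coeff_X_pow_mul] at this

/-! ### The differential equation in Liouville–Green variables -/

/-- The derivative of `U(a, z)` in `z`. -/
noncomputable def dU (a z : ℝ) : ℝ :=
  Real.exp (-z ^ 2 / 4) / Real.Gamma (a + 1 / 2)
    * (-(z / 2) * J (a - 1 / 2) z - J (a + 1 / 2) z)

lemma hasDerivAt_exp_neg_sq_div_four (z : ℝ) :
    HasDerivAt (fun z : ℝ => Real.exp (-z ^ 2 / 4)) (-(z / 2) * Real.exp (-z ^ 2 / 4)) z := by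
  have h1 : HasDerivAt (fun z : ℝ => -z ^ 2 / 4) (-(z / 2)) z := by
    refine ((hasDerivAt_pow 2 z).neg.div_const 4).congr_deriv ?_
    norm_num
    ring
  refine h1.exp.congr_deriv ?_
  ring

lemma hasDerivAt_U {a : ℝ} (ha : 0 ≤ a) (z : ℝ) : HasDerivAt (U a) (dU a z) z := by
  have h1 := ((hasDerivAt_exp_neg_sq_div_four z).div_const (Real.Gamma (a + 1 / 2))).mul
    (hasDerivAt_J (b := a - 1 / 2) (by linarith) z)
  have e : U a = fun z => Real.exp (-z ^ 2 / 4) / Real.Gamma (a + 1 / 2) * J (a - 1 / 2) z :=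
    funext fun z => U_eq_J ha z
  rw [e]
  refine h1.congr_deriv ?_
  rw [dU, show a - 1 / 2 + 1 = a + 1 / 2 by ring]
  ring

/-- Weber's equation `U'' = (z²/4 + a) U`. -/
lemma hasDerivAt_dU {a : ℝ} (ha : 0 ≤ a) (z : ℝ) :
    HasDerivAt (dU a) ((z ^ 2 / 4 + a) * U a z) z := by
  have h1 := ((hasDerivAt_exp_neg_sq_div_four z).div_const (Real.Gamma (a + 1 / 2))).mul
    (((((hasDerivAt_id z).div_const 2).neg).mul
      (hasDerivAt_J (b := a - 1 / 2) (by linarith) z)).sub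
      (hasDerivAt_J (b := a + 1 / 2) (by linarith) z))
  have hr := J_recurrence (b := a - 1 / 2) (by linarith) z
  refine h1.congr_deriv ?_
  rw [show a - 1 / 2 + 1 = a + 1 / 2 by ring, show a - 1 / 2 + 2 = a + 1 / 2 + 1 by ring] at hr
  rw [U_eq_J ha, show a - 1 / 2 + 1 = a + 1 / 2 by ring]
  simp only [id, Pi.neg_apply, Pi.mul_apply, Pi.sub_apply]
  linear_combination (-Real.exp (-z ^ 2 / 4) / Real.Gamma (a + 1 / 2)) * hr

/-- A crude bound, enough to exclude the solution of Weber's equation that grows at infinity. -/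
lemma exists_abs_dU_le {a : ℝ} (ha : 0 ≤ a) : ∃ C, ∀ z, 0 ≤ z → |dU a z| ≤ C := by
  have hG : 0 < Real.Gamma (a + 1 / 2) := Real.Gamma_pos_of_pos (by positivity)
  refine ⟨(J (a - 1 / 2) 0 + J (a + 1 / 2) 0) / Real.Gamma (a + 1 / 2), fun z hz => ?_⟩
  have hJ1 := J_nonneg (a - 1 / 2) z
  have hJ2 := J_nonneg (a + 1 / 2) z
  have hJ3 := J_le_of_nonneg (b := a - 1 / 2) (by linarith) hz
  have hJ4 := J_le_of_nonneg (b := a + 1 / 2) (by linarith) hz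
  have he1 : Real.exp (-z ^ 2 / 4) ≤ 1 := Real.exp_le_one_iff.2 (by nlinarith [sq_nonneg z])
  have he2 : Real.exp (-z ^ 2 / 4) * (z / 2) ≤ 1 := by
    have h1 : z / 2 ≤ Real.exp (z ^ 2 / 4) := by
      have := Real.add_one_le_exp (z ^ 2 / 4)
      nlinarith [sq_nonneg (z / 2 - 1)]
    have h2 : Real.exp (-z ^ 2 / 4) * Real.exp (z ^ 2 / 4) = 1 := by
      rw [← Real.exp_add, show -z ^ 2 / 4 + z ^ 2 / 4 = 0 by ring, Real.exp_zero]
    rw [← h2]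
    gcongr
  have e : dU a z = -((Real.exp (-z ^ 2 / 4) * (z / 2) * J (a - 1 / 2) z
      + Real.exp (-z ^ 2 / 4) * J (a + 1 / 2) z) / Real.Gamma (a + 1 / 2)) := by
    rw [dU]; ring
  rw [e, abs_neg, abs_of_nonneg (by positivity)]
  gcongr
  · calc _ ≤ 1 * J (a - 1 / 2) z := by gcongr
      _ ≤ _ := by linarith
  · calc _ ≤ 1 * J (a + 1 / 2) z := by gcongr
      _ ≤ _ := by linarith

lemma sqrt_one_add_sq_pos (t : ℝ) : 0 < √(1 + t ^ 2) := by positivity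

lemma sq_sqrt_one_add_sq (t : ℝ) : √(1 + t ^ 2) ^ 2 = 1 + t ^ 2 := Real.sq_sqrt (by positivity)

lemma hasDerivAt_sqrt_one_add_sq (t : ℝ) :
    HasDerivAt (fun t : ℝ => √(1 + t ^ 2)) (t / √(1 + t ^ 2)) t := by
  have h := ((hasDerivAt_pow 2 t).const_add 1).sqrt (by positivity)
  refine h.congr_deriv ?_
  norm_num
  field_simp

lemma hasDerivAt_xi (t : ℝ) : HasDerivAt xi √(1 + t ^ 2) t := by
  have hθ := sqrt_one_add_sq_pos t
  have hθ2 := sq_sqrt_one_add_sq t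
  have hp := add_sqrt_one_add_sq_pos t
  have h1 := hasDerivAt_sqrt_one_add_sq t
  have h2 := (((hasDerivAt_id t).mul h1).add (((hasDerivAt_id t).add h1).log hp.ne')).div_const 2
  refine h2.congr_deriv ?_
  simp only [id, Pi.add_apply]
  field_simp
  linear_combination (-t - √(1 + t ^ 2)) * hθ2

lemma hasDerivAt_tau (t : ℝ) : HasDerivAt tau (1 / (2 * √(1 + t ^ 2) ^ 3)) t := by
  have hθ := sqrt_one_add_sq_pos t
  have hθ2 := sq_sqrt_one_add_sq t
  have h2 := (((hasDerivAt_id t).div (hasDerivAt_sqrt_one_add_sq t) hθ.ne').sub_const 1).div_const 2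
  refine h2.congr_deriv ?_
  simp only [id]
  field_simp
  linear_combination hθ2

lemma tau_mul_tau_add_one (t : ℝ) : tau t * (tau t + 1) = -1 / (4 * √(1 + t ^ 2) ^ 2) := by
  have hθ := sqrt_one_add_sq_pos t
  have hθ2 := sq_sqrt_one_add_sq t
  rw [tau]
  field_simp
  linear_combination -4 * hθ2

lemma tau_neg (t : ℝ) : tau t < 0 := by
  have hθ := sqrt_one_add_sq_pos t
  have : t / √(1 + t ^ 2) < 1 := by
    rw [div_lt_one hθ]
    exact Real.lt_sqrt_of_sq_lt (by linarith)
  rw [tau]; linarith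

lemma neg_half_le_tau {t : ℝ} (ht : 0 ≤ t) : -(1 / 2) ≤ tau t := by
  have : 0 ≤ t / √(1 + t ^ 2) := by positivity
  rw [tau]; linarith

lemma half_mul_self_le_xi {t : ℝ} (ht : 0 ≤ t) : t / 2 ≤ xi t := by
  have h1 : 1 ≤ √(1 + t ^ 2) := Real.one_le_sqrt.2 (by nlinarith)
  have h2 : 0 ≤ Real.log (t + √(1 + t ^ 2)) := Real.log_nonneg (by linarith)
  rw [xi]
  nlinarith

lemma tendsto_tau : Tendsto tau atTop (𝓝 0) := by
  have h : Tendsto (fun t : ℝ => 1 / t) atTop (𝓝 0) := tendsto_const_nhds.div_atTop tendsto_id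
  refine squeeze_zero_norm' ?_ h
  filter_upwards [eventually_gt_atTop 0] with t ht
  rw [Real.norm_eq_abs, abs_of_neg (tau_neg t), tau]
  have : t / √(1 + t ^ 2) ≥ 1 - 1 / t := by
    have h3 : √(1 + t ^ 2) ≤ t + 1 := Real.sqrt_le_iff.2 ⟨by linarith, by nlinarith⟩
    have h4 : t / (t + 1) ≤ t / √(1 + t ^ 2) := by gcongr
    have h5 : 1 - 1 / t ≤ t / (t + 1) := by
      have h6 : t / (t + 1) - (1 - 1 / t) = 1 / (t * (t + 1)) := by field_simp; ring
      have h7 : 0 < 1 / (t * (t + 1)) := by positivity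
      linarith
    linarith
  have : 0 < 1 / t := by positivity
  linarith

/-- The Liouville–Green perturbation `f''/(4 f²) - 5 f'²/(16 f³)` for `f = 1 + t²`. -/
noncomputable def psi (t : ℝ) : ℝ :=
  (2 * √(1 + t ^ 2) ^ 2 - 5 * t ^ 2) / (4 * √(1 + t ^ 2) ^ 6)

/-- With `ξ = xi t` as independent variable the normalized function
`V = U / leadingOlver` satisfies `V'' = 2 μ² V' + ψ V`; here the equation is written as a first
order system for `(V, X)`, `X = dV/dξ`, in the variable `t`, with `dξ/dt = √(1 + t²)`. -/
lemma exists_deriv_U_div_leadingOlver {μ : ℝ} (hμ : 0 < μ) :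
    ∃ X : ℝ → ℝ,
      (∀ t, HasDerivAt (fun t => U (μ ^ 2 / 2) (μ * √2 * t) / leadingOlver μ t)
        (√(1 + t ^ 2) * X t) t) ∧
      (∀ t, HasDerivAt X (√(1 + t ^ 2) * (2 * μ ^ 2 * X t
        + psi t * (U (μ ^ 2 / 2) (μ * √2 * t) / leadingOlver μ t))) t) ∧
      Tendsto (fun t => Real.exp (-(2 * μ ^ 2) * xi t) * X t) atTop (𝓝 0) := by
  have ha : 0 ≤ μ ^ 2 / 2 := by positivity
  set Y : ℝ → ℝ := fun t => U (μ ^ 2 / 2) (μ * √2 * t) with hY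
  set Y1 : ℝ → ℝ := fun t => μ * √2 * dU (μ ^ 2 / 2) (μ * √2 * t) with hY1
  set Z : ℝ → ℝ := fun t => Real.exp (μ ^ 2 * xi t) * (t ^ 2 + 1) ^ (1 / 4 : ℝ) / h μ with hZ
  have hh : 0 < h μ := by unfold h; positivity
  have hlin : ∀ t : ℝ, HasDerivAt (fun t : ℝ => μ * √2 * t) (μ * √2) t := fun t => by
    simpa using (hasDerivAt_id t).const_mul (μ * √2)
  have hYd : ∀ t, HasDerivAt Y (Y1 t) t := fun t => by
    refine ((hasDerivAt_U ha _).comp t (hlin t)).congr_deriv ?_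
    rw [hY1]; ring
  have hY1d : ∀ t, HasDerivAt Y1 (μ ^ 4 * √(1 + t ^ 2) ^ 2 * Y t) t := fun t => by
    refine (((hasDerivAt_dU ha _).comp t (hlin t)).const_mul (μ * √2)).congr_deriv ?_
    have h2 : √2 ^ 2 = (2 : ℝ) := Real.sq_sqrt (by norm_num)
    rw [sq_sqrt_one_add_sq]
    simp only [hY]
    linear_combination (μ ^ 2 * U (μ ^ 2 / 2) (μ * √2 * t)
      * (μ ^ 2 * √2 ^ 2 * t ^ 2 / 4 + 2 * μ ^ 2 * t ^ 2 / 4 + μ ^ 2 / 2)) * h2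
  have hZd : ∀ t, HasDerivAt Z (Z t * (t / (2 * √(1 + t ^ 2) ^ 2) + μ ^ 2 * √(1 + t ^ 2))) t := by
    intro t
    have h1 := ((hasDerivAt_xi t).const_mul (μ ^ 2)).exp
    have hp : 0 < t ^ 2 + 1 := by positivity
    have h2 := ((hasDerivAt_pow 2 t).add_const 1).rpow_const (p := (1 / 4 : ℝ)) (Or.inl hp.ne')
    refine ((h1.mul h2).div_const (h μ)).congr_deriv ?_
    rw [Real.rpow_sub_one hp.ne', sq_sqrt_one_add_sq, hZ]
    field_simp
    norm_num
    ring
  have hV : (fun t => U (μ ^ 2 / 2) (μ * √2 * t) / leadingOlver μ t) = fun t => Z t * Y t := by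
    funext t
    have hp : 0 < t ^ 2 + 1 := by positivity
    simp only [hZ, hY, leadingOlver]
    rw [show -μ ^ 2 * xi t = -(μ ^ 2 * xi t) by ring, Real.exp_neg]
    field_simp
  -- `κ = Z' / (√(1 + t²) Z)`, so that `dV/dξ = Z (κ Y + Y' / √(1 + t²))` for `V = Z Y`.
  set κ : ℝ → ℝ := fun t => t / (2 * √(1 + t ^ 2) ^ 3) + μ ^ 2 with hκ
  have hκd : ∀ t, HasDerivAt κ
      (1 / (2 * √(1 + t ^ 2) ^ 3) - 3 * t ^ 2 / (2 * √(1 + t ^ 2) ^ 5)) t := by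
    intro t
    have hθ := sqrt_one_add_sq_pos t
    have h1 := ((hasDerivAt_id t).div (((hasDerivAt_sqrt_one_add_sq t).pow 3).const_mul 2)
      (show 2 * √(1 + t ^ 2) ^ 3 ≠ 0 by positivity)).add_const (μ ^ 2)
    refine h1.congr_deriv ?_
    simp only [id, Pi.pow_apply]
    field_simp
    norm_num
    ring
  have hiθ : ∀ t : ℝ, HasDerivAt (fun t : ℝ => (√(1 + t ^ 2))⁻¹) (-t / √(1 + t ^ 2) ^ 3) t := by
    intro t
    have hθ := sqrt_one_add_sq_pos t
    refine ((hasDerivAt_sqrt_one_add_sq t).inv hθ.ne').congr_deriv ?_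
    field_simp
  refine ⟨fun t => Z t * (Y t * κ t + Y1 t * (√(1 + t ^ 2))⁻¹), ?_, ?_, ?_⟩
  · intro t
    have hθ := sqrt_one_add_sq_pos t
    rw [hV]
    refine ((hZd t).mul (hYd t)).congr_deriv ?_
    simp only [hκ]
    field_simp
  · intro t
    have hθ := sqrt_one_add_sq_pos t
    refine ((hZd t).mul (((hYd t).mul (hκd t)).add ((hY1d t).mul (hiθ t)))).congr_deriv ?_
    rw [show U (μ ^ 2 / 2) (μ * √2 * t) / leadingOlver μ t = Z t * Y t from congrFun hV t]
    simp only [hκ, psi, Pi.add_apply, Pi.mul_apply]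
    field_simp
    ring
  · obtain ⟨C, hC⟩ := exists_abs_dU_le ha
    have hlim : Tendsto (fun t : ℝ => Real.exp (-(μ ^ 2) * (t / 2))
        * (2 * (1 + μ ^ 2) + μ * √2 * C / h μ)) atTop (𝓝 0) := by
      have h1 : Tendsto (fun t : ℝ => -(μ ^ 2) * (t / 2)) atTop atBot :=
        Tendsto.const_mul_atTop_of_neg (by nlinarith) (tendsto_id.atTop_div_const two_pos)
      have h2 := (Real.tendsto_exp_atBot.comp h1).mul_const
        (2 * (1 + μ ^ 2) + μ * √2 * C / h μ)
      rwa [zero_mul] at h2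
    refine squeeze_zero_norm' ?_ hlim
    have hV1 := tendsto_U_div_leadingOlver hμ
    rw [hV] at hV1
    filter_upwards [eventually_ge_atTop 0, hV1.eventually_le_const one_lt_two,
      hV1.eventually_const_le zero_lt_one] with t ht hV2 hV0
    have hθ1 : 1 ≤ √(1 + t ^ 2) := Real.one_le_sqrt.2 (by nlinarith)
    have hθ := sqrt_one_add_sq_pos t
    have hxi := half_mul_self_le_xi ht
    have hκ0 : 0 ≤ κ t := by simp only [hκ]; positivity
    have hκ1 : κ t ≤ 1 + μ ^ 2 := by
      have : t / (2 * √(1 + t ^ 2) ^ 3) ≤ 1 := by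
        rw [div_le_one (by positivity)]
        have h1 : t ≤ √(1 + t ^ 2) := Real.le_sqrt_of_sq_le (by linarith)
        have h2 : √(1 + t ^ 2) ≤ √(1 + t ^ 2) ^ 3 := le_self_pow₀ hθ1 (by norm_num)
        linarith
      simp only [hκ]; linarith
    have hp : 0 < t ^ 2 + 1 := by positivity
    have hq : (t ^ 2 + 1) ^ (1 / 4 : ℝ) ≤ √(1 + t ^ 2) := by
      rw [Real.sqrt_eq_rpow, add_comm]
      exact Real.rpow_le_rpow_of_exponent_le (by nlinarith) (by norm_num)
    have e : Real.exp (-(2 * μ ^ 2) * xi t) * (Z t * (Y t * κ t + Y1 t * (√(1 + t ^ 2))⁻¹))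
        = Real.exp (-(2 * μ ^ 2) * xi t) * ((Z t * Y t) * κ t)
          + Real.exp (-(μ ^ 2) * xi t)
            * ((t ^ 2 + 1) ^ (1 / 4 : ℝ) * (√(1 + t ^ 2))⁻¹ * Y1 t / h μ) := by
      have : Real.exp (-(2 * μ ^ 2) * xi t) * Real.exp (μ ^ 2 * xi t)
          = Real.exp (-(μ ^ 2) * xi t) := by
        rw [← Real.exp_add]; ring_nf
      rw [← this]
      simp only [hZ]
      ring
    rw [e, mul_add (Real.exp (-(μ ^ 2) * (t / 2)))]
    refine (norm_add_le _ _).trans (add_le_add ?_ ?_)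
    · rw [Real.norm_of_nonneg (by positivity)]
      have : Real.exp (-(2 * μ ^ 2) * xi t) ≤ Real.exp (-(μ ^ 2) * (t / 2)) := by
        apply Real.exp_le_exp.2
        have : 0 ≤ μ ^ 2 := by positivity
        nlinarith
      gcongr
    · rw [norm_mul, Real.norm_of_nonneg (Real.exp_pos _).le, norm_div, norm_mul,
        Real.norm_of_nonneg (by positivity : 0 ≤ (t ^ 2 + 1) ^ (1 / 4 : ℝ) * (√(1 + t ^ 2))⁻¹),
        Real.norm_of_nonneg hh.le]
      have h1 : (t ^ 2 + 1) ^ (1 / 4 : ℝ) * (√(1 + t ^ 2))⁻¹ ≤ 1 := by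
        rw [← div_eq_mul_inv, div_le_one hθ]; exact hq
      have h2 : ‖Y1 t‖ ≤ μ * √2 * C := by
        simp only [hY1]
        rw [norm_mul, Real.norm_of_nonneg (by positivity), Real.norm_eq_abs]
        gcongr
        exact hC _ (by positivity)
      have h3 : Real.exp (-(μ ^ 2) * xi t) ≤ Real.exp (-(μ ^ 2) * (t / 2)) := by
        apply Real.exp_le_exp.2
        have : 0 ≤ μ ^ 2 := by positivity
        nlinarith
      have h4 : (t ^ 2 + 1) ^ (1 / 4 : ℝ) * (√(1 + t ^ 2))⁻¹ * ‖Y1 t‖ ≤ μ * √2 * C :=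
        (mul_le_of_le_one_left (norm_nonneg _) h1).trans h2
      exact mul_le_mul h3 (div_le_div_of_nonneg_right h4 hh.le) (by positivity)
        (Real.exp_pos _).le

/-! ### The expansion in the variables `μ`, `t` -/

/-- If `P` and `Q` tend to `0` at infinity and `|P'| ≤ -Q'`, then `|P| ≤ Q`. This replaces the
estimate of an integral over `[t₀, ∞)`, and no integrability has to be checked. -/
lemma abs_le_of_abs_deriv_le {P P' Q Q' : ℝ → ℝ} {t₀ : ℝ}
    (hP : ∀ t, t₀ ≤ t → HasDerivAt P (P' t) t) (hQ : ∀ t, t₀ ≤ t → HasDerivAt Q (Q' t) t)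
    (hle : ∀ t, t₀ ≤ t → |P' t| ≤ -Q' t)
    (hP0 : Tendsto P atTop (𝓝 0)) (hQ0 : Tendsto Q atTop (𝓝 0)) : |P t₀| ≤ Q t₀ := by
  have aux : ∀ (R R' : ℝ → ℝ), (∀ t, t₀ ≤ t → HasDerivAt R (R' t) t) → (∀ t, t₀ ≤ t → R' t ≤ 0) →
      Tendsto R atTop (𝓝 0) → 0 ≤ R t₀ := by
    intro R R' hR hR' hR0
    have hanti : AntitoneOn R (Ici t₀) := by
      refine antitoneOn_of_deriv_nonpos (convex_Ici _)
        (fun t ht => (hR t ht).continuousAt.continuousWithinAt) ?_ ?_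
      · intro t ht
        rw [interior_Ici] at ht
        exact (hR t (le_of_lt ht)).differentiableAt.differentiableWithinAt
      · intro t ht
        rw [interior_Ici] at ht
        rw [(hR t (le_of_lt ht)).deriv]
        exact hR' t (le_of_lt ht)
    refine le_of_tendsto hR0 ?_
    filter_upwards [eventually_ge_atTop t₀] with t ht
    exact hanti self_mem_Ici ht ht
  have h1 := aux (fun t => Q t - P t) _ (fun t ht => (hQ t ht).sub (hP t ht))
    (fun t ht => by linarith [hle t ht, neg_abs_le (P' t)]) (by simpa using hQ0.sub hP0)
  have h2 := aux (fun t => Q t + P t) _ (fun t ht => (hQ t ht).add (hP t ht))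
    (fun t ht => by linarith [hle t ht, le_abs_self (P' t)]) (by simpa using hQ0.add hP0)
  rw [abs_le]
  constructor <;> linarith

lemma tendsto_xi : Tendsto xi atTop atTop := by
  refine tendsto_atTop_mono' _ ?_ (tendsto_id.atTop_div_const two_pos)
  filter_upwards [eventually_ge_atTop 0] with t ht using half_mul_self_le_xi ht

lemma tau_monotone : Monotone tau :=
  monotone_of_deriv_nonneg (fun t => (hasDerivAt_tau t).differentiableAt) fun t => by
    rw [(hasDerivAt_tau t).deriv]; positivity

/-- A priori bound for the solution `E → 0` of `d²E/dξ² = 2 κ dE/dξ + r`, in the variable `t` with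
`dξ/dt = √(1 + t²)`, when `|r|` is at most `(c₁ + c₂ |τ|ⁿ) dτ/dξ`. -/
lemma abs_le_of_inhomogeneous {E E1 r : ℝ → ℝ} {κ c₁ c₂ t₀ : ℝ} {n : ℕ} (hκ : 0 < κ)
    (ht₀ : 0 ≤ t₀) (hc₁ : 0 ≤ c₁) (hc₂ : 0 ≤ c₂)
    (hE : ∀ t, t₀ ≤ t → HasDerivAt E (√(1 + t ^ 2) * E1 t) t)
    (hE1 : ∀ t, t₀ ≤ t → HasDerivAt E1 (√(1 + t ^ 2) * (2 * κ * E1 t + r t)) t)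
    (h1 : Tendsto (fun t => Real.exp (-(2 * κ) * xi t) * E1 t) atTop (𝓝 0))
    (h0 : Tendsto E atTop (𝓝 0))
    (hr : ∀ t, t₀ ≤ t → |r t| ≤ 1 / (2 * √(1 + t ^ 2) ^ 4) * (c₁ + c₂ * (-tau t) ^ n)) :
    |E t₀| ≤ 1 / (2 * κ) * (c₁ * (-tau t₀) + c₂ * ((-tau t₀) ^ (n + 1) / (n + 1))) := by
  set G : ℝ → ℝ := fun t => 1 / (2 * √(1 + t ^ 2) ^ 4) * (c₁ + c₂ * (-tau t) ^ n) with hG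
  have hGanti : ∀ t₁ t, t₀ ≤ t₁ → t₁ ≤ t → G t ≤ G t₁ := by
    intro t₁ t h01 h1t
    have ht1 : 0 ≤ t₁ := ht₀.trans h01
    have := tau_monotone h1t
    have := tau_neg t
    have := tau_neg t₁
    have h3 : √(1 + t₁ ^ 2) ≤ √(1 + t ^ 2) := by gcongr
    have h4 : 0 ≤ c₂ * (-tau t) ^ n := mul_nonneg hc₂ (pow_nonneg (by linarith) _)
    simp only [hG]
    gcongr
    linarith
  -- With the integrating factor `e^{-2κξ}`, and as `G` is decreasing, `|E1| ≤ G / (2κ)`.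
  have hE1bd : ∀ t₁, t₀ ≤ t₁ → |E1 t₁| ≤ G t₁ / (2 * κ) := by
    intro t₁ ht₁
    have hexp : ∀ t, HasDerivAt (fun t => Real.exp (-(2 * κ) * xi t))
        (-(2 * κ) * √(1 + t ^ 2) * Real.exp (-(2 * κ) * xi t)) t := fun t => by
      refine (((hasDerivAt_xi t).const_mul (-(2 * κ))).exp).congr_deriv ?_
      ring
    have key := abs_le_of_abs_deriv_le (t₀ := t₁)
      (P := fun t => Real.exp (-(2 * κ) * xi t) * E1 t)
      (P' := fun t => √(1 + t ^ 2) * Real.exp (-(2 * κ) * xi t) * r t)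
      (Q := fun t => Real.exp (-(2 * κ) * xi t) * (G t₁ / (2 * κ)))
      (Q' := fun t => -(√(1 + t ^ 2) * Real.exp (-(2 * κ) * xi t) * G t₁))
      (fun t ht => by
        refine ((hexp t).mul (hE1 t (ht₁.trans ht))).congr_deriv ?_
        ring)
      (fun t ht => by
        refine ((hexp t).mul_const _).congr_deriv ?_
        field_simp)
      (fun t ht => by
        rw [neg_neg, abs_mul, abs_of_nonneg (by positivity)]
        gcongr
        exact (hr t (ht₁.trans ht)).trans (hGanti t₁ t ht₁ ht))
      h1
      (by
        have := Real.tendsto_exp_atBot.comp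
          (tendsto_xi.const_mul_atTop_of_neg (show -(2 * κ) < 0 by linarith))
        simpa using this.mul_const (G t₁ / (2 * κ)))
    rw [abs_mul, abs_of_pos (Real.exp_pos _)] at key
    exact le_of_mul_le_mul_left key (Real.exp_pos _)
  -- `dτ/dξ` being the weight in `G`, the bound `G / (2κ)` for `dE/dξ` integrates to one in `τ`.
  have hK : ∀ t, HasDerivAt
      (fun t => 1 / (2 * κ) * (c₁ * (-tau t) + c₂ * ((-tau t) ^ (n + 1) / (n + 1))))
      (-(√(1 + t ^ 2) * (G t / (2 * κ)))) t := by
    intro t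
    have hτ := (hasDerivAt_tau t).neg
    have := ((hτ.const_mul c₁).add
      (((hτ.pow (n + 1)).div_const ((n : ℝ) + 1)).const_mul c₂)).const_mul (1 / (2 * κ))
    refine this.congr_deriv ?_
    have hn : (n : ℝ) + 1 ≠ 0 := by positivity
    simp only [hG, Nat.add_sub_cancel, Pi.neg_apply, Nat.cast_add, Nat.cast_one]
    field_simp
    ring
  refine abs_le_of_abs_deriv_le hE (fun t _ => hK t) (fun t ht => ?_) h0 ?_
  · rw [neg_neg, abs_mul, abs_of_nonneg (by positivity)]
    gcongr
    exact hE1bd t ht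
  · have hτ := tendsto_tau.neg
    rw [neg_zero] at hτ
    have := ((hτ.const_mul c₁).add
      (((hτ.pow (n + 1)).div_const ((n : ℝ) + 1)).const_mul c₂)).const_mul (1 / (2 * κ))
    simpa using this

open Polynomial in
/-- Differentiation with respect to `ξ`, expressed in `τ`: `dτ/dξ = 8 τ² (τ + 1)²`. -/
noncomputable def derivXi (p : ℝ[X]) : ℝ[X] := 8 * X ^ 2 * (X + 1) ^ 2 * derivative p

lemma eight_mul_tau_sq (t : ℝ) :
    8 * tau t ^ 2 * (tau t + 1) ^ 2 = 1 / (2 * √(1 + t ^ 2) ^ 4) := by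
  have hθ := sqrt_one_add_sq_pos t
  have h := tau_mul_tau_add_one t
  calc 8 * tau t ^ 2 * (tau t + 1) ^ 2 = 8 * (tau t * (tau t + 1)) ^ 2 := by ring
    _ = _ := by rw [h]; field_simp; norm_num

lemma eval_derivXi_tau (p : Polynomial ℝ) (t : ℝ) :
    (derivXi p).eval (tau t) = 1 / (2 * √(1 + t ^ 2) ^ 4) * p.derivative.eval (tau t) := by
  rw [← eight_mul_tau_sq]
  simp [derivXi]

lemma hasDerivAt_eval_tau (p : Polynomial ℝ) (t : ℝ) :
    HasDerivAt (fun t => p.eval (tau t)) (√(1 + t ^ 2) * (derivXi p).eval (tau t)) t := by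
  have hθ := sqrt_one_add_sq_pos t
  refine ((p.hasDerivAt (tau t)).comp t (hasDerivAt_tau t)).congr_deriv ?_
  rw [eval_derivXi_tau]
  field_simp

open Polynomial in
/-- `psi` as a polynomial in `τ`. -/
noncomputable def psiPoly : ℝ[X] := -4 * X ^ 2 * (X + 1) ^ 2 * (20 * X ^ 2 + 20 * X + 3)

lemma eval_psiPoly_tau (t : ℝ) : psiPoly.eval (tau t) = psi t := by
  have hθ := sqrt_one_add_sq_pos t
  have hθ2 := sq_sqrt_one_add_sq t
  have h := tau_mul_tau_add_one t
  have : psiPoly.eval (tau t)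
      = -4 * (tau t * (tau t + 1)) ^ 2 * (20 * (tau t * (tau t + 1)) + 3) := by
    simp [psiPoly]; ring
  rw [this, h, psi]
  field_simp
  linear_combination -20 * hθ2

open Polynomial in
/-- The recursion for `φ_s` is the transport equation of the Liouville–Green expansion. -/
lemma derivXi_phiPoly_succ (k : ℕ) :
    2 * derivXi (phiPoly (k + 1))
      = psiPoly * phiPoly k - derivXi (derivXi (phiPoly k)) := by
  have h : phiPoly (k + 1) = -C (1 / 2) * derivXi (phiPoly k)
      - C (1 / 4) * antideriv ((20 * X ^ 2 + 20 * X + 3) * phiPoly k) := by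
    rw [phiPoly, derivXi]
    have : (-4 : ℝ[X]) = -C (1 / 2) * 8 := by
      rw [show (8 : ℝ[X]) = C 8 from rfl, ← C_neg, ← C_mul,
        show (-4 : ℝ[X]) = C (-4) by rw [C_neg]; rfl]
      norm_num
    rw [this]
    ring
  have h2 : (2 : ℝ[X]) * C (1 / 2) = 1 := by
    rw [show (2 : ℝ[X]) = C 2 from rfl, ← C_mul]; norm_num
  have h4 : (4 : ℝ[X]) * C (1 / 4) = 1 := by
    rw [show (4 : ℝ[X]) = C 4 from rfl, ← C_mul]; norm_num
  rw [derivXi, h, derivative_sub, derivative_mul, derivative_mul, ← C_neg, derivative_C,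
    derivative_C, derivative_antideriv, C_neg]
  simp only [derivXi, psiPoly]
  linear_combination (-8 * X ^ 2 * (X + 1) ^ 2
      * derivative (8 * X ^ 2 * (X + 1) ^ 2 * derivative (phiPoly k))) * h2
    - 4 * X ^ 2 * (X + 1) ^ 2 * (20 * X ^ 2 + 20 * X + 3) * phiPoly k * h4

open Polynomial in
/-- The partial sum `∑_{k < N} (-1)^k φ_k(τ) / κ^k`. -/
noncomputable def partialSum (κ : ℝ) (N : ℕ) : ℝ[X] :=
  ∑ k ∈ Finset.range N, C ((-1) ^ k / κ ^ k) * phiPoly k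

open Polynomial in
/-- The partial sum solves the equation for `V` up to a term with `dφ_N/dξ`: the other terms
telescope by the recursion. -/
lemma derivXi_derivXi_partialSum {κ : ℝ} (hκ : κ ≠ 0) (N : ℕ) :
    derivXi (derivXi (partialSum κ N)) = psiPoly * partialSum κ N
      + C (2 * κ) * (derivXi (partialSum κ N)
        + C ((-1) ^ N / κ ^ N) * derivXi (phiPoly N)) := by
  have hadd : ∀ p q : ℝ[X], derivXi (p + q) = derivXi p + derivXi q := by
    intro p q; simp only [derivXi, derivative_add]; ring
  have hC : ∀ (c : ℝ) (p : ℝ[X]), derivXi (C c * p) = C c * derivXi p := by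
    intro c p; simp only [derivXi, derivative_C_mul]; ring
  induction N with
  | zero => simp [partialSum, derivXi, phiPoly]
  | succ N ih =>
    have hs : partialSum κ (N + 1) = partialSum κ N + C ((-1) ^ N / κ ^ N) * phiPoly N := by
      rw [partialSum, Finset.sum_range_succ, partialSum]
    have hr := derivXi_phiPoly_succ N
    rw [hs, hadd, hadd, ih, hC, hC]
    have hc : C (2 * κ) * C ((-1) ^ (N + 1) / κ ^ (N + 1)) = -2 * C ((-1) ^ N / κ ^ N) := by
      rw [show (-2 : ℝ[X]) = C (-2) by rw [C_neg]; rfl, ← C_mul, ← C_mul]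
      congr 1
      field_simp
      ring
    linear_combination (-derivXi (phiPoly (N + 1))) * hc + C ((-1) ^ N / κ ^ N) * hr

/-- On `-1/2 ≤ τ ≤ 0`, `φ'_{n+1}(τ) = O(τⁿ)`. -/
lemma exists_abs_derivative_phiPoly_le (n : ℕ) :
    ∃ B, 0 ≤ B ∧ ∀ x ∈ Icc (-(1 / 2) : ℝ) 0,
      |(phiPoly (n + 1)).derivative.eval x| ≤ B * (-x) ^ n := by
  obtain ⟨q, hq, -⟩ := exists_phiPoly_eq (n + 1)
  set s : Polynomial ℝ := Polynomial.C ((n : ℝ) + 1) * q + Polynomial.X * q.derivative with hs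
  have hd : (phiPoly (n + 1)).derivative = Polynomial.X ^ n * s := by
    rw [hq, Polynomial.derivative_mul, Polynomial.derivative_X_pow, hs]
    simp only [Nat.add_sub_cancel, Nat.cast_add, Nat.cast_one]
    ring
  obtain ⟨B, hB⟩ := (isCompact_Icc (a := (-(1 / 2) : ℝ)) (b := 0)).exists_bound_of_continuousOn
    (f := fun x => s.eval x) s.continuous.continuousOn
  refine ⟨B, (norm_nonneg _).trans (hB 0 (by norm_num)), fun x hx => ?_⟩
  have hb := hB x hx
  rw [Real.norm_eq_abs] at hb
  rw [hd, Polynomial.eval_mul, Polynomial.eval_pow, Polynomial.eval_X, abs_mul, abs_pow,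
    abs_of_nonpos hx.2, mul_comm]
  exact mul_le_mul_of_nonneg_right hb (pow_nonneg (by linarith [hx.2]) _)

lemma abs_psi_le (t : ℝ) : |psi t| ≤ 3 / 2 * (1 / (2 * √(1 + t ^ 2) ^ 4)) := by
  have hθ := sqrt_one_add_sq_pos t
  have hθ2 := sq_sqrt_one_add_sq t
  have h : |2 * √(1 + t ^ 2) ^ 2 - 5 * t ^ 2| ≤ 3 * √(1 + t ^ 2) ^ 2 := by
    rw [hθ2, abs_le]; constructor <;> nlinarith [sq_nonneg t]
  rw [psi, abs_div, abs_of_pos (by positivity : 0 < 4 * √(1 + t ^ 2) ^ 6),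
    div_le_iff₀ (by positivity)]
  refine h.trans (le_of_eq ?_)
  field_simp
  norm_num

/-- The restriction `μ² (1 + t²) ≥ 1` is what makes the contribution of `ψ E` to the error equation
a contraction. -/
lemma neg_tau_div_le {μ t : ℝ} (hμ : 0 < μ) (ht : 0 ≤ t) (h : 1 ≤ μ ^ 2 * (1 + t ^ 2)) :
    -tau t / μ ^ 2 ≤ 1 / 2 := by
  have h1 := tau_mul_tau_add_one t
  have h2 := neg_half_le_tau ht
  have h3 := tau_neg t
  rw [sq_sqrt_one_add_sq] at h1
  have h4 : 0 < 1 + t ^ 2 := by positivity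
  have h5 : -tau t ≤ 1 / (2 * (1 + t ^ 2)) := by
    have : -tau t * (tau t + 1) = 1 / (4 * (1 + t ^ 2)) := by
      rw [neg_mul, h1]; ring
    have h6 : 1 / (2 * (1 + t ^ 2)) = 2 * (1 / (4 * (1 + t ^ 2))) := by field_simp; norm_num
    rw [h6, ← this]
    nlinarith
  rw [div_le_iff₀ (by positivity)]
  refine h5.trans ?_
  rw [div_le_iff₀ (by positivity)]
  nlinarith

/-- The expansion of `U(μ²/2, μ √2 t)`, uniform in `t ≥ 0`, for `μ² (1 + t²) ≥ 1`. -/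
theorem exists_abs_U_div_leadingOlver_sub_le (N : ℕ) :
    ∃ C, ∀ μ t : ℝ, 0 < μ → 0 ≤ t → 1 ≤ μ ^ 2 * (1 + t ^ 2) →
      |U (μ ^ 2 / 2) (μ * √2 * t) / leadingOlver μ t - (partialSum (μ ^ 2) N).eval (tau t)|
        ≤ C * (-tau t / μ ^ 2) ^ N := by
  have succ_case : ∀ n : ℕ, ∃ C, ∀ μ t : ℝ, 0 < μ → 0 ≤ t → 1 ≤ μ ^ 2 * (1 + t ^ 2) →
      |U (μ ^ 2 / 2) (μ * √2 * t) / leadingOlver μ t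
        - (partialSum (μ ^ 2) (n + 1)).eval (tau t)| ≤ C * (-tau t / μ ^ 2) ^ (n + 1) := by
    intro n
    obtain ⟨B, hB0, hB⟩ := exists_abs_derivative_phiPoly_le n
    refine ⟨8 / 5 * B, fun μ t₀ hμ ht₀ hR => ?_⟩
    obtain ⟨X, hX, hX1, hX0⟩ := exists_deriv_U_div_leadingOlver hμ
    set V : ℝ → ℝ := fun t => U (μ ^ 2 / 2) (μ * √2 * t) / leadingOlver μ t with hV
    set S := partialSum (μ ^ 2) (n + 1) with hS
    set E : ℝ → ℝ := fun t => V t - S.eval (tau t) with hE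
    have hκ : 0 < μ ^ 2 := by positivity
    have hSid := derivXi_derivXi_partialSum hκ.ne' (n + 1)
    rw [← hS] at hSid
    set c : ℝ := 2 * μ ^ 2 * ((-1) ^ (n + 1) / (μ ^ 2) ^ (n + 1)) with hc
    have hcabs : |c| = 2 * μ ^ 2 / (μ ^ 2) ^ (n + 1) := by
      rw [hc, abs_mul, abs_div, abs_pow, abs_neg, abs_one, one_pow, abs_of_pos (by positivity),
        abs_of_pos (by positivity : 0 < (μ ^ 2) ^ (n + 1))]
      ring
    have hEd : ∀ t, HasDerivAt E (√(1 + t ^ 2) * (X t - (derivXi S).eval (tau t))) t := fun t => by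
      refine ((hX t).sub (hasDerivAt_eval_tau S t)).congr_deriv ?_
      ring
    have hE1d : ∀ t, HasDerivAt (fun t => X t - (derivXi S).eval (tau t))
        (√(1 + t ^ 2) * (2 * μ ^ 2 * (X t - (derivXi S).eval (tau t))
          + (psi t * E t - c * (derivXi (phiPoly (n + 1))).eval (tau t)))) t := fun t => by
      refine ((hX1 t).sub (hasDerivAt_eval_tau (derivXi S) t)).congr_deriv ?_
      rw [hSid]
      simp only [Polynomial.eval_add, Polynomial.eval_mul, Polynomial.eval_C, eval_psiPoly_tau,
        hE, hV, hc]
      ring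
    have hτc : ∀ p : Polynomial ℝ, Tendsto (fun t => p.eval (tau t)) atTop (𝓝 (p.eval 0)) :=
      fun p => (p.continuous.tendsto 0).comp tendsto_tau
    have hS0 : S.eval 0 = 1 := by
      rw [hS, partialSum, Polynomial.eval_finsetSum, Finset.sum_eq_single 0]
      · simp [phiPoly]
      · intro k _ hk
        obtain ⟨q, hq, -⟩ := exists_phiPoly_eq k
        rw [hq]
        simp [hk]
      · simp
    have hE0 : Tendsto E atTop (𝓝 0) := by
      have := (tendsto_U_div_leadingOlver hμ).sub (hτc S)
      rwa [hS0, sub_self] at this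
    have hE10 : Tendsto (fun t => Real.exp (-(2 * μ ^ 2) * xi t)
        * (X t - (derivXi S).eval (tau t))) atTop (𝓝 0) := by
      have h1 := Real.tendsto_exp_atBot.comp
          (tendsto_xi.const_mul_atTop_of_neg (show -(2 * μ ^ 2) < 0 by linarith))
      have h2 := hX0.sub (h1.mul (hτc (derivXi S)))
      rw [zero_mul, sub_zero] at h2
      refine h2.congr fun t => ?_
      simp only [Function.comp]
      ring
    have hb0 : 0 ≤ |c| * B := by positivity
    -- A bound `M` for `|E|` on `[t₀, ∞)` improves itself.
    have step : ∀ M, 0 ≤ M → (∀ t, t₀ ≤ t → |E t| ≤ M) → ∀ t, t₀ ≤ t →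
        |E t| ≤ 3 / 8 * M + B * (-tau t₀ / μ ^ 2) ^ (n + 1) := by
      intro M hM hEM t₁ ht₁
      have ht₁0 : 0 ≤ t₁ := ht₀.trans ht₁
      have key := abs_le_of_inhomogeneous (E := E) (n := n) (c₁ := 3 / 2 * M) (c₂ := |c| * B)
        hκ ht₁0 (by positivity) hb0
        (fun t _ => hEd t) (fun t _ => hE1d t) hE10 hE0 (fun t ht => by
          have hθ := sqrt_one_add_sq_pos t
          have ht0 : 0 ≤ t := ht₁0.trans ht
          have h1 := abs_psi_le t
          have h2 := hEM t (ht₁.trans ht)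
          have h3 := hB (tau t) ⟨neg_half_le_tau ht0, (tau_neg t).le⟩
          have h4 : |psi t * E t| ≤ 3 / 2 * (1 / (2 * √(1 + t ^ 2) ^ 4)) * M := by
            rw [abs_mul]; gcongr
          have h5 : |c * (derivXi (phiPoly (n + 1))).eval (tau t)|
              ≤ |c| * (1 / (2 * √(1 + t ^ 2) ^ 4) * (B * (-tau t) ^ n)) := by
            rw [eval_derivXi_tau, abs_mul c, abs_mul (1 / _),
              abs_of_pos (by positivity : 0 < 1 / (2 * √(1 + t ^ 2) ^ 4))]
            gcongr
          refine (abs_sub _ _).trans ((add_le_add h4 h5).trans (le_of_eq ?_))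
          ring)
      have hτ1 := tau_neg t₁
      have hτm := tau_monotone ht₁
      have hτ0 := neg_tau_div_le hμ ht₀ hR
      refine key.trans ?_
      have e : 1 / (2 * μ ^ 2) * (3 / 2 * M * (-tau t₁)
          + |c| * B * ((-tau t₁) ^ (n + 1) / (n + 1)))
          = 3 / 4 * M * (-tau t₁ / μ ^ 2)
            + B * ((-tau t₁ / μ ^ 2) ^ (n + 1) / (n + 1)) := by
        have hK : (μ ^ 2) ^ (n + 1) ≠ 0 := by positivity
        rw [hcabs, div_pow]
        generalize (μ ^ 2) ^ (n + 1) = K at hK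
        have hn : (n : ℝ) + 1 ≠ 0 := by positivity
        field_simp
        ring
      rw [e]
      have h6 : -tau t₁ / μ ^ 2 ≤ -tau t₀ / μ ^ 2 := by gcongr
      have h7 : 0 ≤ -tau t₁ / μ ^ 2 := div_nonneg (by linarith) hκ.le
      refine add_le_add (by nlinarith) (mul_le_mul_of_nonneg_left ?_ hB0)
      calc (-tau t₁ / μ ^ 2) ^ (n + 1) / (n + 1) ≤ (-tau t₁ / μ ^ 2) ^ (n + 1) :=
            div_le_self (pow_nonneg h7 _) (by have : (0 : ℝ) ≤ n := n.cast_nonneg; linarith)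
        _ ≤ _ := by gcongr
    have hbdd : ∃ M, ∀ t, t₀ ≤ t → |E t| ≤ M := by
      obtain ⟨T, hT⟩ := eventually_atTop.1 (hE0.abs.eventually_le_const
        (show |(0 : ℝ)| < 1 by simp))
      have hcont : Continuous E := continuous_iff_continuousAt.2 fun t => (hEd t).continuousAt
      obtain ⟨M, hM⟩ := (isCompact_Icc (a := t₀) (b := T)).exists_bound_of_continuousOn
        hcont.continuousOn
      refine ⟨max M 1, fun t ht => ?_⟩
      rcases le_total t T with h | h
      · exact (hM t ⟨ht, h⟩).trans (le_max_left _ _)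
      · exact (hT t h).trans (le_max_right _ _)
    obtain ⟨M₀, hM₀⟩ := hbdd
    have hne : (((fun t => |E t|) '' Ici t₀)).Nonempty := ⟨_, t₀, self_mem_Ici, rfl⟩
    have hbd : BddAbove ((fun t => |E t|) '' Ici t₀) :=
      ⟨M₀, by rintro _ ⟨t, ht, rfl⟩; exact hM₀ t ht⟩
    set M := sSup ((fun t => |E t|) '' Ici t₀)
    have hEM : ∀ t, t₀ ≤ t → |E t| ≤ M := fun t ht => le_csSup hbd ⟨t, ht, rfl⟩
    have hM0 : 0 ≤ M := (abs_nonneg _).trans (hEM t₀ le_rfl)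
    have hMle : M ≤ 3 / 8 * M + B * (-tau t₀ / μ ^ 2) ^ (n + 1) := by
      refine csSup_le hne ?_
      rintro _ ⟨t, ht, rfl⟩
      exact step M hM0 hEM t ht
    -- `M ≤ 3/8 M + B x` gives `M ≤ 8/5 B x`.
    have := hEM t₀ le_rfl
    change |E t₀| ≤ _
    linarith
  rcases N with _ | n
  · -- Boundedness follows from the expansion with one term.
    obtain ⟨C, hC⟩ := succ_case 0
    refine ⟨1 + |C|, fun μ t hμ ht hR => ?_⟩
    have h1 := hC μ t hμ ht hR
    have h2 := neg_tau_div_le hμ ht hR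
    have h3 : 0 ≤ -tau t / μ ^ 2 := div_nonneg (by linarith [tau_neg t]) (by positivity)
    have h4 : (partialSum (μ ^ 2) 0).eval (tau t) = 0 := by simp [partialSum]
    have h5 : (partialSum (μ ^ 2) (0 + 1)).eval (tau t) = 1 := by simp [partialSum, phiPoly]
    rw [h5, zero_add, pow_one] at h1
    rw [h4, sub_zero, pow_zero, mul_one]
    have h6 : C * (-tau t / μ ^ 2) ≤ |C| := by
      calc C * (-tau t / μ ^ 2) ≤ |C| * (-tau t / μ ^ 2) := by gcongr; exact le_abs_self C
        _ ≤ |C| * 1 := by gcongr; linarith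
        _ = |C| := mul_one _
    have h7 := abs_sub_abs_le_abs_sub (U (μ ^ 2 / 2) (μ * √2 * t) / leadingOlver μ t) 1
    rw [abs_one] at h7
    linarith
  · exact succ_case n

/-! ### The map `t ↦ w(t)` -/

/-- The common form `x + q x²/2 - l log x` of the phase `φ` (`q = 1`) and of the phase
`t - l log t` of the Gamma integral (`q = 0`). Its minimum on `x > 0` is at the `c ≥ 0` with
`q c² + c = l`. -/
noncomputable def genPhase (q l x : ℝ) : ℝ := x + q * x ^ 2 / 2 - l * Real.log x

lemma phase_eq_genPhase (l : ℝ) : phase l = genPhase 1 l := by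
  funext x; simp [phase, genPhase]

lemma genPhase_zero (l t : ℝ) : genPhase 0 l t = t - l * Real.log t := by
  simp [genPhase]

lemma hasDerivAt_genPhase {q l c x : ℝ} (hc : q * c ^ 2 + c = l) (hx : 0 < x) :
    HasDerivAt (genPhase q l) ((x - c) * ((q * (x + c) + 1) / x)) x := by
  have h := ((hasDerivAt_id x).add (((hasDerivAt_pow 2 x).const_mul q).div_const 2)).sub
    ((Real.hasDerivAt_log hx.ne').const_mul l)
  refine h.congr_deriv ?_
  rw [← hc]
  field_simp
  norm_num
  ring

lemma analyticAt_genPhase (q l : ℝ) {x : ℝ} (hx : 0 < x) : AnalyticAt ℝ (genPhase q l) x := by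
  have : AnalyticAt ℝ Real.log x := analyticAt_log hx
  unfold genPhase
  fun_prop

lemma continuousOn_genPhase_Ioi (q l : ℝ) : ContinuousOn (genPhase q l) (Ioi 0) :=
  fun _ hx => (analyticAt_genPhase q l hx).continuousAt.continuousWithinAt

lemma continuousOn_genPhase_Ici {q l c : ℝ} (hc0 : 0 ≤ c) (hc : q * c ^ 2 + c = l) :
    ContinuousOn (genPhase q l) (Ici c) := by
  rcases hc0.eq_or_lt with rfl | h
  · have hl : l = 0 := by rw [← hc]; ring
    have : genPhase q l = fun x => x + q * x ^ 2 / 2 := by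
      funext x; simp [genPhase, hl]
    rw [this]
    fun_prop
  · exact (continuousOn_genPhase_Ioi q l).mono fun x hx => h.trans_le hx

lemma strictMonoOn_genPhase {q l c : ℝ} (hq : 0 ≤ q) (hc0 : 0 ≤ c) (hc : q * c ^ 2 + c = l) :
    StrictMonoOn (genPhase q l) (Ici c) := by
  refine strictMonoOn_of_deriv_pos (convex_Ici c) (continuousOn_genPhase_Ici hc0 hc) ?_
  intro x hx
  rw [interior_Ici] at hx
  have hx' : c < x := hx
  have hx0 : 0 < x := hc0.trans_lt hx'
  rw [(hasDerivAt_genPhase hc hx0).deriv]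
  have : 0 < x - c := by linarith
  positivity

lemma strictAntiOn_genPhase {q l c : ℝ} (hq : 0 ≤ q) (hc : q * c ^ 2 + c = l) :
    StrictAntiOn (genPhase q l) (Ioc 0 c) := by
  refine strictAntiOn_of_deriv_neg (convex_Ioc 0 c)
    ((continuousOn_genPhase_Ioi q l).mono fun x hx => hx.1) ?_
  intro x hx
  rw [interior_Ioc] at hx
  have hx0 : 0 < x := hx.1
  have hxc : x < c := hx.2
  have hc0 : 0 < c := hx0.trans hxc
  rw [(hasDerivAt_genPhase hc hx0).deriv]
  exact mul_neg_of_neg_of_pos (by linarith) (by positivity)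

lemma genPhase_lt_of_ne {q l c x : ℝ} (hq : 0 ≤ q) (hc0 : 0 ≤ c) (hc : q * c ^ 2 + c = l)
    (hx : 0 < x) (hxc : x ≠ c) : genPhase q l c < genPhase q l x := by
  rcases lt_or_gt_of_ne hxc with h | h
  · exact strictAntiOn_genPhase hq hc ⟨hx, h.le⟩ ⟨hx.trans h, le_rfl⟩ h
  · exact strictMonoOn_genPhase hq hc0 hc self_mem_Ici h.le h

lemma exists_genPhase_eq_right {q l c y : ℝ} (hq : 0 ≤ q) (hc0 : 0 ≤ c)
    (hc : q * c ^ 2 + c = l) (hy : genPhase q l c ≤ y) : ∃ x ∈ Ici c, genPhase q l x = y := by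
  have hl : 0 ≤ l := by rw [← hc]; positivity
  set K := 2 * l + 1 with hK
  have hK0 : 0 < K := by positivity
  -- `log x ≤ x / K - 1 + log K` makes the phase at least `x / 2 - l log K`.
  set b := max c (2 * (|y| + l * |Real.log K|) + 1) with hb
  have hb1 : 2 * (|y| + l * |Real.log K|) + 1 ≤ b := le_max_right _ _
  have hb0 : 0 < b := lt_of_lt_of_le (by positivity) hb1
  have hyb : y ≤ genPhase q l b := by
    have h1 : Real.log b ≤ b / K - 1 + Real.log K := by
      have := Real.log_le_sub_one_of_pos (div_pos hb0 hK0)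
      rw [Real.log_div hb0.ne' hK0.ne'] at this
      linarith
    have h2 : l * Real.log b ≤ l * (b / K) + l * |Real.log K| := by
      rw [← mul_add]
      exact mul_le_mul_of_nonneg_left (by linarith [le_abs_self (Real.log K)]) hl
    have h3 : l * (b / K) ≤ b / 2 := by
      rw [← mul_div_assoc, div_le_div_iff₀ hK0 two_pos]
      nlinarith
    have h4 : 0 ≤ q * b ^ 2 / 2 := by positivity
    rw [genPhase]
    linarith [le_abs_self y]
  obtain ⟨x, hx, hxy⟩ := intermediate_value_Icc (le_max_left c _ : c ≤ b)
    ((continuousOn_genPhase_Ici hc0 hc).mono Icc_subset_Ici_self) ⟨hy, hyb⟩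
  exact ⟨x, hx.1, hxy⟩

lemma exists_genPhase_eq_left {q l c y : ℝ} (hq : 0 ≤ q) (hc0 : 0 < c)
    (hc : q * c ^ 2 + c = l) (hy : genPhase q l c ≤ y) : ∃ x ∈ Ioc 0 c, genPhase q l x = y := by
  have hl : 0 < l := by rw [← hc]; positivity
  set b := min c (Real.exp (-y / l)) with hb
  have hb0 : 0 < b := lt_min hc0 (Real.exp_pos _)
  have hyb : y ≤ genPhase q l b := by
    have h1 : Real.log b ≤ -y / l := by
      rw [← Real.log_exp (-y / l)]
      exact Real.log_le_log hb0 (min_le_right _ _)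
    have h2 : l * Real.log b ≤ -y := by
      have := mul_le_mul_of_nonneg_left h1 hl.le
      rwa [mul_div_cancel₀ _ hl.ne'] at this
    have h4 : 0 ≤ q * b ^ 2 / 2 := by positivity
    rw [genPhase]
    linarith
  obtain ⟨x, hx, hxy⟩ := intermediate_value_Icc' (min_le_left c _ : b ≤ c)
    ((continuousOn_genPhase_Ioi q l).mono fun x hx => hb0.trans_le hx.1) ⟨hy, hyb⟩
  exact ⟨x, ⟨hb0.trans_le hx.1, hx.2⟩, hxy⟩

lemma saddle_nonneg {l : ℝ} (hl : 0 ≤ l) : 0 ≤ saddle l := by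
  rw [saddle_eq_mul hl]; exact mul_nonneg hl (saddleRatio_pos l).le

lemma saddle_pos {l : ℝ} (hl : 0 < l) : 0 < saddle l := by
  rw [saddle_eq_mul hl.le]; exact mul_pos hl (saddleRatio_pos l)

lemma saddle_crit {l : ℝ} (hl : 0 ≤ l) : 1 * saddle l ^ 2 + saddle l = l := by
  rw [one_mul]; exact saddle_sq hl

lemma self_crit (l : ℝ) : 0 * l ^ 2 + l = l := by ring

/-- `A` is the difference of the minima of the two phases. -/
lemma genPhase_saddle (l : ℝ) : genPhase 1 l (saddle l) = genPhase 0 l l + A l := by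
  simp only [genPhase, A]; ring

lemma rhs_eq (l t : ℝ) : t - l * Real.log t + A l = genPhase 0 l t + A l := by
  rw [genPhase_zero]

lemma genPhase_saddle_le {l t : ℝ} (hl : 0 ≤ l) (ht : 0 < t) :
    genPhase 1 l (saddle l) ≤ genPhase 0 l t + A l := by
  rw [genPhase_saddle]
  rcases eq_or_ne t l with rfl | h
  · exact le_rfl
  · linarith [genPhase_lt_of_ne le_rfl hl (self_crit l) ht h]

lemma w_of_le {l t : ℝ} (hl : 0 ≤ l) (ht : 0 < t) (h : l ≤ t) :
    saddle l ≤ w l t ∧ genPhase 1 l (w l t) = genPhase 0 l t + A l := by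
  have hex : ∃ x ∈ Ici (saddle l), phase l x = t - l * Real.log t + A l := by
    rw [phase_eq_genPhase, rhs_eq]
    exact exists_genPhase_eq_right zero_le_one (saddle_nonneg hl) (saddle_crit hl)
      (genPhase_saddle_le hl ht)
  have h1 := Function.invFunOn_mem hex
  have h2 := Function.invFunOn_eq hex
  rw [w, if_pos h]
  exact ⟨h1, by rw [← phase_eq_genPhase, h2, rhs_eq]⟩

lemma w_of_lt {l t : ℝ} (ht : 0 < t) (h : t < l) :
    w l t ∈ Ioc 0 (saddle l) ∧ genPhase 1 l (w l t) = genPhase 0 l t + A l := by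
  have hl : 0 < l := ht.trans h
  have hex : ∃ x ∈ Ioc 0 (saddle l), phase l x = t - l * Real.log t + A l := by
    rw [phase_eq_genPhase, rhs_eq]
    exact exists_genPhase_eq_left zero_le_one (saddle_pos hl) (saddle_crit hl.le)
      (genPhase_saddle_le hl.le ht)
  have h1 := Function.invFunOn_mem hex
  have h2 := Function.invFunOn_eq hex
  rw [w, if_neg h.not_ge]
  exact ⟨h1, by rw [← phase_eq_genPhase, h2, rhs_eq]⟩

lemma genPhase_w {l t : ℝ} (hl : 0 ≤ l) (ht : 0 < t) :
    genPhase 1 l (w l t) = genPhase 0 l t + A l := by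
  rcases le_or_gt l t with h | h
  · exact (w_of_le hl ht h).2
  · exact (w_of_lt ht h).2

lemma w_pos {l t : ℝ} (hl : 0 ≤ l) (ht : 0 < t) : 0 < w l t := by
  rcases le_or_gt l t with h | h
  · obtain ⟨h1, h2⟩ := w_of_le hl ht h
    rcases hl.eq_or_lt with rfl | hl'
    · refine lt_of_le_of_ne ((saddle_nonneg le_rfl).trans h1) fun h0 => ?_
      rw [← h0] at h2
      simp [genPhase, A, saddle] at h2
      linarith
    · exact (saddle_pos hl').trans_le h1
  · exact (w_of_lt ht h).1.1

/-- The defining property of `w` determines it. -/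
lemma w_eq_of_genPhase_eq {l t x : ℝ} (hl : 0 ≤ l) (ht : 0 < t) (hx : 0 < x)
    (h : genPhase 1 l x = genPhase 0 l t + A l) (h1 : l ≤ t → saddle l ≤ x)
    (h2 : t < l → x ≤ saddle l) : w l t = x := by
  rcases le_or_gt l t with hlt | hlt
  · obtain ⟨h3, h4⟩ := w_of_le hl ht hlt
    exact (strictMonoOn_genPhase zero_le_one (saddle_nonneg hl) (saddle_crit hl)).injOn h3
      (h1 hlt) (h4.trans h.symm)
  · obtain ⟨h3, h4⟩ := w_of_lt ht hlt
    exact (strictAntiOn_genPhase zero_le_one (saddle_crit hl)).injOn h3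
      ⟨hx, h2 hlt⟩ (h4.trans h.symm)

lemma w_self {l : ℝ} (hl : 0 < l) : w l l = saddle l :=
  w_eq_of_genPhase_eq hl.le hl (saddle_pos hl) (genPhase_saddle l) (fun _ => le_rfl)
    (fun h => absurd h (lt_irrefl _))

lemma w_lt_saddle {l t : ℝ} (ht : 0 < t) (h : t < l) : w l t < saddle l := by
  obtain ⟨h1, h2⟩ := w_of_lt ht h
  refine lt_of_le_of_ne h1.2 fun h0 => ?_
  rw [h0, genPhase_saddle] at h2
  linarith [genPhase_lt_of_ne le_rfl (ht.trans h).le (self_crit l) ht h.ne]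

lemma saddle_lt_w {l t : ℝ} (hl : 0 ≤ l) (h : l < t) : saddle l < w l t := by
  have ht : 0 < t := hl.trans_lt h
  obtain ⟨h1, h2⟩ := w_of_le hl ht h.le
  refine lt_of_le_of_ne h1 fun h0 => ?_
  rw [← h0, genPhase_saddle] at h2
  linarith [genPhase_lt_of_ne le_rfl hl (self_crit l) ht h.ne']

lemma strictMonoOn_w {l : ℝ} (hl : 0 ≤ l) : StrictMonoOn (w l) (Ioi 0) := by
  intro t₁ ht₁ t₂ ht₂ h
  have ht₁' : 0 < t₁ := ht₁
  have ht₂' : 0 < t₂ := ht₂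
  rcases lt_or_ge t₂ l with h2 | h2
  · obtain ⟨h3, h4⟩ := w_of_lt ht₁ (h.trans h2)
    obtain ⟨h5, h6⟩ := w_of_lt ht₂ h2
    have := strictAntiOn_genPhase le_rfl (self_crit l) ⟨ht₁', (h.trans h2).le⟩ ⟨ht₂', h2.le⟩ h
    rw [← (strictAntiOn_genPhase zero_le_one (saddle_crit hl)).lt_iff_gt h5 h3, h4, h6]
    linarith
  · rcases lt_or_ge t₁ l with h1 | h1
    · exact (w_lt_saddle ht₁ h1).trans_le (w_of_le hl ht₂ h2).1
    · obtain ⟨h3, h4⟩ := w_of_le hl ht₁ h1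
      obtain ⟨h5, h6⟩ := w_of_le hl ht₂ h2
      have := strictMonoOn_genPhase le_rfl hl (self_crit l) h1 h2 h
      rw [← (strictMonoOn_genPhase zero_le_one (saddle_nonneg hl) (saddle_crit hl)).lt_iff_lt h3 h5,
        h4, h6]
      linarith

lemma image_w {l : ℝ} (hl : 0 ≤ l) : w l '' Ioi 0 = Ioi 0 := by
  ext x
  constructor
  · rintro ⟨t, ht, rfl⟩
    exact w_pos hl ht
  · intro hx
    have hx' : 0 < x := hx
    have hmin : genPhase 0 l l ≤ genPhase 1 l x - A l := by
      rcases eq_or_ne x (saddle l) with rfl | hne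
      · linarith [genPhase_saddle l]
      · linarith [genPhase_saddle l,
          genPhase_lt_of_ne zero_le_one (saddle_nonneg hl) (saddle_crit hl) hx' hne]
    rcases lt_or_ge x (saddle l) with h | h
    · have hl' : 0 < l := by
        rcases hl.eq_or_lt with rfl | hl'
        · simp [saddle] at h; linarith
        · exact hl'
      obtain ⟨t, ht, hte⟩ := exists_genPhase_eq_left le_rfl hl' (self_crit l) hmin
      have htl : t ≠ l := by
        rintro rfl
        have := genPhase_lt_of_ne zero_le_one (saddle_nonneg hl) (saddle_crit hl) hx' h.ne
        linarith [genPhase_saddle t]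
      exact ⟨t, ht.1, w_eq_of_genPhase_eq hl ht.1 hx' (by linarith)
        (fun h0 => absurd (le_antisymm ht.2 h0) htl) (fun _ => h.le)⟩
    · obtain ⟨t, ht, hte⟩ := exists_genPhase_eq_right le_rfl hl (self_crit l) hmin
      have ht0 : 0 < t := by
        refine lt_of_le_of_ne (hl.trans ht) ?_
        rintro rfl
        have hl0 : l = 0 := le_antisymm ht hl
        subst hl0
        simp [genPhase, A, saddle] at hte
        nlinarith
      exact ⟨t, ht0, w_eq_of_genPhase_eq hl ht0 hx' (by linarith) (fun _ => h)
        (fun h0 => absurd h0 (not_lt.2 ht))⟩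

/-! ### Analyticity of `w` -/

lemma analyticAt_sqrt {x : ℝ} (hx : 0 < x) : AnalyticAt ℝ (fun x => √x) x :=
  (Real.contDiffAt_sqrt (n := ω) hx.ne').analyticAt

lemma analyticAt_dslope_self {F : ℝ → ℝ} {c : ℝ} (h : AnalyticAt ℝ F c) :
    AnalyticAt ℝ (dslope F c) c := by
  obtain ⟨p, hp⟩ := h
  exact hp.has_fpower_series_dslope_fslope.analyticAt

/-- Near its minimum the phase is its minimal value plus the square of an analytic coordinate. -/
lemma exists_genPhase_eq_sq {q l c : ℝ} (hq : 0 ≤ q) (hc0 : 0 < c) (hc : q * c ^ 2 + c = l) :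
    ∃ r : ℝ → ℝ, AnalyticAt ℝ r c ∧ 0 < r c ∧
      ∀ᶠ x in 𝓝 c, genPhase q l x = genPhase q l c + ((x - c) * r x) ^ 2 := by
  set g := genPhase q l with hg
  set D := dslope g c with hD
  set H := dslope D c with hH
  have hDa : AnalyticAt ℝ D c := analyticAt_dslope_self (analyticAt_genPhase q l hc0)
  have hHa : AnalyticAt ℝ H c := analyticAt_dslope_self hDa
  have hDc : D c = 0 := by
    rw [hD, dslope_same, (hasDerivAt_genPhase hc hc0).deriv]; ring
  have hgD : ∀ x, g x = g c + (x - c) * D x := fun x => by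
    have := sub_smul_dslope g c x
    rw [smul_eq_mul] at this
    linarith
  have hDH : ∀ x, D x = (x - c) * H x := fun x => by
    have := sub_smul_dslope D c x
    rw [smul_eq_mul, hDc] at this
    linarith
  -- Comparing the two expressions of `g'` off `c` gives `H c = g''(c) / 2`.
  have hlim : H c + deriv D c = (q * (c + c) + 1) / c := by
    have h1 : Tendsto (fun x => H x + deriv D x) (𝓝[≠] c) (𝓝 (H c + deriv D c)) :=
      (hHa.continuousAt.add hDa.deriv.continuousAt).tendsto.mono_left nhdsWithin_le_nhds
    have h2 : Tendsto (fun x => (q * (x + c) + 1) / x) (𝓝[≠] c) (𝓝 ((q * (c + c) + 1) / c)) := by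
      have : ContinuousAt (fun x => (q * (x + c) + 1) / x) c :=
        ContinuousAt.div (by fun_prop) continuousAt_id hc0.ne'
      exact this.tendsto.mono_left nhdsWithin_le_nhds
    refine tendsto_nhds_unique (h1.congr' ?_) h2
    filter_upwards [self_mem_nhdsWithin,
      nhdsWithin_le_nhds (hDa.eventually_analyticAt), nhdsWithin_le_nhds (lt_mem_nhds hc0)]
      with x hx hxD hx0
    have h3 : HasDerivAt g (1 * D x + (x - c) * deriv D x) x := by
      have := (((hasDerivAt_id x).sub_const c).mul hxD.differentiableAt.hasDerivAt).const_add (g c)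
      refine this.congr_of_eventuallyEq (Eventually.of_forall fun y => ?_)
      exact hgD y
    have h4 := h3.unique (hasDerivAt_genPhase hc hx0)
    have hne : x - c ≠ 0 := sub_ne_zero.2 hx
    rw [hDH x] at h4
    apply mul_left_cancel₀ hne
    linarith
  have hHc : H c = deriv D c := by rw [hH, dslope_same]
  have hHpos : 0 < H c := by
    have : 0 < (q * (c + c) + 1) / c := by positivity
    linarith
  refine ⟨fun x => √(H x), (analyticAt_sqrt hHpos).comp hHa, Real.sqrt_pos.2 hHpos, ?_⟩
  filter_upwards [hHa.continuousAt.eventually (lt_mem_nhds hHpos)] with x hx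
  rw [mul_pow, Real.sq_sqrt (le_of_lt hx), hgD x, hDH x]
  ring

lemma analyticAt_w_of_ne {l t : ℝ} (hl : 0 ≤ l) (ht : 0 < t) (htl : t ≠ l) :
    AnalyticAt ℝ (w l) t := by
  have hw := w_pos hl ht
  have hga := analyticAt_genPhase 1 l hw
  have hws : w l t ≠ saddle l := by
    rcases lt_or_gt_of_ne htl with h | h
    · exact (w_lt_saddle ht h).ne
    · exact (saddle_lt_w hl h).ne'
  have hder : deriv (genPhase 1 l) (w l t) ≠ 0 := by
    rw [(hasDerivAt_genPhase (saddle_crit hl) hw).deriv]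
    have := saddle_nonneg hl
    exact mul_ne_zero (sub_ne_zero.2 hws) (by positivity)
  set inv := hga.hasStrictDerivAt.localInverse _ _ _ hder
  have hia : AnalyticAt ℝ inv (genPhase 1 l (w l t)) := hga.analyticAt_localInverse hder
  have hi0 : inv (genPhase 1 l (w l t)) = w l t := HasStrictFDerivAt.localInverse_apply_image ..
  have hright : ∀ᶠ y in 𝓝 (genPhase 1 l (w l t)), genPhase 1 l (inv y) = y :=
    HasStrictDerivAt.eventually_right_inverse ..
  rw [genPhase_w hl ht] at hia hi0 hright
  have hma : AnalyticAt ℝ (fun s => genPhase 0 l s + A l) t :=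
    (analyticAt_genPhase 0 l ht).add analyticAt_const
  have hcomp : AnalyticAt ℝ (fun s => inv (genPhase 0 l s + A l)) t :=
    AnalyticAt.comp (g := inv) (f := fun s => genPhase 0 l s + A l) hia hma
  have hcont : Tendsto (fun s => inv (genPhase 0 l s + A l)) (𝓝 t) (𝓝 (w l t)) := by
    have := hcomp.continuousAt.tendsto
    rwa [hi0] at this
  refine hcomp.congr ?_
  have e1 := hma.continuousAt.eventually hright
  have e2 : ∀ᶠ s in 𝓝 t, 0 < inv (genPhase 0 l s + A l) :=
    hcont.eventually (lt_mem_nhds hw)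
  rcases lt_or_gt_of_ne htl with h | h
  · have e3 : ∀ᶠ s in 𝓝 t, inv (genPhase 0 l s + A l) < saddle l :=
      hcont.eventually (gt_mem_nhds (w_lt_saddle ht h))
    filter_upwards [e1, e2, e3, lt_mem_nhds ht, gt_mem_nhds h] with s h1 h2 h3 h4 h5
    exact (w_eq_of_genPhase_eq hl h4 h2 h1 (fun h0 => absurd h5 (not_lt.2 h0))
      (fun _ => h3.le)).symm
  · have e3 : ∀ᶠ s in 𝓝 t, saddle l < inv (genPhase 0 l s + A l) :=
      hcont.eventually (lt_mem_nhds (saddle_lt_w hl h))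
    filter_upwards [e1, e2, e3, lt_mem_nhds ht, lt_mem_nhds h] with s h1 h2 h3 h4 h5
    exact (w_eq_of_genPhase_eq hl h4 h2 h1 (fun _ => h3.le)
      (fun h0 => absurd h5 (not_lt.2 h0.le))).symm

/-- At `t = l` the map `w` matches the analytic coordinates of the two phases at their minima. -/
lemma analyticAt_w_self {l : ℝ} (hl : 0 < l) : AnalyticAt ℝ (w l) l := by
  have hs := saddle_pos hl
  obtain ⟨r, hra, hr0, hr⟩ := exists_genPhase_eq_sq zero_le_one hs (saddle_crit hl.le)
  obtain ⟨p, hpa, hp0, hp⟩ := exists_genPhase_eq_sq le_rfl hl (self_crit l)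
  set R : ℝ → ℝ := fun x => (x - saddle l) * r x with hR
  have hRa : AnalyticAt ℝ R (saddle l) := (analyticAt_id.sub analyticAt_const).mul hra
  have hR0 : R (saddle l) = 0 := by simp [hR]
  have hRd : deriv R (saddle l) ≠ 0 := by
    have := ((hasDerivAt_id (saddle l)).sub_const (saddle l)).mul
      hra.differentiableAt.hasDerivAt
    have h2 : HasDerivAt R (r (saddle l)) (saddle l) := by
      refine this.congr_deriv ?_
      simp
    rw [h2.deriv]
    exact hr0.ne'
  set inv := hRa.hasStrictDerivAt.localInverse _ _ _ hRd
  have hia : AnalyticAt ℝ inv (R (saddle l)) := hRa.analyticAt_localInverse hRd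
  have hi0 : inv (R (saddle l)) = saddle l := HasStrictFDerivAt.localInverse_apply_image ..
  have hright : ∀ᶠ y in 𝓝 (R (saddle l)), R (inv y) = y :=
    HasStrictDerivAt.eventually_right_inverse ..
  set P : ℝ → ℝ := fun t => (t - l) * p t with hP
  have hPa : AnalyticAt ℝ P l := (analyticAt_id.sub analyticAt_const).mul hpa
  have hPl : P l = R (saddle l) := by simp [hP, hR0]
  rw [← hPl] at hia hi0 hright
  have hcomp : AnalyticAt ℝ (fun s => inv (P s)) l := AnalyticAt.comp (g := inv) (f := P) hia hPa
  have hcont : Tendsto (fun s => inv (P s)) (𝓝 l) (𝓝 (saddle l)) := by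
    have := hcomp.continuousAt.tendsto
    rwa [hi0] at this
  refine hcomp.congr ?_
  filter_upwards [hPa.continuousAt.eventually hright, hcont.eventually hr, hp,
    hcont.eventually (lt_mem_nhds hs), lt_mem_nhds hl,
    hcont.eventually (hra.continuousAt.eventually (lt_mem_nhds hr0)),
    hpa.continuousAt.eventually (lt_mem_nhds hp0)] with t h1 h2 h3 h4 h5 h6 h7
  have h8 : (inv (P t) - saddle l) * r (inv (P t)) = (t - l) * p t := h1
  refine (w_eq_of_genPhase_eq hl.le h5 h4 ?_ (fun h0 => ?_) (fun h0 => ?_)).symm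
  · rw [h2, h8, h3, genPhase_saddle]; ring
  · by_contra hcon
    have : (inv (P t) - saddle l) * r (inv (P t)) < 0 :=
      mul_neg_of_neg_of_pos (by linarith [not_le.1 hcon]) h6
    have : 0 ≤ (t - l) * p t := mul_nonneg (by linarith) (le_of_lt h7)
    linarith
  · by_contra hcon
    have : 0 < (inv (P t) - saddle l) * r (inv (P t)) :=
      mul_pos (by linarith [not_le.1 hcon]) h6
    have : (t - l) * p t < 0 := mul_neg_of_neg_of_pos (by linarith) h7
    linarith

lemma analyticAt_w {l t : ℝ} (hl : 0 ≤ l) (ht : 0 < t) : AnalyticAt ℝ (w l) t := by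
  rcases eq_or_ne t l with rfl | h
  · exact analyticAt_w_self ht
  · exact analyticAt_w_of_ne hl ht h

lemma deriv_w_mul {l t : ℝ} (hl : 0 ≤ l) (ht : 0 < t) :
    (w l t ^ 2 + w l t - l) / w l t * deriv (w l) t = (t - l) / t := by
  have hw := w_pos hl ht
  have h := (analyticAt_w hl ht).differentiableAt.hasDerivAt
  have h1 := (hasDerivAt_genPhase (saddle_crit hl) hw).comp t h
  have h2 := (hasDerivAt_genPhase (self_crit l) ht).add_const (A l)
  have h3 := h1.unique (h2.congr_of_eventuallyEq (by
    filter_upwards [lt_mem_nhds ht] with s hs using genPhase_w hl hs))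
  have e : w l t ^ 2 + w l t - l = (w l t - saddle l) * (1 * (w l t + saddle l) + 1) := by
    linear_combination saddle_crit hl
  rw [e, mul_div_assoc, h3]
  field_simp
  ring

/-! ### The functions `f_k` -/

/-- `f_0` expressed by `dw/dt`; this form makes sense at `t = l` too. -/
lemma f_zero_eq {l t : ℝ} (hl : 0 ≤ l) (ht : 0 < t) (htl : t ≠ l) :
    f l 0 t = (1 + 4 * l) ^ (1 / 4 : ℝ) * deriv (w l) t * √(t / w l t) := by
  have hw := w_pos hl ht
  have h := deriv_w_mul hl ht
  have hne : w l t ^ 2 + w l t - l ≠ 0 := by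
    intro h0
    rw [h0, zero_div, zero_mul] at h
    have : t - l ≠ 0 := sub_ne_zero.2 htl
    exact (div_ne_zero this ht.ne') h.symm
  have hd : deriv (w l) t = (t - l) / (w l t ^ 2 + w l t - l) * (w l t / t) := by
    generalize w l t ^ 2 + w l t - l = D at h hne
    have h1 : deriv (w l) t = w l t / D * (D / w l t * deriv (w l) t) := by field_simp
    rw [h1, h]
    ring
  have hs : √(w l t / t) = w l t / t * √(t / w l t) := by
    rw [Real.sqrt_div hw.le, Real.sqrt_div ht.le]
    have h1 := Real.sq_sqrt hw.le
    have h2 := Real.sq_sqrt ht.le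
    have := Real.sqrt_pos.2 hw
    have := Real.sqrt_pos.2 ht
    field_simp
    rw [h1, h2, mul_comm]
  rw [f]
  beta_reduce
  rw [hd, hs]
  ring

lemma w_zero_eq {t : ℝ} (ht : 0 < t) : w 0 t = √(1 + 2 * t) - 1 := by
  have h1 := Real.sq_sqrt (by positivity : 0 ≤ 1 + 2 * t)
  have h2 : 1 < √(1 + 2 * t) := Real.lt_sqrt_of_sq_lt (by linarith)
  refine w_eq_of_genPhase_eq le_rfl ht (by linarith) ?_ (fun _ => ?_) (fun h => absurd h ht.not_gt)
  · simp only [genPhase, A_eq le_rfl]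
    linear_combination h1 / 2
  · simp [saddle]; linarith

/-- `f_0` extends analytically to `t = l`. -/
lemma exists_analytic_extension {l : ℝ} (hl : 0 ≤ l) :
    ∃ F : ℝ → ℝ, (∀ t ∈ insert l (Ioi 0), AnalyticAt ℝ F t) ∧
      ∀ t, 0 < t → F t = (1 + 4 * l) ^ (1 / 4 : ℝ) * deriv (w l) t * √(t / w l t) := by
  rcases hl.eq_or_lt with rfl | hl'
  · refine ⟨fun t => √((1 + √(1 + 2 * t)) / 2) / √(1 + 2 * t), ?_, ?_⟩
    · intro t ht
      have ht0 : 0 ≤ t := by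
        rcases ht with rfl | ht
        · exact le_rfl
        · exact le_of_lt ht
      have h1 : 0 < 1 + 2 * t := by positivity
      have h2 : AnalyticAt ℝ (fun t : ℝ => √(1 + 2 * t)) t :=
        AnalyticAt.comp (g := fun x => √x) (f := fun t : ℝ => 1 + 2 * t) (analyticAt_sqrt h1)
          (by fun_prop)
      have h3 : AnalyticAt ℝ (fun t : ℝ => √((1 + √(1 + 2 * t)) / 2)) t :=
        AnalyticAt.comp (g := fun x => √x) (f := fun t : ℝ => (1 + √(1 + 2 * t)) / 2)
          (analyticAt_sqrt (by positivity)) ((analyticAt_const.add h2).div_const)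
      exact h3.div h2 (Real.sqrt_pos.2 h1).ne'
    · intro t ht
      have h1 : 0 < 1 + 2 * t := by positivity
      have h2 := Real.sq_sqrt h1.le
      have h3 := Real.sqrt_pos.2 h1
      have hd : deriv (w 0) t = 1 / √(1 + 2 * t) := by
        have e : w 0 =ᶠ[𝓝 t] fun t => √(1 + 2 * t) - 1 := by
          filter_upwards [lt_mem_nhds ht] with s hs using w_zero_eq hs
        rw [e.deriv_eq]
        have := ((((hasDerivAt_id t).const_mul 2).const_add 1).sqrt h1.ne').sub_const 1
        rw [show deriv (fun t : ℝ => √(1 + 2 * t) - 1) t = _ from this.deriv]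
        simp only [id]
        field_simp
      have hr : t / w 0 t = (1 + √(1 + 2 * t)) / 2 := by
        have h4 : 1 < √(1 + 2 * t) := Real.lt_sqrt_of_sq_lt (by linarith)
        have h5 : √(1 + 2 * t) - 1 ≠ 0 := by linarith
        rw [w_zero_eq ht, div_eq_iff h5]
        linear_combination -h2 / 2
      rw [hd, hr]
      simp
      ring
  · refine ⟨fun t => (1 + 4 * l) ^ (1 / 4 : ℝ) * deriv (w l) t * √(t / w l t), ?_,
      fun t _ => rfl⟩
    intro t ht
    have ht0 : 0 < t := by
      rcases ht with rfl | ht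
      · exact hl'
      · exact ht
    have hw := w_pos hl ht0
    have hwa := analyticAt_w hl ht0
    refine (analyticAt_const.mul hwa.deriv).mul ?_
    exact AnalyticAt.comp (g := fun x => √x) (f := fun t => t / w l t)
      (analyticAt_sqrt (by positivity)) (analyticAt_id.div hwa hw.ne')

/-- The operator `F ↦ √t d/dt [√t (F(t) - F(l)) / (t - l)]`, in a form regular at `t = l`. -/
noncomputable def stepOp (l : ℝ) (F : ℝ → ℝ) : ℝ → ℝ :=
  fun t => dslope F l t / 2 + t * deriv (dslope F l) t

lemma analyticAt_dslope {F : ℝ → ℝ} {l t : ℝ} (h : AnalyticAt ℝ F t) :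
    AnalyticAt ℝ (dslope F l) t := by
  rcases eq_or_ne t l with rfl | htl
  · exact analyticAt_dslope_self h
  · have : AnalyticAt ℝ (fun s => (F s - F l) / (s - l)) t :=
      (h.sub analyticAt_const).div (analyticAt_id.sub analyticAt_const) (sub_ne_zero.2 htl)
    refine this.congr ?_
    filter_upwards [isOpen_ne.mem_nhds htl] with s hs
    rw [dslope_of_ne _ hs, slope_def_field]

lemma analyticAt_stepOp {F : ℝ → ℝ} {l t : ℝ} (h : AnalyticAt ℝ F t) :
    AnalyticAt ℝ (stepOp l F) t := by
  have h1 := analyticAt_dslope (l := l) h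
  exact h1.div_const.add (analyticAt_id.mul h1.deriv)

lemma neBot_nhdsWithin_self {l : ℝ} (hl : 0 ≤ l) : (𝓝[Ioi 0 \ {l}] l).NeBot := by
  have : 𝓝[>] l ≤ 𝓝[Ioi 0 \ {l}] l :=
    nhdsWithin_mono l fun x hx => ⟨hl.trans_lt hx, fun h => (ne_of_gt hx) h⟩
  exact Filter.NeBot.mono inferInstance this

/-- The functions `f_k` are the iterates of `stepOp` on the analytic extension of `f_0`. -/
lemma f_eq_iterate {l : ℝ} (hl : 0 ≤ l) {F : ℝ → ℝ}
    (hF : ∀ t ∈ insert l (Ioi 0), AnalyticAt ℝ F t)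
    (hf : ∀ t, 0 < t → t ≠ l → f l 0 t = F t) (k : ℕ) :
    (∀ t ∈ insert l (Ioi 0), AnalyticAt ℝ ((stepOp l)^[k] F) t) ∧
    (∀ t, 0 < t → t ≠ l → f l k t = (stepOp l)^[k] F t) ∧
    Tendsto (f l k) (𝓝[Ioi 0 \ {l}] l) (𝓝 ((stepOp l)^[k] F l)) ∧
    coeff k l = (stepOp l)^[k] F l := by
  have hlim : ∀ G : ℝ → ℝ, AnalyticAt ℝ G l → (∀ t, 0 < t → t ≠ l → f l k t = G t) →
      Tendsto (f l k) (𝓝[Ioi 0 \ {l}] l) (𝓝 (G l)) ∧ coeff k l = G l := by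
    intro G hG hfG
    have := neBot_nhdsWithin_self hl
    have h1 : Tendsto G (𝓝[Ioi 0 \ {l}] l) (𝓝 (G l)) :=
      hG.continuousAt.tendsto.mono_left nhdsWithin_le_nhds
    have h2 : Tendsto (f l k) (𝓝[Ioi 0 \ {l}] l) (𝓝 (G l)) := by
      refine h1.congr' ?_
      filter_upwards [self_mem_nhdsWithin] with t ht
      exact (hfG t ht.1 ht.2).symm
    exact ⟨h2, h2.limUnder_eq⟩
  suffices h : (∀ t ∈ insert l (Ioi 0), AnalyticAt ℝ ((stepOp l)^[k] F) t) ∧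
      (∀ t, 0 < t → t ≠ l → f l k t = (stepOp l)^[k] F t) from
    ⟨h.1, h.2, hlim _ (h.1 l (mem_insert _ _)) h.2⟩
  clear hlim
  induction k with
  | zero => exact ⟨hF, hf⟩
  | succ k ih =>
    obtain ⟨ih1, ih2⟩ := ih
    rw [Function.iterate_succ_apply']
    set G := (stepOp l)^[k] F with hG
    refine ⟨fun t ht => analyticAt_stepOp (ih1 t ht), fun t ht htl => ?_⟩
    have hval : valueAt l (f l k) = G l := by
      have := neBot_nhdsWithin_self hl
      have h1 : Tendsto G (𝓝[Ioi 0 \ {l}] l) (𝓝 (G l)) :=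
        (ih1 l (mem_insert _ _)).continuousAt.tendsto.mono_left nhdsWithin_le_nhds
      refine Tendsto.limUnder_eq (h1.congr' ?_)
      filter_upwards [self_mem_nhdsWithin] with t ht
      exact (ih2 t ht.1 ht.2).symm
    have hda := analyticAt_dslope (l := l) (ih1 t (mem_insert_of_mem _ ht))
    have e : (fun s => √s * ((f l k s - valueAt l (f l k)) / (s - l)))
        =ᶠ[𝓝 t] fun s => √s * dslope G l s := by
      filter_upwards [isOpen_ne.mem_nhds htl, lt_mem_nhds ht] with s hs hs0
      rw [hval, ih2 s hs0 hs, dslope_of_ne _ hs, slope_def_field]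
    have hd := (Real.hasDerivAt_sqrt ht.ne').mul hda.differentiableAt.hasDerivAt
    rw [f]
    beta_reduce
    rw [e.deriv_eq, show deriv (fun s => √s * dslope G l s) t = _ from hd.deriv, stepOp]
    have h1 := Real.sq_sqrt ht.le
    have h2 := Real.sqrt_pos.2 ht
    field_simp
    rw [h1]
    ring

lemma contDiffOn_f {l : ℝ} (hl : 0 ≤ l) (k : ℕ) :
    ContDiffOn ℝ ∞ (f l k) (Ioi 0 \ {l}) := by
  obtain ⟨F, hF, hFf⟩ := exists_analytic_extension hl
  obtain ⟨h1, h2, -, -⟩ := f_eq_iterate hl hF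
    (fun t ht htl => by rw [f_zero_eq hl ht htl, hFf t ht]) k
  have : ContDiffOn ℝ ∞ ((stepOp l)^[k] F) (Ioi 0 \ {l}) := fun t ht =>
    (h1 t (mem_insert_of_mem _ ht.1)).contDiffAt.contDiffWithinAt
  exact this.congr fun t ht => h2 t ht.1 ht.2

lemma tendsto_f {l : ℝ} (hl : 0 ≤ l) (k : ℕ) :
    Tendsto (f l k) (𝓝[Ioi 0 \ {l}] l) (𝓝 (coeff k l)) := by
  obtain ⟨F, hF, hFf⟩ := exists_analytic_extension hl
  obtain ⟨-, -, h3, h4⟩ := f_eq_iterate hl hF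
    (fun t ht htl => by rw [f_zero_eq hl ht htl, hFf t ht]) k
  rwa [h4]

/-! ### Laplace's method for fixed `l` -/

/-- The density `t^{-1/2} e^{-κ (t - l log t)} = t^{κ l - 1/2} e^{-κ t}` on `t > 0`. -/
noncomputable def gammaDensity (l κ t : ℝ) : ℝ :=
  t ^ (-(1 / 2) : ℝ) * Real.exp (-κ * genPhase 0 l t)

/-- The total mass of `gammaDensity`. -/
noncomputable def gammaMass (l κ : ℝ) : ℝ := ∫ t in Ioi (0 : ℝ), gammaDensity l κ t

lemma gammaDensity_nonneg {l κ t : ℝ} (ht : 0 ≤ t) : 0 ≤ gammaDensity l κ t := by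
  unfold gammaDensity; positivity

lemma gammaDensity_eq {l κ t : ℝ} (ht : 0 < t) :
    gammaDensity l κ t = t ^ (l * κ + 1 / 2 - 1) * Real.exp (-(κ * t)) := by
  rw [gammaDensity, genPhase_zero, Real.rpow_def_of_pos ht, Real.rpow_def_of_pos ht,
    ← Real.exp_add, ← Real.exp_add]
  ring_nf

lemma integrableOn_gammaDensity {l κ : ℝ} (hl : 0 ≤ l) (hκ : 0 < κ) :
    IntegrableOn (gammaDensity l κ) (Ioi 0) := by
  have h := integrableOn_rpow_mul_exp_neg_mul_rpow (p := 1) (s := l * κ + 1 / 2 - 1) (b := κ)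
    (by nlinarith [mul_nonneg hl hκ.le]) one_pos hκ
  refine h.congr_fun (fun t ht => ?_) measurableSet_Ioi
  simp only
  rw [gammaDensity_eq ht, Real.rpow_one, neg_mul]

lemma gammaMass_eq {l κ : ℝ} (hl : 0 ≤ l) (hκ : 0 < κ) :
    gammaMass l κ = (1 / κ) ^ (l * κ + 1 / 2) * Real.Gamma (l * κ + 1 / 2) := by
  rw [← Real.integral_rpow_mul_exp_neg_mul_Ioi (by positivity) hκ, gammaMass]
  exact setIntegral_congr_fun measurableSet_Ioi fun t ht => gammaDensity_eq ht

lemma gammaMass_pos {l κ : ℝ} (hl : 0 ≤ l) (hκ : 0 < κ) : 0 < gammaMass l κ := by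
  rw [gammaMass_eq hl hκ]
  have : 0 < Real.Gamma (l * κ + 1 / 2) := Real.Gamma_pos_of_pos (by positivity)
  positivity

/-- The integrand of the scaled integral representation of `U`. -/
lemma rpow_mul_exp_genPhase {l κ s : ℝ} (hs : 0 < s) :
    s ^ (-(1 / 2) : ℝ) * Real.exp (-κ * genPhase 1 l s)
      = s ^ (l * κ - 1 / 2) * Real.exp (-κ * s ^ 2 / 2 - κ * s) := by
  rw [genPhase, Real.rpow_def_of_pos hs, Real.rpow_def_of_pos hs, ← Real.exp_add, ← Real.exp_add]
  ring_nf

lemma integrableOn_rpow_mul_exp_genPhase {l κ : ℝ} (hl : 0 ≤ l) (hκ : 0 < κ) :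
    IntegrableOn (fun s : ℝ => s ^ (-(1 / 2) : ℝ) * Real.exp (-κ * genPhase 1 l s)) (Ioi 0) := by
  have h := integrableOn_rpow_mul_exp_neg_mul_sq (b := κ / 2) (s := l * κ - 1 / 2)
    (by positivity) (by nlinarith [mul_nonneg hl hκ.le])
  have h2 : IntegrableOn (fun s : ℝ => s ^ (l * κ - 1 / 2) * Real.exp (-κ * s ^ 2 / 2 - κ * s))
      (Ioi 0) := by
    refine Integrable.mono' h (Measurable.aestronglyMeasurable (by fun_prop)) ?_
    filter_upwards [ae_restrict_mem measurableSet_Ioi] with s hs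
    have hs' : (0 : ℝ) < s := hs
    rw [Real.norm_of_nonneg (by positivity)]
    have : 0 ≤ κ * s := by positivity
    gcongr
    linarith
  exact h2.congr_fun (fun s hs => (rpow_mul_exp_genPhase hs).symm) measurableSet_Ioi

/-- The integrand after the substitution `s = w(t)`. -/
lemma deriv_w_smul {l κ t : ℝ} (hl : 0 ≤ l) (ht : 0 < t) {F : ℝ → ℝ}
    (hF : F t = (1 + 4 * l) ^ (1 / 4 : ℝ) * deriv (w l) t * √(t / w l t)) :
    F t * gammaDensity l κ t = (1 + 4 * l) ^ (1 / 4 : ℝ) * Real.exp (κ * A l)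
      * (deriv (w l) t • (w l t ^ (-(1 / 2) : ℝ) * Real.exp (-κ * genPhase 1 l (w l t)))) := by
  have hw := w_pos hl ht
  have hs : √(t / w l t) * t ^ (-(1 / 2) : ℝ) = w l t ^ (-(1 / 2) : ℝ) := by
    rw [Real.sqrt_eq_rpow, Real.div_rpow ht.le hw.le, Real.rpow_neg ht.le, Real.rpow_neg hw.le]
    have : 0 < t ^ (1 / 2 : ℝ) := by positivity
    field_simp
  rw [hF, gammaDensity, genPhase_w hl ht, ← hs, smul_eq_mul,
    show -κ * (genPhase 0 l t + A l) = -κ * genPhase 0 l t - κ * A l by ring, Real.exp_sub]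
  field_simp

/-- `U` divided by the leading factor is the mean of `f_0` with respect to `gammaDensity`. -/
lemma U_div_leading_eq_mean {l z : ℝ} (hl : 0 ≤ l) (hz : 0 < z) {F : ℝ → ℝ}
    (hF : ∀ t, 0 < t → F t = (1 + 4 * l) ^ (1 / 4 : ℝ) * deriv (w l) t * √(t / w l t)) :
    IntegrableOn (fun t => F t * gammaDensity l (z ^ 2) t) (Ioi 0) ∧
    U (l * z ^ 2) z / leading (l * z ^ 2) z
      = (∫ t in Ioi (0 : ℝ), F t * gammaDensity l (z ^ 2) t) / gammaMass l (z ^ 2) := by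
  have hz2 : 0 < z ^ 2 := by positivity
  set a := l * z ^ 2 with ha
  have ha0 : 0 ≤ a := by positivity
  have hder : ∀ t ∈ Ioi (0 : ℝ), HasDerivWithinAt (w l) (deriv (w l) t) (Ioi 0) t := fun t ht =>
    (analyticAt_w hl ht).differentiableAt.hasDerivAt.hasDerivWithinAt
  set g : ℝ → ℝ := fun s => s ^ (-(1 / 2) : ℝ) * Real.exp (-z ^ 2 * genPhase 1 l s) with hg
  have hmono := (strictMonoOn_w hl).monotoneOn
  have hint := integrableOn_rpow_mul_exp_genPhase (l := l) hl hz2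
  have hcv := integral_image_eq_integral_deriv_smul_of_monotoneOn measurableSet_Ioi hder hmono g
  have hci := (integrableOn_image_iff_integrableOn_deriv_smul_of_monotoneOn measurableSet_Ioi
    hder hmono g).1 (by rw [image_w hl]; exact hint)
  rw [image_w hl] at hcv
  have heq : EqOn (fun t => F t * gammaDensity l (z ^ 2) t) (fun t => (1 + 4 * l) ^ (1 / 4 : ℝ)
      * Real.exp (z ^ 2 * A l) * (deriv (w l) t • g (w l t))) (Ioi 0) := fun t ht =>
    deriv_w_smul hl ht (hF t ht)
  refine ⟨IntegrableOn.congr_fun (hci.const_mul _) heq.symm measurableSet_Ioi, ?_⟩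
  rw [setIntegral_congr_fun measurableSet_Ioi heq, integral_const_mul, ← hcv,
    U_div_leading ha0 hz, J_scale _ _ hz, gammaMass_eq hl hz2, ← ha,
    show a / z ^ 2 = l by rw [ha]; field_simp]
  have hJ : ∫ s in Ioi (0 : ℝ), s ^ (a - 1 / 2) * Real.exp (-z ^ 2 * s ^ 2 / 2 - z * z * s)
      = ∫ s in Ioi (0 : ℝ), g s := by
    refine setIntegral_congr_fun measurableSet_Ioi fun s hs => ?_
    simp only [hg]
    rw [rpow_mul_exp_genPhase hs, ← ha, sq z]
  rw [hJ, show a - 1 / 2 + 1 = a + 1 / 2 by ring, one_div (z ^ 2), Real.inv_rpow hz2.le, sq z,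
    Real.mul_rpow hz.le hz.le, mul_comm (A l)]
  have hG : 0 < Real.Gamma (a + 1 / 2) := Real.Gamma_pos_of_pos (by positivity)
  have hzp : 0 < z ^ (a + 1 / 2) := by positivity
  field_simp

/-- `(α, β]` is a neighbourhood of `l` in `[0, ∞)` outside of which, and at whose endpoints, the
phase exceeds its minimum by at least `2 η`. For `l = 0` the minimum is at the boundary and `α = 0`;
the boundary term at `α` then vanishes because of a factor `√α`. -/
structure LocalInterval (l α β η : ℝ) : Prop where
  pos : 0 < η
  left : (0 < α ∧ α < l) ∨ (α = 0 ∧ l = 0)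
  right : l < β
  bound_right : genPhase 0 l l + 2 * η ≤ genPhase 0 l β
  bound_left : α = 0 ∨ genPhase 0 l l + 2 * η ≤ genPhase 0 l α
  bound : ∀ t, 0 < t → t ∉ Ioc α β → genPhase 0 l l + 2 * η ≤ genPhase 0 l t

lemma exists_localInterval {l : ℝ} (hl : 0 ≤ l) : ∃ α β η, LocalInterval l α β η := by
  have hmono := strictMonoOn_genPhase le_rfl hl (self_crit l)
  have hβ : genPhase 0 l l < genPhase 0 l (l + 1) :=
    hmono self_mem_Ici (show l ≤ l + 1 by linarith) (by linarith)
  rcases hl.eq_or_lt with hl0 | hl'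
  · refine ⟨0, l + 1, (genPhase 0 l (l + 1) - genPhase 0 l l) / 2, by linarith,
      Or.inr ⟨rfl, hl0.symm⟩, by linarith, by linarith, Or.inl rfl, fun t ht htn => ?_⟩
    have h1 : l + 1 < t := by
      by_contra h
      exact htn ⟨ht, not_lt.1 h⟩
    have := hmono.monotoneOn (show l ≤ l + 1 by linarith) (show l ≤ t by linarith) h1.le
    linarith
  · have hanti := strictAntiOn_genPhase le_rfl (self_crit l)
    have hα : genPhase 0 l l < genPhase 0 l (l / 2) :=
      hanti ⟨by linarith, by linarith⟩ ⟨hl', le_rfl⟩ (by linarith)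
    set η := min (genPhase 0 l (l / 2) - genPhase 0 l l)
      (genPhase 0 l (l + 1) - genPhase 0 l l) / 2 with hη
    have h1 : 2 * η ≤ genPhase 0 l (l / 2) - genPhase 0 l l := by
      rw [hη]; linarith [min_le_left (genPhase 0 l (l / 2) - genPhase 0 l l)
        (genPhase 0 l (l + 1) - genPhase 0 l l)]
    have h2 : 2 * η ≤ genPhase 0 l (l + 1) - genPhase 0 l l := by
      rw [hη]; linarith [min_le_right (genPhase 0 l (l / 2) - genPhase 0 l l)
        (genPhase 0 l (l + 1) - genPhase 0 l l)]
    have h0 : 0 < η := by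
      rw [hη]; exact half_pos (lt_min (by linarith) (by linarith))
    refine ⟨l / 2, l + 1, η, h0, Or.inl ⟨by linarith, by linarith⟩, by linarith, by linarith,
      Or.inr (by linarith), fun t ht htn => ?_⟩
    rcases le_or_gt t (l / 2) with h | h
    · have := hanti.antitoneOn ⟨ht, by linarith⟩ ⟨by linarith, by linarith⟩ h
      linarith
    · have h3 : l + 1 < t := by
        by_contra h'
        exact htn ⟨h, not_lt.1 h'⟩
      have := hmono.monotoneOn (show l ≤ l + 1 by linarith) (show l ≤ t by linarith) h3.le
      linarith

/-- A lower bound for the mass, from the points to the right of `l` with phase at most `η` above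
its minimum. -/
lemma exists_gammaMass_ge {l η : ℝ} (hl : 0 ≤ l) (hη : 0 < η) :
    ∃ c, 0 < c ∧ ∀ κ, 0 < κ → c * Real.exp (-κ * (genPhase 0 l l + η)) ≤ gammaMass l κ := by
  have hcont := continuousOn_genPhase_Ici hl (self_crit l) l self_mem_Ici
  have hev : ∀ᶠ t in 𝓝[≥] l, genPhase 0 l t < genPhase 0 l l + η :=
    hcont.tendsto.eventually (gt_mem_nhds (by linarith))
  obtain ⟨b, hb, hbs⟩ := (mem_nhdsGE_iff_exists_Ico_subset).1 hev
  have hb' : l < b := hb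
  set β := (l + b) / 2 with hβ
  have hβl : l < β := by linarith
  have hβ0 : 0 < β := hl.trans_lt hβl
  refine ⟨β ^ (-(1 / 2) : ℝ) * (β - l), mul_pos (by positivity) (by linarith), fun κ hκ => ?_⟩
  have hsub : Ioc l β ⊆ Ioi 0 := fun t ht => hl.trans_lt ht.1
  calc β ^ (-(1 / 2) : ℝ) * (β - l) * Real.exp (-κ * (genPhase 0 l l + η))
      = ∫ _ in Ioc l β, β ^ (-(1 / 2) : ℝ) * Real.exp (-κ * (genPhase 0 l l + η)) := by
        rw [setIntegral_const, Measure.real, Real.volume_Ioc,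
          ENNReal.toReal_ofReal (by linarith), smul_eq_mul]
        ring
    _ ≤ ∫ t in Ioc l β, gammaDensity l κ t := by
        refine setIntegral_mono_on (integrableOn_const (by simp))
          ((integrableOn_gammaDensity hl hκ).mono_set hsub) measurableSet_Ioc fun t ht => ?_
        have ht0 : 0 < t := hsub ht
        have h1 : genPhase 0 l t < genPhase 0 l l + η := hbs ⟨ht.1.le, by linarith [ht.2]⟩
        have h2 : β ^ (-(1 / 2) : ℝ) ≤ t ^ (-(1 / 2) : ℝ) :=
          Real.rpow_le_rpow_of_nonpos ht0 ht.2 (by norm_num)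
        rw [gammaDensity]
        refine mul_le_mul h2 (Real.exp_le_exp.2 ?_) (Real.exp_pos _).le (by positivity)
        nlinarith
    _ ≤ gammaMass l κ := by
        refine setIntegral_mono_set (integrableOn_gammaDensity hl hκ) ?_ hsub.eventuallyLE
        filter_upwards [ae_restrict_mem measurableSet_Ioi] with t ht
        exact gammaDensity_nonneg (le_of_lt ht)

/-- Exponentially small multiples are negligible. -/
lemma exists_exp_le_gammaMass {l η : ℝ} (hl : 0 ≤ l) (hη : 0 < η) (N : ℕ) :
    ∃ C, 0 ≤ C ∧ ∀ κ, 1 ≤ κ →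
      Real.exp (-κ * (genPhase 0 l l + 2 * η)) ≤ C / κ ^ N * gammaMass l κ := by
  obtain ⟨c, hc, hcm⟩ := exists_gammaMass_ge hl hη
  refine ⟨N.factorial / η ^ N / c, by positivity, fun κ hκ => ?_⟩
  have hκ0 : 0 < κ := by linarith
  have h1 := hcm κ hκ0
  have h2 := Real.pow_div_factorial_le_exp (η * κ) (by positivity) N
  have h3 : Real.exp (-(η * κ)) ≤ N.factorial / (η * κ) ^ N := by
    rw [Real.exp_neg, inv_le_comm₀ (Real.exp_pos _) (by positivity), inv_div]
    exact h2
  calc Real.exp (-κ * (genPhase 0 l l + 2 * η))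
      = Real.exp (-(η * κ)) * Real.exp (-κ * (genPhase 0 l l + η)) := by
        rw [← Real.exp_add]; ring_nf
    _ ≤ (N.factorial / (η * κ) ^ N) * (gammaMass l κ / c) := by
        gcongr
        rw [le_div_iff₀ hc, mul_comm]
        exact h1
    _ = _ := by
        rw [mul_pow]
        field_simp

/-- The contribution from outside of the interval is negligible. -/
lemma exists_tail_le {l α β η : ℝ} (hl : 0 ≤ l) (hI : LocalInterval l α β η) {F : ℝ → ℝ}
    (hF : ∀ κ, 1 ≤ κ → IntegrableOn (fun t => F t * gammaDensity l κ t) (Ioi 0)) (N : ℕ) :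
    ∃ C, 0 ≤ C ∧ ∀ κ, 1 ≤ κ →
      |(∫ t in Ioi (0 : ℝ), F t * gammaDensity l κ t) - ∫ t in Ioc α β, F t * gammaDensity l κ t|
        ≤ C / κ ^ N * gammaMass l κ := by
  obtain ⟨C, hC0, hC⟩ := exists_exp_le_gammaMass hl hI.pos N
  have hα0 : 0 ≤ α := by rcases hI.left with h | h <;> linarith [h.1]
  have hsub : Ioc α β ⊆ Ioi 0 := fun t ht => hα0.trans_lt ht.1
  set M := ∫ t in Ioi (0 : ℝ), |F t * gammaDensity l 1 t| with hM
  have hM0 : 0 ≤ M := integral_nonneg fun t => abs_nonneg _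
  -- Outside of the interval the density at `κ` is at most `e^{-(κ - 1) (min + 2η)}` times the
  -- density at `1`.
  refine ⟨Real.exp (genPhase 0 l l + 2 * η) * M * C, by positivity, fun κ hκ => ?_⟩
  have hd := setIntegral_sdiff (f := fun t => F t * gammaDensity l κ t) (μ := volume)
    measurableSet_Ioc (hF κ hκ) hsub
  rw [← hd]
  have hi1 : IntegrableOn (fun t => |F t * gammaDensity l 1 t|) (Ioi 0) := (hF 1 le_rfl).abs
  calc |∫ t in Ioi (0 : ℝ) \ Ioc α β, F t * gammaDensity l κ t|
      ≤ ∫ t in Ioi (0 : ℝ) \ Ioc α β, |F t * gammaDensity l κ t| := abs_integral_le_integral_abs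
    _ ≤ ∫ t in Ioi (0 : ℝ) \ Ioc α β, Real.exp (-(κ - 1) * (genPhase 0 l l + 2 * η))
          * |F t * gammaDensity l 1 t| := by
        refine setIntegral_mono_on (((hF κ hκ).mono_set sdiff_subset).abs)
          ((hi1.mono_set sdiff_subset).const_mul _) (measurableSet_Ioi.diff measurableSet_Ioc)
          fun t ht => ?_
        have ht0 : 0 < t := ht.1
        have hb := hI.bound t ht0 ht.2
        have e : gammaDensity l κ t
            = Real.exp (-(κ - 1) * genPhase 0 l t) * gammaDensity l 1 t := by
          rw [gammaDensity, gammaDensity, mul_left_comm, ← Real.exp_add]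
          ring_nf
        rw [e, mul_left_comm, abs_mul, abs_of_pos (Real.exp_pos _)]
        refine mul_le_mul_of_nonneg_right (Real.exp_le_exp.2 ?_) (abs_nonneg _)
        nlinarith
    _ = Real.exp (-(κ - 1) * (genPhase 0 l l + 2 * η))
          * ∫ t in Ioi (0 : ℝ) \ Ioc α β, |F t * gammaDensity l 1 t| := integral_const_mul _ _
    _ ≤ Real.exp (-(κ - 1) * (genPhase 0 l l + 2 * η)) * M := by
        refine mul_le_mul_of_nonneg_left ?_ (Real.exp_pos _).le
        exact setIntegral_mono_set hi1 (Eventually.of_forall fun t => abs_nonneg _)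
          sdiff_subset.eventuallyLE
    _ = Real.exp (genPhase 0 l l + 2 * η) * M
          * Real.exp (-κ * (genPhase 0 l l + 2 * η)) := by
        rw [mul_right_comm, ← Real.exp_add]; ring_nf
    _ ≤ Real.exp (genPhase 0 l l + 2 * η) * M * (C / κ ^ N * gammaMass l κ) :=
        mul_le_mul_of_nonneg_left (hC κ hκ) (by positivity)
    _ = _ := by ring

lemma LocalInterval.Icc_subset {l α β η : ℝ} (hI : LocalInterval l α β η) :
    Icc α β ⊆ insert l (Ioi 0) := by
  intro t ht
  rcases hI.left with h | h
  · exact mem_insert_of_mem _ (h.1.trans_le ht.1)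
  · rcases (h.1 ▸ ht.1).eq_or_lt with h0 | h0
    · rw [← h0, h.2]; exact mem_insert _ _
    · exact mem_insert_of_mem _ h0

lemma integrableOn_mul_gammaDensity {l κ α β η : ℝ} (hl : 0 ≤ l) (hκ : 0 < κ)
    (hI : LocalInterval l α β η) {G : ℝ → ℝ} (hG : ∀ t ∈ insert l (Ioi 0), AnalyticAt ℝ G t) :
    IntegrableOn (fun t => G t * gammaDensity l κ t) (Ioc α β) := by
  have hα0 : 0 ≤ α := by rcases hI.left with h | h <;> linarith [h.1]
  have h1 : IntegrableOn (gammaDensity l κ) (Icc α β) := by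
    rw [integrableOn_Icc_iff_integrableOn_Ioc]
    exact (integrableOn_gammaDensity hl hκ).mono_set fun t ht => hα0.trans_lt ht.1
  have h2 : ContinuousOn G (Icc α β) := fun t ht =>
    (hG t (hI.Icc_subset ht)).continuousAt.continuousWithinAt
  exact (h1.continuousOn_mul h2 isCompact_Icc).mono_set Ioc_subset_Icc_self

/-- Integration by parts on the interval: `(t - l) gammaDensity` is `-κ⁻¹ √t` times the derivative
of `e^{-κ (t - l log t)}`. -/
lemma integral_stepOp {l κ α β η : ℝ} (hl : 0 ≤ l) (hκ : 0 < κ) (hI : LocalInterval l α β η)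
    {F : ℝ → ℝ} (hF : ∀ t ∈ insert l (Ioi 0), AnalyticAt ℝ F t) :
    ∫ t in Ioc α β, F t * gammaDensity l κ t
      = F l * (∫ t in Ioc α β, gammaDensity l κ t)
        + κ⁻¹ * (∫ t in Ioc α β, stepOp l F t * gammaDensity l κ t)
        - κ⁻¹ * (Real.exp (-κ * genPhase 0 l β) * (√β * dslope F l β)
          - Real.exp (-κ * genPhase 0 l α) * (√α * dslope F l α)) := by
  have hα0 : 0 ≤ α := by rcases hI.left with h | h <;> linarith [h.1]
  have hαl : α ≤ l := by rcases hI.left with h | h <;> linarith [h.1, h.2]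
  have hαβ : α ≤ β := hαl.trans hI.right.le
  set D := dslope F l with hD
  have hDa : ∀ t ∈ insert l (Ioi 0), AnalyticAt ℝ D t := fun t ht => analyticAt_dslope (hF t ht)
  have hSa : ∀ t ∈ insert l (Ioi 0), AnalyticAt ℝ (stepOp l F) t :=
    fun t ht => analyticAt_stepOp (hF t ht)
  have hMa : ∀ t ∈ insert l (Ioi 0), AnalyticAt ℝ (fun t => (t - l) * D t) t := fun t ht =>
    (analyticAt_id.sub analyticAt_const).mul (hDa t ht)
  have i1 := integrableOn_mul_gammaDensity hl hκ hI hSa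
  have i2 := integrableOn_mul_gammaDensity hl hκ hI hMa
  have i3 : IntegrableOn (gammaDensity l κ) (Ioc α β) :=
    (integrableOn_gammaDensity hl hκ).mono_set fun t ht => hα0.trans_lt ht.1
  have hphase : ContinuousOn (genPhase 0 l) (Icc α β) := by
    rcases hI.left with h | h
    · exact (continuousOn_genPhase_Ioi 0 l).mono fun t ht => h.1.trans_le ht.1
    · refine (continuousOn_genPhase_Ici hl (self_crit l)).mono fun t ht => ?_
      have := ht.1
      rw [mem_Ici]; linarith [h.1, h.2]
  have hcont : ContinuousOn (fun t => Real.exp (-κ * genPhase 0 l t) * (√t * D t)) (Icc α β) := by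
    refine ContinuousOn.mul (hphase.const_mul _).rexp
      (Real.continuous_sqrt.continuousOn.mul fun t ht => ?_)
    exact (hDa t (hI.Icc_subset ht)).continuousAt.continuousWithinAt
  have hderiv : ∀ t ∈ Ioo α β, HasDerivAt
      (fun t => Real.exp (-κ * genPhase 0 l t) * (√t * D t))
      (stepOp l F t * gammaDensity l κ t - κ * ((t - l) * D t * gammaDensity l κ t)) t := by
    intro t ht
    have ht0 : 0 < t := hα0.trans_lt ht.1
    have h1 := ((hasDerivAt_genPhase (self_crit l) ht0).const_mul (-κ)).exp
    have h2 := (Real.hasDerivAt_sqrt ht0.ne').mul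
      (hDa t (mem_insert_of_mem _ ht0)).differentiableAt.hasDerivAt
    refine (h1.mul h2).congr_deriv ?_
    have hs := Real.sq_sqrt ht0.le
    have hs0 := Real.sqrt_pos.2 ht0
    have hr : t ^ (-(1 / 2) : ℝ) = (√t)⁻¹ := by
      rw [Real.rpow_neg ht0.le, Real.sqrt_eq_rpow]
    simp only [gammaDensity, stepOp, ← hD, Pi.mul_apply, hr]
    generalize √t = q at hs hs0
    subst hs
    field_simp
    ring
  have hint : IntervalIntegrable (fun t => stepOp l F t * gammaDensity l κ t
      - κ * ((t - l) * D t * gammaDensity l κ t)) volume α β := by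
    rw [intervalIntegrable_iff_integrableOn_Ioc_of_le hαβ]
    exact i1.sub (i2.const_mul κ)
  have key := intervalIntegral.integral_eq_sub_of_hasDerivAt_of_le hαβ hcont hderiv hint
  rw [intervalIntegral.integral_of_le hαβ, integral_sub i1 (i2.const_mul κ),
    integral_const_mul] at key
  have hsplit : ∫ t in Ioc α β, F t * gammaDensity l κ t
      = F l * (∫ t in Ioc α β, gammaDensity l κ t)
        + ∫ t in Ioc α β, (t - l) * D t * gammaDensity l κ t := by
    rw [← integral_const_mul, ← integral_add (i3.const_mul _) i2]
    refine setIntegral_congr_fun measurableSet_Ioc fun t _ => ?_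
    have := sub_smul_dslope F l t
    rw [smul_eq_mul] at this
    simp only [hD]
    rw [this]
    ring
  rw [hsplit, ← key]
  field_simp
  ring

/-- The expansion of the mean of an analytic function over the interval. -/
lemma exists_abs_integral_Ioc_sub_le {l α β η : ℝ} (hl : 0 ≤ l) (hI : LocalInterval l α β η)
    (N : ℕ) {F : ℝ → ℝ} (hF : ∀ t ∈ insert l (Ioi 0), AnalyticAt ℝ F t) :
    ∃ C, 0 ≤ C ∧ ∀ κ, 1 ≤ κ →
      |(∫ t in Ioc α β, F t * gammaDensity l κ t)
        - (∑ k ∈ Finset.range N, (stepOp l)^[k] F l / κ ^ k) * gammaMass l κ|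
        ≤ C / κ ^ N * gammaMass l κ := by
  have hα0 : 0 ≤ α := by rcases hI.left with h | h <;> linarith [h.1]
  have hsub : Ioc α β ⊆ Ioi 0 := fun t ht => hα0.trans_lt ht.1
  induction N generalizing F with
  | zero =>
    obtain ⟨C, hC⟩ := (isCompact_Icc (a := α) (b := β)).exists_bound_of_continuousOn (f := F)
      fun t ht => (hF t (hI.Icc_subset ht)).continuousAt.continuousWithinAt
    refine ⟨|C|, abs_nonneg _, fun κ hκ => ?_⟩
    have hκ0 : 0 < κ := by linarith
    have i := integrableOn_gammaDensity hl hκ0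
    rw [Finset.range_zero, Finset.sum_empty, zero_mul, sub_zero, pow_zero, div_one]
    calc |∫ t in Ioc α β, F t * gammaDensity l κ t|
        ≤ ∫ t in Ioc α β, |F t * gammaDensity l κ t| := abs_integral_le_integral_abs
      _ ≤ ∫ t in Ioc α β, |C| * gammaDensity l κ t := by
          refine setIntegral_mono_on (integrableOn_mul_gammaDensity hl hκ0 hI hF).abs
            ((i.mono_set hsub).const_mul _) measurableSet_Ioc fun t ht => ?_
          have ht0 : 0 < t := hsub ht
          rw [abs_mul, abs_of_nonneg (gammaDensity_nonneg ht0.le)]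
          refine mul_le_mul_of_nonneg_right ?_ (gammaDensity_nonneg ht0.le)
          exact (hC t (Ioc_subset_Icc_self ht)).trans (le_abs_self C)
      _ = |C| * ∫ t in Ioc α β, gammaDensity l κ t := integral_const_mul _ _
      _ ≤ |C| * gammaMass l κ := by
          refine mul_le_mul_of_nonneg_left ?_ (abs_nonneg _)
          refine setIntegral_mono_set i ?_ hsub.eventuallyLE
          filter_upwards [ae_restrict_mem measurableSet_Ioi] with t ht
          exact gammaDensity_nonneg (le_of_lt ht)
  | succ N ih =>
    obtain ⟨C₁, hC₁0, hC₁⟩ := ih (F := stepOp l F) fun t ht => analyticAt_stepOp (hF t ht)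
    obtain ⟨C₂, hC₂0, hC₂⟩ := exists_tail_le hl hI (F := fun _ => 1)
      (fun κ hκ => by simpa using integrableOn_gammaDensity hl (by linarith)) (N + 1)
    obtain ⟨C₃, hC₃0, hC₃⟩ := exists_exp_le_gammaMass hl hI.pos (N + 1)
    set b₁ := |√β * dslope F l β| with hb₁
    set b₂ := |√α * dslope F l α| with hb₂
    refine ⟨|F l| * C₂ + C₁ + (C₃ * b₁ + C₃ * b₂), by positivity, fun κ hκ => ?_⟩
    have hκ0 : 0 < κ := by linarith
    have hm := gammaMass_pos hl hκ0
    have h1 := hC₁ κ hκ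
    have h2 := hC₂ κ hκ
    have h3 := hC₃ κ hκ
    simp only [one_mul] at h2
    change |gammaMass l κ - _| ≤ _ at h2
    rw [integral_stepOp hl hκ0 hI hF]
    have hsum : ∑ k ∈ Finset.range (N + 1), (stepOp l)^[k] F l / κ ^ k
        = F l + κ⁻¹ * ∑ k ∈ Finset.range N, (stepOp l)^[k] (stepOp l F) l / κ ^ k := by
      rw [Finset.sum_range_succ', Finset.mul_sum, add_comm]
      congr 1
      · simp
      · refine Finset.sum_congr rfl fun k _ => ?_
        rw [Function.iterate_succ_apply, pow_succ]
        field_simp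
    rw [hsum]
    set S := ∑ k ∈ Finset.range N, (stepOp l)^[k] (stepOp l F) l / κ ^ k
    set I₀ := ∫ t in Ioc α β, gammaDensity l κ t
    set I₁ := ∫ t in Ioc α β, stepOp l F t * gammaDensity l κ t
    set e₁ := Real.exp (-κ * genPhase 0 l β) * (√β * dslope F l β) with he₁
    set e₂ := Real.exp (-κ * genPhase 0 l α) * (√α * dslope F l α) with he₂
    set E := C₃ / κ ^ (N + 1) * gammaMass l κ with hE
    have hE0 : 0 ≤ E := by positivity
    have hκinv : |κ⁻¹| ≤ 1 := by
      rw [abs_of_pos (by positivity)]; exact inv_le_one_of_one_le₀ hκ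
    have he₁b : |e₁| ≤ E * b₁ := by
      rw [he₁, abs_mul, abs_of_pos (Real.exp_pos _)]
      refine mul_le_mul_of_nonneg_right (le_trans (Real.exp_le_exp.2 ?_) h3) (abs_nonneg _)
      nlinarith [hI.bound_right]
    have he₂b : |e₂| ≤ E * b₂ := by
      rcases hI.bound_left with h0 | h0
      · -- `√α = 0`.
        have : e₂ = 0 := by rw [he₂, h0]; simp
        rw [this, abs_zero]
        positivity
      · rw [he₂, abs_mul, abs_of_pos (Real.exp_pos _)]
        refine mul_le_mul_of_nonneg_right (le_trans (Real.exp_le_exp.2 ?_) h3) (abs_nonneg _)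
        nlinarith
    have hsplit : F l * I₀ + κ⁻¹ * I₁ - κ⁻¹ * (e₁ - e₂) - (F l + κ⁻¹ * S) * gammaMass l κ
        = -(F l * (gammaMass l κ - I₀)) + κ⁻¹ * (I₁ - S * gammaMass l κ) - κ⁻¹ * (e₁ - e₂) := by
      ring
    rw [hsplit]
    have t1 : |-(F l * (gammaMass l κ - I₀))| ≤ |F l| * (C₂ / κ ^ (N + 1) * gammaMass l κ) := by
      rw [abs_neg, abs_mul]; gcongr
    have t2 : |κ⁻¹ * (I₁ - S * gammaMass l κ)| ≤ κ⁻¹ * (C₁ / κ ^ N * gammaMass l κ) := by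
      rw [abs_mul, abs_of_pos (by positivity : 0 < κ⁻¹)]; gcongr
    have t3 : |κ⁻¹ * (e₁ - e₂)| ≤ E * b₁ + E * b₂ := by
      rw [abs_mul]
      calc |κ⁻¹| * |e₁ - e₂| ≤ 1 * |e₁ - e₂| := by gcongr
        _ ≤ |e₁| + |e₂| := by rw [one_mul]; exact abs_sub _ _
        _ ≤ _ := add_le_add he₁b he₂b
    refine (abs_sub _ _).trans ((add_le_add ((abs_add_le _ _).trans (add_le_add t1 t2)) t3).trans
      (le_of_eq ?_))
    rw [hE, pow_succ]
    field_simp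

/-- The expansion of `U / leading` as `z → ∞` with `a / z² = l` fixed. -/
theorem exists_abs_U_div_leading_sub_coeff_le {l : ℝ} (hl : 0 ≤ l) (N : ℕ) :
    ∃ C, 0 ≤ C ∧ ∀ z, 1 ≤ z →
      |U (l * z ^ 2) z / leading (l * z ^ 2) z - ∑ k ∈ Finset.range N, coeff k l / (z ^ 2) ^ k|
        ≤ C / (z ^ 2) ^ N := by
  obtain ⟨F, hF, hFf⟩ := exists_analytic_extension hl
  obtain ⟨α, β, η, hI⟩ := exists_localInterval hl
  have hint : ∀ κ, 1 ≤ κ → IntegrableOn (fun t => F t * gammaDensity l κ t) (Ioi 0) := by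
    intro κ hκ
    have := (U_div_leading_eq_mean hl (Real.sqrt_pos.2 (by linarith : 0 < κ)) hFf).1
    rwa [Real.sq_sqrt (by linarith)] at this
  obtain ⟨C₁, hC₁0, hC₁⟩ := exists_abs_integral_Ioc_sub_le hl hI N hF
  obtain ⟨C₂, hC₂0, hC₂⟩ := exists_tail_le hl hI hint N
  refine ⟨C₂ + C₁, by positivity, fun z hz => ?_⟩
  have hz0 : 0 < z := by linarith
  have hκ : 1 ≤ z ^ 2 := one_le_pow₀ hz
  have hm := gammaMass_pos hl (by linarith : 0 < z ^ 2)
  have h1 := hC₁ _ hκ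
  have h2 := hC₂ _ hκ
  rw [(U_div_leading_eq_mean hl hz0 hFf).2]
  have hcoef : ∑ k ∈ Finset.range N, coeff k l / (z ^ 2) ^ k
      = ∑ k ∈ Finset.range N, (stepOp l)^[k] F l / (z ^ 2) ^ k := by
    refine Finset.sum_congr rfl fun k _ => ?_
    rw [(f_eq_iterate hl hF (fun t ht htl => by rw [f_zero_eq hl ht htl, hFf t ht]) k).2.2.2]
  rw [hcoef, ← mul_le_mul_iff_left₀ hm, ← abs_of_pos hm, ← abs_mul, abs_of_pos hm, sub_mul,
    div_mul_cancel₀ _ hm.ne']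
  have h3 := (abs_add_le _ _).trans (add_le_add h2 h1)
  rw [sub_add_sub_cancel] at h3
  refine h3.trans (le_of_eq ?_)
  ring

/-! ### Comparison of the two expansions -/

/-- Uniqueness of asymptotic expansions in powers of `1/κ`. -/
lemma asymptotic_coeff_unique {V : ℝ → ℝ} {c d : ℕ → ℝ}
    (hc : ∀ N, ∃ C, ∀ᶠ κ in atTop, |V κ - ∑ k ∈ Finset.range N, c k / κ ^ k| ≤ C / κ ^ N)
    (hd : ∀ N, ∃ C, ∀ᶠ κ in atTop, |V κ - ∑ k ∈ Finset.range N, d k / κ ^ k| ≤ C / κ ^ N) :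
    c = d := by
  funext n
  induction n using Nat.strong_induction_on with
  | _ n ih =>
    obtain ⟨C₁, h₁⟩ := hc (n + 1)
    obtain ⟨C₂, h₂⟩ := hd (n + 1)
    have hsum : ∀ κ : ℝ, ∑ k ∈ Finset.range n, c k / κ ^ k = ∑ k ∈ Finset.range n, d k / κ ^ k :=
      fun κ => Finset.sum_congr rfl fun k hk => by rw [ih k (Finset.mem_range.1 hk)]
    have hb : ∀ᶠ κ in atTop, |c n - d n| ≤ (C₁ + C₂) / κ := by
      filter_upwards [h₁, h₂, eventually_gt_atTop 0] with κ h1 h2 hκ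
      rw [Finset.sum_range_succ] at h1 h2
      rw [hsum] at h1
      have h3 : |(c n - d n) / κ ^ n| ≤ C₁ / κ ^ (n + 1) + C₂ / κ ^ (n + 1) := by
        rw [abs_sub_comm] at h1
        refine le_trans (le_of_eq ?_) ((abs_add_le _ _).trans (add_le_add h1 h2))
        congr 1
        ring
      rw [abs_div, abs_of_pos (by positivity : 0 < κ ^ n), div_le_iff₀ (by positivity)] at h3
      refine h3.trans (le_of_eq ?_)
      rw [pow_succ]
      field_simp
    have h0 : Tendsto (fun κ : ℝ => (C₁ + C₂) / κ) atTop (𝓝 0) :=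
      tendsto_const_nhds.div_atTop tendsto_id
    have := ge_of_tendsto h0 hb
    have := abs_nonpos_iff.1 this
    linarith

/-- The polynomial cofactor of `X ^ k` in `φ_k`. -/
noncomputable def phiCofactor (k : ℕ) : Polynomial ℝ := (exists_phiPoly_eq k).choose

lemma phiPoly_eval_eq (k : ℕ) (x : ℝ) :
    (phiPoly k).eval x = x ^ k * (phiCofactor k).eval x := by
  have h : phiPoly k = Polynomial.X ^ k * phiCofactor k := (exists_phiPoly_eq k).choose_spec.1
  rw [h]
  simp

/-- The polynomial `p_k(σ) = φ_k(σ - 1) / (2 (σ - 1))^k`. -/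
noncomputable def coeffPoly (k : ℕ) : Polynomial ℝ :=
  Polynomial.C ((1 / 2) ^ k) * Polynomial.taylor (-1) (phiCofactor k)

lemma degree_coeffPoly (k : ℕ) : (coeffPoly k).degree = ((2 * k : ℕ) : WithBot ℕ) := by
  rw [coeffPoly, Polynomial.degree_C_mul (by positivity), Polynomial.degree_taylor]
  exact (exists_phiPoly_eq k).choose_spec.2

lemma eval_coeffPoly (k : ℕ) (x : ℝ) :
    (coeffPoly k).eval x = (1 / 2) ^ k * (phiCofactor k).eval (x - 1) := by
  rw [coeffPoly, Polynomial.eval_mul, Polynomial.eval_C, Polynomial.taylor_eval, sub_eq_add_neg]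

lemma sqrt_four_mul_add_sq_pos {a z : ℝ} (ha : 0 ≤ a) (hz : 0 < z) : 0 < √(4 * a + z ^ 2) := by
  positivity

lemma sigma_mem {a z : ℝ} (ha : 0 ≤ a) (hz : 0 < z) : sigma a z ∈ Icc (1 / 2 : ℝ) 1 := by
  have h := sqrt_four_mul_add_sq_pos ha hz
  have h1 : z / √(4 * a + z ^ 2) ≤ 1 := by
    rw [div_le_one h]; exact Real.le_sqrt_of_sq_le (by linarith)
  have h2 : 0 ≤ z / √(4 * a + z ^ 2) := by positivity
  rw [sigma]
  constructor <;> linarith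

lemma rho_div_sq {a z : ℝ} (ha : 0 ≤ a) (hz : 0 < z) :
    rho a z / z ^ 2 = 1 / ((4 * a + z ^ 2) * sigma a z) := by
  have h := sqrt_four_mul_add_sq_pos ha hz
  have h2 := Real.sq_sqrt (by positivity : 0 ≤ 4 * a + z ^ 2)
  have hs : 0 < sigma a z := by linarith [(sigma_mem ha hz).1]
  have e : 2 * sigma a z - 1 = z / √(4 * a + z ^ 2) := by rw [sigma]; ring
  rw [rho, e, div_pow, h2]
  field_simp

lemma sigma_eq_tau {μ t : ℝ} (hμ : 0 < μ) : sigma (μ ^ 2 / 2) (μ * √2 * t) = tau t + 1 := by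
  have h2 : √2 ^ 2 = (2 : ℝ) := Real.sq_sqrt (by norm_num)
  have e : √(4 * (μ ^ 2 / 2) + (μ * √2 * t) ^ 2) = μ * √2 * √(1 + t ^ 2) := by
    rw [← Real.sqrt_sq (by positivity : 0 ≤ μ * √2), ← Real.sqrt_mul (by positivity),
      Real.sqrt_sq (by positivity)]
    congr 1
    linear_combination (-μ ^ 2) * h2
  rw [sigma, e, tau, mul_div_mul_left _ _ (by positivity)]
  ring

lemma rho_div_sq_eq_tau {μ t : ℝ} (hμ : 0 < μ) (ht : 0 < t) :
    rho (μ ^ 2 / 2) (μ * √2 * t) / (μ * √2 * t) ^ 2 = 2 * (-tau t / μ ^ 2) := by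
  have h2 : √2 ^ 2 = (2 : ℝ) := Real.sq_sqrt (by norm_num)
  have h1 := tau_mul_tau_add_one t
  rw [sq_sqrt_one_add_sq] at h1
  have h3 : 0 < tau t + 1 := by linarith [neg_half_le_tau ht.le]
  rw [rho_div_sq (by positivity) (by positivity), sigma_eq_tau hμ,
    show 4 * (μ ^ 2 / 2) + (μ * √2 * t) ^ 2 = 2 * μ ^ 2 * (1 + t ^ 2) by
      linear_combination (μ ^ 2 * t ^ 2) * h2]
  field_simp at h1 ⊢
  linarith

/-- The uniform expansion in the variables `a > 0`, `z > 0`. -/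
lemma exists_abs_U_div_leading_sub_le_of_pos (N : ℕ) :
    ∃ C, ∀ a z : ℝ, 0 < a → 0 < z → 2 ≤ 4 * a + z ^ 2 →
      |U a z / leading a z - ∑ k ∈ Finset.range N,
          rho a z ^ k * (coeffPoly k).eval (sigma a z) / z ^ (2 * k)|
        ≤ C * (rho a z / z ^ 2) ^ N := by
  obtain ⟨C, hC⟩ := exists_abs_U_div_leadingOlver_sub_le N
  refine ⟨C * (1 / 2) ^ N, fun a z ha hz haz => ?_⟩
  have h2 : √2 ^ 2 = (2 : ℝ) := Real.sq_sqrt (by norm_num)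
  obtain ⟨μ, t, hμ, ht, rfl, rfl⟩ :
      ∃ μ t : ℝ, 0 < μ ∧ 0 < t ∧ a = μ ^ 2 / 2 ∧ z = μ * √2 * t := by
    -- This is where `a > 0` is needed.
    refine ⟨√(2 * a), z / (√(2 * a) * √2), by positivity, by positivity, ?_, ?_⟩
    · rw [Real.sq_sqrt (by positivity)]; ring
    · field_simp
  have h := hC μ t hμ ht.le (by nlinarith)
  rw [leading_eq_leadingOlver hμ ht, rho_div_sq_eq_tau hμ ht]
  have hsum : ∑ k ∈ Finset.range N, rho (μ ^ 2 / 2) (μ * √2 * t) ^ k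
        * (coeffPoly k).eval (sigma (μ ^ 2 / 2) (μ * √2 * t)) / (μ * √2 * t) ^ (2 * k)
      = (partialSum (μ ^ 2) N).eval (tau t) := by
    rw [partialSum, Polynomial.eval_finsetSum]
    refine Finset.sum_congr rfl fun k _ => ?_
    rw [Polynomial.eval_mul, Polynomial.eval_C, phiPoly_eval_eq, eval_coeffPoly, sigma_eq_tau hμ,
      add_sub_cancel_right, pow_mul, mul_div_right_comm, ← div_pow, rho_div_sq_eq_tau hμ ht,
      ← mul_assoc, ← mul_assoc, ← mul_pow, ← div_pow, ← mul_pow]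
    congr 2
    ring
  rw [hsum]
  refine h.trans (le_of_eq ?_)
  rw [mul_pow 2, mul_assoc, ← mul_assoc ((1 / 2) ^ N), ← mul_pow]
  norm_num

/-- For `0 < a < 1`, `s^{a - 1/2}` is dominated by `s^{-1/2} + s^{1/2}`. -/
lemma tendsto_J_nhdsGT_zero (z : ℝ) :
    Tendsto (fun a => J (a - 1 / 2) z) (𝓝[>] 0) (𝓝 (J (0 - 1 / 2) z)) := by
  refine tendsto_integral_filter_of_dominated_convergence
    (fun s => s ^ (-(1 / 2) : ℝ) * Real.exp (-s ^ 2 / 2 - z * s)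
      + s ^ (1 / 2 : ℝ) * Real.exp (-s ^ 2 / 2 - z * s)) ?_ ?_ ?_ ?_
  · exact Eventually.of_forall fun a => aestronglyMeasurable_J_integrand _ z
  · filter_upwards [self_mem_nhdsWithin, nhdsWithin_le_nhds (gt_mem_nhds one_pos)] with a ha0 ha1
    filter_upwards [ae_restrict_mem measurableSet_Ioi] with s hs
    have hs' : (0 : ℝ) < s := hs
    have ha0' : 0 < a := ha0
    rw [Real.norm_of_nonneg (by positivity), ← add_mul]
    refine mul_le_mul_of_nonneg_right ?_ (Real.exp_pos _).le
    rcases le_total 1 s with h | h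
    · have h1 : s ^ (a - 1 / 2) ≤ s ^ (1 / 2 : ℝ) :=
        Real.rpow_le_rpow_of_exponent_le h (by linarith)
      have : 0 ≤ s ^ (-(1 / 2) : ℝ) := by positivity
      linarith
    · have h1 : s ^ (a - 1 / 2) ≤ s ^ (-(1 / 2) : ℝ) :=
        Real.rpow_le_rpow_of_exponent_ge hs' h (by linarith)
      have : 0 ≤ s ^ (1 / 2 : ℝ) := by positivity
      linarith
  · exact (integrableOn_J (by norm_num) z).add (integrableOn_J (by norm_num) z)
  · filter_upwards [ae_restrict_mem measurableSet_Ioi] with s hs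
    have hs' : (0 : ℝ) < s := hs
    have hc : Continuous fun a : ℝ => s ^ (a - 1 / 2) * Real.exp (-s ^ 2 / 2 - z * s) :=
      (Continuous.rpow continuous_const (by fun_prop) fun _ => Or.inl hs'.ne').mul
        continuous_const
    exact (hc.tendsto 0).mono_left nhdsWithin_le_nhds

lemma tendsto_U_div_leading_nhdsGT_zero {z : ℝ} (hz : 0 < z) :
    Tendsto (fun a => U a z / leading a z) (𝓝[>] 0) (𝓝 (U 0 z / leading 0 z)) := by
  have e : ∀ a, 0 ≤ a → U a z / leading a z
      = z ^ (a + 1 / 2) * J (a - 1 / 2) z / Real.Gamma (a + 1 / 2)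
      * Real.exp (a / z ^ 2 * (saddleRatio (a / z ^ 2) / 2 - 1 / 2
        - Real.log (saddleRatio (a / z ^ 2))) * z ^ 2)
      * (1 + 4 * (a / z ^ 2)) ^ (1 / 4 : ℝ) := fun a ha => by
    rw [U_div_leading ha hz, A_eq (by positivity)]
  rw [e 0 le_rfl]
  refine Tendsto.congr' (f₁ := fun a => z ^ (a + 1 / 2) * J (a - 1 / 2) z / Real.Gamma (a + 1 / 2)
      * Real.exp (a / z ^ 2 * (saddleRatio (a / z ^ 2) / 2 - 1 / 2
        - Real.log (saddleRatio (a / z ^ 2))) * z ^ 2)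
      * (1 + 4 * (a / z ^ 2)) ^ (1 / 4 : ℝ)) ?_ ?_
  · filter_upwards [self_mem_nhdsWithin] with a ha
    exact (e a (le_of_lt ha)).symm
  have h1 : Tendsto (fun a : ℝ => z ^ (a + 1 / 2)) (𝓝[>] 0) (𝓝 (z ^ ((0 : ℝ) + 1 / 2))) := by
    have hc : Continuous fun a : ℝ => z ^ (a + 1 / 2) :=
      Continuous.rpow continuous_const (by fun_prop) fun _ => Or.inl hz.ne'
    exact (hc.tendsto 0).mono_left nhdsWithin_le_nhds
  have h2 : Tendsto (fun a : ℝ => Real.Gamma (a + 1 / 2)) (𝓝[>] 0)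
      (𝓝 (Real.Gamma (0 + 1 / 2))) := by
    have hg : ContinuousAt Real.Gamma (0 + 1 / 2) := by
      refine (Real.differentiableAt_Gamma fun m => ?_).continuousAt
      have : (0 : ℝ) ≤ m := m.cast_nonneg
      intro h
      linarith
    have hc : ContinuousAt (fun a : ℝ => Real.Gamma (a + 1 / 2)) 0 :=
      ContinuousAt.comp (f := fun a : ℝ => a + 1 / 2) hg (by fun_prop)
    exact hc.tendsto.mono_left nhdsWithin_le_nhds
  have h3 : Continuous fun a : ℝ => Real.exp (a / z ^ 2 * (saddleRatio (a / z ^ 2) / 2 - 1 / 2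
      - Real.log (saddleRatio (a / z ^ 2))) * z ^ 2) := by
    have := continuous_saddleRatio_combination.comp (continuous_id.div_const (z ^ 2))
    exact (((continuous_id.div_const (z ^ 2)).mul this).mul continuous_const).rexp
  have h4 : Continuous fun a : ℝ => (1 + 4 * (a / z ^ 2)) ^ (1 / 4 : ℝ) :=
    Continuous.rpow_const (by fun_prop) fun _ => Or.inr (by norm_num)
  have hG : Real.Gamma (0 + 1 / 2) ≠ 0 := (Real.Gamma_pos_of_pos (by norm_num)).ne'
  exact (((h1.mul (tendsto_J_nhdsGT_zero z)).div h2 hG).mul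
    ((h3.tendsto 0).mono_left nhdsWithin_le_nhds)).mul
    ((h4.tendsto 0).mono_left nhdsWithin_le_nhds)

/-- The uniform expansion in the variables `a ≥ 0`, `z > 0`, the case `a = 0` being a limit. -/
theorem exists_abs_U_div_leading_sub_le (N : ℕ) :
    ∃ C, ∀ a z : ℝ, 0 ≤ a → 0 < z → 2 ≤ 4 * a + z ^ 2 →
      |U a z / leading a z - ∑ k ∈ Finset.range N,
          rho a z ^ k * (coeffPoly k).eval (sigma a z) / z ^ (2 * k)|
        ≤ C * (rho a z / z ^ 2) ^ N := by
  obtain ⟨C, hC⟩ := exists_abs_U_div_leading_sub_le_of_pos N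
  refine ⟨C, fun a z ha hz haz => ?_⟩
  rcases ha.eq_or_lt with rfl | ha'
  swap
  · exact hC a z ha' hz haz
  have hσ : ContinuousAt (fun a => sigma a z) 0 := by
    have h := (sqrt_four_mul_add_sq_pos le_rfl hz).ne'
    have hs : ContinuousAt (fun a => √(4 * a + z ^ 2)) 0 := by fun_prop
    unfold sigma
    exact (continuousAt_const.add (continuousAt_const.div hs h)).div_const 2
  have hρ : ContinuousAt (fun a => rho a z) 0 := by
    have h : sigma 0 z ≠ 0 := by linarith [(sigma_mem le_rfl hz).1]
    unfold rho
    exact (((hσ.const_mul 2).sub continuousAt_const).pow 2).div hσ h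
  have hsum : ContinuousAt (fun a => ∑ k ∈ Finset.range N,
      rho a z ^ k * (coeffPoly k).eval (sigma a z) / z ^ (2 * k)) 0 := by
    refine tendsto_finsetSum _ fun k _ => ?_
    exact ((hρ.pow k).mul
      ((coeffPoly k).continuous.continuousAt.comp (f := fun a => sigma a z) hσ)).div_const _
  have hrhs : ContinuousAt (fun a => C * (rho a z / z ^ 2) ^ N) 0 :=
    ((hρ.div_const _).pow N).const_mul C
  refine le_of_tendsto_of_tendsto
    ((tendsto_U_div_leading_nhdsGT_zero hz).sub (hsum.tendsto.mono_left nhdsWithin_le_nhds)).abs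
    (hrhs.tendsto.mono_left nhdsWithin_le_nhds) ?_
  filter_upwards [self_mem_nhdsWithin] with a ha'
  have ha0 : 0 < a := ha'
  exact hC a z ha0 hz (by linarith)

lemma sigma_mul_sq {l z : ℝ} (hz : 0 < z) : sigma (l * z ^ 2) z = sigma l 1 := by
  have e : √(4 * (l * z ^ 2) + z ^ 2) = z * √(4 * l + 1 ^ 2) := by
    rw [show 4 * (l * z ^ 2) + z ^ 2 = z ^ 2 * (4 * l + 1 ^ 2) by ring,
      Real.sqrt_mul (by positivity), Real.sqrt_sq hz.le]
  rw [sigma, sigma, e, div_mul_eq_div_div, div_self hz.ne']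

lemma rho_mul_sq {l z : ℝ} (hz : 0 < z) : rho (l * z ^ 2) z = rho l 1 := by
  rw [rho, rho, sigma_mul_sq hz]

/-- Both expansions hold along `a = l z²`, so their coefficients agree. -/
theorem coeff_eq {l : ℝ} (hl : 0 ≤ l) (k : ℕ) :
    coeff k l = rho l 1 ^ k * (coeffPoly k).eval (sigma l 1) := by
  have key : (fun k => coeff k l) = fun k => rho l 1 ^ k * (coeffPoly k).eval (sigma l 1) := by
    refine asymptotic_coeff_unique (V := fun κ => U (l * κ) √κ / leading (l * κ) √κ)
      (fun N => ?_) (fun N => ?_)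
    · obtain ⟨C, -, hC⟩ := exists_abs_U_div_leading_sub_coeff_le hl N
      refine ⟨C, ?_⟩
      filter_upwards [eventually_ge_atTop 1] with κ hκ
      have h := hC √κ (Real.one_le_sqrt.2 hκ)
      rwa [Real.sq_sqrt (by linarith)] at h
    · obtain ⟨C, hC⟩ := exists_abs_U_div_leading_sub_le N
      refine ⟨C * rho l 1 ^ N, ?_⟩
      filter_upwards [eventually_ge_atTop 2] with κ hκ
      have hκ0 : 0 < κ := by linarith
      have hs := Real.sq_sqrt hκ0.le
      have hs0 := Real.sqrt_pos.2 hκ0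
      have h := hC (l * √κ ^ 2) √κ (by positivity) hs0 (by
        rw [hs]; nlinarith [mul_nonneg hl hκ0.le])
      rw [rho_mul_sq hs0, sigma_mul_sq hs0] at h
      simp only [pow_mul, hs] at h
      rw [div_pow, ← mul_div_assoc] at h
      exact h
  exact congrFun key k

lemma coeff_eq_rho_sigma {a z : ℝ} (ha : 0 ≤ a) (hz : 0 < z) (k : ℕ) :
    coeff k (a / z ^ 2) = rho a z ^ k * (coeffPoly k).eval (sigma a z) := by
  have e : a = a / z ^ 2 * z ^ 2 := by field_simp
  conv_rhs => rw [e]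
  rw [rho_mul_sq hz, sigma_mul_sq hz, coeff_eq (by positivity)]

lemma coeff_eq_phi (k : ℕ) {t : ℝ} (ht : 0 < t) :
    (-1) ^ k / (2 * t ^ 2) ^ k * coeff k (1 / (4 * t ^ 2)) = phi k (tau t) := by
  -- `ρ` and `σ` depend on `a / z²` only, so `μ` may be chosen such that `z = μ √2 t = 1`.
  set μ := 1 / (√2 * t) with hμ
  have h2 : √2 ^ 2 = (2 : ℝ) := Real.sq_sqrt (by norm_num)
  have hμ0 : 0 < μ := by positivity
  have hz : μ * √2 * t = 1 := by rw [hμ]; field_simp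
  have hμ2 : μ ^ 2 = 1 / (2 * t ^ 2) := by rw [hμ, div_pow, mul_pow, h2, one_pow]
  have ha : μ ^ 2 / 2 = 1 / (4 * t ^ 2) := by rw [hμ2]; field_simp; norm_num
  have hσ := sigma_eq_tau (t := t) hμ0
  have hρ := rho_div_sq_eq_tau hμ0 ht
  rw [ha, hz] at hσ hρ
  rw [one_pow, div_one, hμ2] at hρ
  rw [coeff_eq (by positivity), hρ, hσ, eval_coeffPoly, phi_eq_eval, phiPoly_eval_eq,
    add_sub_cancel_right, ← mul_assoc, ← mul_assoc, ← div_pow, ← mul_pow, ← mul_pow]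
  congr 2
  field_simp

end ParabolicCylinder

theorem mainTheorem3 :
    -- the map `t ↦ w(t)` and the functions `f_k` are well defined
    (∀ l : ℝ, 0 ≤ l →
      (∀ t : ℝ, 0 < t →
        0 < ParabolicCylinder.w l t ∧
        ParabolicCylinder.phase l (ParabolicCylinder.w l t)
          = t - l * Real.log t + ParabolicCylinder.A l ∧
        (t < l ↔ ParabolicCylinder.w l t < ParabolicCylinder.saddle l) ∧
        (l < t ↔ ParabolicCylinder.saddle l < ParabolicCylinder.w l t)) ∧
      (∀ k : ℕ,
        ContDiffOn ℝ ∞ (ParabolicCylinder.f l k) (Set.Ioi 0 \ {l}) ∧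
        Filter.Tendsto (ParabolicCylinder.f l k) (𝓝[Set.Ioi 0 \ {l}] l)
          (𝓝 (ParabolicCylinder.coeff k l)))) ∧
    -- `f_k(l)` is `ρ^k` times a polynomial of degree `2k` in `σ ∈ [0, 1]`
    (∀ a z : ℝ, 0 ≤ a → 0 < z → ParabolicCylinder.sigma a z ∈ Set.Icc (0 : ℝ) 1) ∧
    (∀ k : ℕ, ∃ p : Polynomial ℝ, p.degree = ((2 * k : ℕ) : WithBot ℕ) ∧
      ∀ a z : ℝ, 0 ≤ a → 0 < z →
        ParabolicCylinder.coeff k (a / z ^ 2)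
          = ParabolicCylinder.rho a z ^ k * p.eval (ParabolicCylinder.sigma a z)) ∧
    -- `(ρ / z²)^k` is an asymptotic scale when `a` or `z` is large
    (∀ ε : ℝ, 0 < ε → ∃ R : ℝ, ∀ a z : ℝ, 0 ≤ a → 0 < z → (R ≤ z ∨ R ≤ a) →
      0 < ParabolicCylinder.rho a z / z ^ 2 ∧ ParabolicCylinder.rho a z / z ^ 2 < ε) ∧
    -- the expansion, uniform in `a ≥ 0` as `z → ∞` and uniform in `z > 0` as `a → ∞`
    (∀ N : ℕ, ∃ C R : ℝ, ∀ a z : ℝ, 0 ≤ a → 0 < z → (R ≤ z ∨ R ≤ a) →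
      |ParabolicCylinder.U a z / ParabolicCylinder.leading a z
          - ∑ k ∈ Finset.range N, ParabolicCylinder.coeff k (a / z ^ 2) / z ^ (2 * k)|
        ≤ C * (ParabolicCylinder.rho a z / z ^ 2) ^ N) ∧
    -- the same expansion for `a = μ²/2`, `z = μ √2 t`, which includes `z = 0`
    (∀ μ t : ℝ, 0 < μ → 0 < t →
      ParabolicCylinder.leading (μ ^ 2 / 2) (μ * √2 * t)
        = ParabolicCylinder.leadingOlver μ t) ∧
    (∀ (k : ℕ) (t : ℝ), 0 < t →
      (-1) ^ k / (2 * t ^ 2) ^ k * ParabolicCylinder.coeff k (1 / (4 * t ^ 2))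
        = ParabolicCylinder.phi k (ParabolicCylinder.tau t)) ∧
    (∀ N : ℕ, ∃ C R : ℝ, ∀ μ t : ℝ, 0 < μ → 0 ≤ t → (R ≤ μ ∨ R ≤ μ * t) →
      |ParabolicCylinder.U (μ ^ 2 / 2) (μ * √2 * t) / ParabolicCylinder.leadingOlver μ t
          - ∑ k ∈ Finset.range N,
              (-1) ^ k * ParabolicCylinder.phi k (ParabolicCylinder.tau t) / μ ^ (2 * k)|
        ≤ C * (|ParabolicCylinder.tau t| / μ ^ 2) ^ N) := by
  refine ⟨fun l hl => ⟨fun t ht => ?_, fun k => ⟨?_, ?_⟩⟩, fun a z ha hz => ?_, fun k => ?_,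
    fun ε hε => ?_, fun N => ?_, fun μ t hμ ht => ?_, fun k t ht => ?_, fun N => ?_⟩
  · have hlt := ParabolicCylinder.w_lt_saddle (l := l) ht
    have hgt := ParabolicCylinder.saddle_lt_w (t := t) hl
    have hself : t = l → ParabolicCylinder.w l t = ParabolicCylinder.saddle l := by
      rintro rfl
      exact ParabolicCylinder.w_self ht
    refine ⟨ParabolicCylinder.w_pos hl ht, ?_, ⟨hlt, fun h => ?_⟩, hgt, fun h => ?_⟩
    · rw [ParabolicCylinder.phase_eq_genPhase, ParabolicCylinder.rhs_eq]
      exact ParabolicCylinder.genPhase_w hl ht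
    · by_contra h0
      rcases (not_lt.1 h0).eq_or_lt with h1 | h1
      · exact h.ne (hself h1.symm)
      · exact lt_asymm h (hgt h1)
    · by_contra h0
      rcases (not_lt.1 h0).eq_or_lt with h1 | h1
      · exact h.ne' (hself h1)
      · exact lt_asymm h (hlt h1)
  · exact ParabolicCylinder.contDiffOn_f hl k
  · exact ParabolicCylinder.tendsto_f hl k
  · have h := ParabolicCylinder.sigma_mem ha hz
    exact ⟨by linarith [h.1], h.2⟩
  · exact ⟨ParabolicCylinder.coeffPoly k, ParabolicCylinder.degree_coeffPoly k,
      fun a z ha hz => ParabolicCylinder.coeff_eq_rho_sigma ha hz k⟩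
  · -- `ρ / z² = 1 / ((4a + z²) σ)` with `σ ≥ 1/2`.
    refine ⟨2 / ε + 1, fun a z ha hz hR => ?_⟩
    have hσ := (ParabolicCylinder.sigma_mem ha hz).1
    have hε2 : 0 < 2 / ε := by positivity
    have hX : 2 / ε < 4 * a + z ^ 2 := by
      rcases hR with h | h <;> nlinarith [sq_nonneg z]
    rw [ParabolicCylinder.rho_div_sq ha hz]
    have hpos : 0 < 4 * a + z ^ 2 := hε2.trans hX
    refine ⟨by positivity, ?_⟩
    rw [div_lt_iff₀ hε] at hX
    rw [div_lt_iff₀ (by positivity)]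
    nlinarith
  · obtain ⟨C, hC⟩ := ParabolicCylinder.exists_abs_U_div_leading_sub_le N
    -- `R = 2` ensures `4a + z² ≥ 2`.
    refine ⟨C, 2, fun a z ha hz hR => ?_⟩
    have h := hC a z ha hz (by rcases hR with h | h <;> nlinarith [sq_nonneg z])
    have hsum : ∑ k ∈ Finset.range N, ParabolicCylinder.coeff k (a / z ^ 2) / z ^ (2 * k)
        = ∑ k ∈ Finset.range N, ParabolicCylinder.rho a z ^ k
          * (ParabolicCylinder.coeffPoly k).eval (ParabolicCylinder.sigma a z) / z ^ (2 * k) :=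
      Finset.sum_congr rfl fun k _ => by rw [ParabolicCylinder.coeff_eq_rho_sigma ha hz]
    rwa [hsum]
  · exact ParabolicCylinder.leading_eq_leadingOlver hμ ht
  · exact ParabolicCylinder.coeff_eq_phi k ht
  · obtain ⟨C, hC⟩ := ParabolicCylinder.exists_abs_U_div_leadingOlver_sub_le N
    -- `R = 1` ensures `μ² (1 + t²) ≥ 1`.
    refine ⟨C, 1, fun μ t hμ ht hR => ?_⟩
    have h := hC μ t hμ ht (by
      have : 0 ≤ μ * t := by positivity
      rcases hR with h | h <;> nlinarith [sq_nonneg μ, sq_nonneg (μ * t)])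
    rw [abs_of_neg (ParabolicCylinder.tau_neg t)]
    have hsum : ∑ k ∈ Finset.range N,
        (-1) ^ k * ParabolicCylinder.phi k (ParabolicCylinder.tau t) / μ ^ (2 * k)
        = (ParabolicCylinder.partialSum (μ ^ 2) N).eval (ParabolicCylinder.tau t) := by
      rw [ParabolicCylinder.partialSum, Polynomial.eval_finsetSum]
      refine Finset.sum_congr rfl fun k _ => ?_
      rw [Polynomial.eval_mul, Polynomial.eval_C, ParabolicCylinder.phi_eq_eval, pow_mul]
      ring
    rwa [hsum]
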